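/- **Conventions.** Let $\Bbbk$ be a field of characteristic $0$ and $d\in\mathbb Z$. A graded quiver $\mathcal A$ with set of objects $\mathcal O_{\mathcal A}$ consists of $\mathbb Z$-graded vector spaces ${}_x\mathcal A_y$ for $x,y\in\mathcal O_{\mathcal A}$; $V[n]^i=V^{n+i}$, and $\mathcal A^*$ is the graded dual quiver, ${}_x\mathcal A^*_y=({}_y\mathcal A_x)^*$. Elements of $\mathcal A[1]$ are written $sa$, elements of $\mathcal A^*[d]$ are written $tf$, so that $|sa|=|a|-1$ and $|tf|=|f|-d$. If $\Phi_0:\mathcal O_{\mathcal A}\to\mathcal O_{\mathcal B}$ is a map, then $\mathcal A\oplus\mathcal B^*[d-1]$ is the graded quiver on $\mathcal O_{\mathcal A}$ with ${}_x\mathcal A_y\oplus{}_{\Phi_0(x)}\mathcal B^*_{\Phi_0(y)}[d-1]$ as morphism spaces. For a sequence $\bar x=(x_1,\dots,x_m)$ of objects, $m\ge1$, $\mathrm{lt}(\bar x)=x_1$, $\mathrm{rt}(\bar x)=x_m$ and $\mathcal A[1]^{\otimes\bar x}={}_{x_1}\mathcal A[1]_{x_2}\otimes\cdots\otimes{}_{x_{m-1}}\mathcal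 A[1]_{x_m}$. All operations below are without terms "with no input and at most one output" (for $n=1$, $\bar x^1$ has at least two entries). **Multi-output operations.** Let $\mathcal B$ be a graded quiver, and $F$ a family of linear maps $$F^{\bar x^1,\dots,\bar x^n}:\mathcal A[1]^{\otimes\bar x^1}\otimes\cdots\otimes\mathcal A[1]^{\otimes\bar x^n}\longrightarrow\bigotimes_{i=1}^{n}{}_{\Phi_0(\mathrm{lt}\,\bar x^i)}\mathcal B_{\Phi_0(\mathrm{rt}\,\bar x^{i+1})}[-d],\qquad n\ge1,\ \bar x^{n+1}=\bar x^1,$$ of degree $d+1+e$, invariant under the cyclic group $C_n$ (rotating input blocks and outputs together, with Koszul signs). It is a disc with $n$ outputs on its boundary, the inputs being placed between consecutive outputs; it is regarded as having degree $e$ after the shift by $d+1$. Contracting all outputs but the last with functionals gives, for each word $\sigma=(\bar{sa}^n,tf^{n-1},\bar{sa}^{n-1},\dots,tf^1,\bar{sa}^1)$ of elements of $\mathcal A[1]\oplus\mathcal B^*[d]$ from $x$ to $y$, an element $$\hat F(\sigma)=(-1)^{E(\sigma)}\,f^{1}(w_1)\cdots f^{n-1}(w_{n-1})\,s w_n\in{}_{\Phi_0(x)}\mathcal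 B[1]_{\Phi_0(y)},\qquad F(\bar{sa}^1,\dots,\bar{sa}^n)=w_1\otimes\cdots\otimes w_n\ \text{(sum understood)},$$ $$E(\sigma)=\sum_{i>j}|\bar{sa}^i|\,|\bar{sa}^j|+\sum_{i=1}^{n-1}|tf^i|\sum_{j>i}|\bar{sa}^j|+(e+1)\sum_{i=1}^{n-1}|tf^i|+(n-1)d ,$$ of degree $|\sigma|+e$. Set $\Gamma(sa,tf)=(-1)^{|sa||tf|+|tf|}f(a)$, $\Gamma(tf,sa)=(-1)^{|tf|+1}f(a)$, and define the closed value of $F$ on a cyclic word ending with a functional by $\langle F\,|\,\sigma\cdot tf\rangle=\Gamma(\hat F(\sigma),tf)$, extended to all cyclic words containing a functional by Koszul signs under rotation (this is well defined by $C_n$-invariance), and by $0$ to cyclic words without functional. Finally let $\check F(\sigma)\in{}_x\mathcal A^*_y[d]$ be the functional $b\mapsto(-1)^{|\sigma|}\langle F\,|\,\sigma\cdot sb\rangle$; it is $F$ with *all* its outputs contracted with the functionals of $\sigma$, the free input $sb$ being placed between the end and the beginning of $\sigma$. **$d$-pre-Calabi–Yau categories.** A $d$-pre-Calabi–Yau structure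 on $\mathcal A$ is such a family $M_{\mathcal A}$ with $\mathcal B=\mathcal A$, $\Phi_0=\mathrm{id}$, $e=1$, satisfying $M_{\mathcal A}\circ_{\mathrm{nec}}M_{\mathcal A}=0$: the sum, with Koszul signs, over all diagrams of two discs $M_{\mathcal A}$, one output of one disc being plugged into one input of the other, vanishes for every type $(\bar x^1,\dots,\bar x^n)$. **Morphisms.** A morphism $(\mathcal A,M_{\mathcal A})\to(\mathcal B,M_{\mathcal B})$ of $d$-pre-Calabi–Yau categories is a map $\Phi_0:\mathcal O_{\mathcal A}\to\mathcal O_{\mathcal B}$ with a family $\Phi$ as above, with $e=0$, such that for every type the sum over all diagrams consisting of one disc $M_{\mathcal A}$ with each of its outputs plugged into an input of a disc $\Phi$ equals the sum over all diagrams consisting of one disc $M_{\mathcal B}$ with each of its inputs fed by an output of a disc $\Phi$ (Koszul signs throughout, and each disc $\Phi$ being connected to the disc $M$ exactly once). **The maps $\varphi_{\mathcal A}$, $\varphi_{\mathcal B}$.** They are families of degree $0$ multilinear maps on words $\sigma$ of elements of $\mathcal A[1]\oplus\mathcal B^*[d]$ of length $\ge1$, over $\mathrm{id}$ and $\Phi_0$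 respectively: $$\varphi_{\mathcal A}:\mathcal A[1]\oplus\mathcal B^*[d]\to\mathcal A[1]\oplus\mathcal A^*[d],\qquad \varphi_{\mathcal A}(\sigma)=\mathrm{id}_{\mathcal A[1]}(\sigma)+\check\Phi(\sigma),$$ $$\varphi_{\mathcal B}:\mathcal A[1]\oplus\mathcal B^*[d]\to\mathcal B[1]\oplus\mathcal B^*[d],\qquad \varphi_{\mathcal B}(\sigma)=\mathrm{id}_{\mathcal B^*[d]}(\sigma)+\hat\Phi(\sigma),$$ where $\mathrm{id}_{\mathcal A[1]}(\sigma)=sa$ if $\sigma=(sa)$ and $0$ for every other word in elements of $\mathcal A[1]$ and of $\mathcal B^*[d]$, and likewise $\mathrm{id}_{\mathcal B^*[d]}(\sigma)=tf$ if $\sigma=(tf)$, and $0$ otherwise. In particular $\varphi_{\mathcal A}(tf)=tf\circ\Phi$ and $\varphi_{\mathcal B}(sa)=\Phi(sa)$. **The structures.** On $\mathcal A\oplus\mathcal A^*[d-1]$ put $sm_{\mathcal A\oplus\mathcal A^*}(\sigma)=\hat M_{\mathcal A}(\sigma)+\check M_{\mathcal A}(\sigma)$, and similarly for $\mathcal B$.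 On $\mathcal A\oplus\mathcal B^*[d-1]$ put $$sm_{\mathcal A\oplus\mathcal B^*}(\sigma)=\sum\hat M_{\mathcal A}\bigl(\varphi_{\mathcal A}(\sigma_1),\dots,\varphi_{\mathcal A}(\sigma_r)\bigr)+\sum\check M_{\mathcal B}\bigl(\varphi_{\mathcal B}(\sigma_1),\dots,\varphi_{\mathcal B}(\sigma_r)\bigr)\in{}_x\mathcal A[1]_y\oplus{}_{\Phi_0(x)}\mathcal B^*_{\Phi_0(y)}[d],$$ the sums being over all decompositions of $\sigma$ in consecutive nonempty words $\sigma_1\cdots\sigma_r$, where in the second sum the functional $\check M_{\mathcal B}(\dots)$ is the one on ${}_{\Phi_0(y)}\mathcal B_{\Phi_0(x)}$. That is: the part in $\mathcal A[1]$ is $M_{\mathcal A}$ with every output but one plugged into a disc $\Phi$, and the part in $\mathcal B^*[d]$ is $M_{\mathcal B}$ with every input but one fed by an output of a disc $\Phi$. **Proposition.** Let $(\mathcal A,M_{\mathcal A})$ and $(\mathcal B,M_{\mathcal B})$ be $d$-pre-Calabi–Yau categories and $(\Phi_0,\Phi):(\mathcal A,M_{\mathcal A})\to(\mathcal B,M_{\mathcal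 B})$ a morphism of $d$-pre-Calabi–Yau categories. Then $\varphi_{\mathcal A}$ is an $A_\infty$-morphism from the $A_\infty$-category $(\mathcal A\oplus\mathcal B^*[d-1],sm_{\mathcal A\oplus\mathcal B^*})$ to the $A_\infty$-category $(\mathcal A\oplus\mathcal A^*[d-1],sm_{\mathcal A\oplus\mathcal A^*})$, with the identity on objects, and $\varphi_{\mathcal B}$ is an $A_\infty$-morphism from $(\mathcal A\oplus\mathcal B^*[d-1],sm_{\mathcal A\oplus\mathcal B^*})$ to $(\mathcal B\oplus\mathcal B^*[d-1],sm_{\mathcal B\oplus\mathcal B^*})$, with $\Phi_0$ on objects. Here $sm$ is an $A_\infty$-structure if $\sum(-1)^{|\sigma'|}sm(\sigma',sm(\tau),\sigma'')=0$ for each word $\sigma$, and $\varphi$ is an $A_\infty$-morphism if $$\sum(-1)^{|\sigma'|}\varphi(\sigma',sm(\tau),\sigma'')=\sum sm\bigl(\varphi(\sigma_1),\dots,\varphi(\sigma_r)\bigr)$$ for each word $\sigma$, the sums being over the decompositions $\sigma=\sigma'\tau\sigma''$ with $\tau\ne\emptyset$, and over the decompositions $\sigma=\sigma_1\cdots\sigma_r$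 in nonempty words. -/

import Mathlib

open scoped DirectSum TensorProduct

universe u v v₁ v₂ w w₁ w₂

noncomputable section

/-! ### Graded quivers and words -/

/-- A `ℤ`-graded quiver over `k` with set of objects `O`: a `ℤ`-graded vector space
`Hom x y`, with homogeneous components `Hom x y p`, for all objects `x`, `y`. -/
structure GradedQuiver (k : Type u) [Field k] (O : Type w) where
  Hom : O → O → ℤ → Type v
  [grp : ∀ x y p, AddCommGroup (Hom x y p)]
  [mod : ∀ x y p, Module k (Hom x y p)]

attribute [instance] GradedQuiver.grp GradedQuiver.mod

namespace GradedQuiver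

variable {k : Type u} [Field k] {O : Type w}

/-- The underlying vector space of the graded space of morphisms from `x` to `y`. -/
abbrev Tot (Q : GradedQuiver.{u, v, w} k O) (x y : O) : Type v := ⨁ p, Q.Hom x y p

/-- Homogeneous morphisms from `x` to `y`, with their degree. -/
abbrev Letter (Q : GradedQuiver.{u, v, w} k O) (x y : O) : Type v := Σ p, Q.Hom x y p

/-- A homogeneous morphism as an element of the total space. -/
def toTot (Q : GradedQuiver.{u, v, w} k O) {x y : O} {p : ℤ} (a : Q.Hom x y p) : Q.Tot x y :=
  DirectSum.of (fun p => Q.Hom x y p) p a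

end GradedQuiver

/-- Words `l₁ l₂ … l_r` of composable letters `l_i ∈ L x_i x_{i+1}`. -/
inductive Word {O : Type w} (L : O → O → Type v) : O → O → Type (max w v)
  | nil (x : O) : Word L x x
  | cons {x y z : O} (l : L x y) (t : Word L y z) : Word L x z

namespace Word

variable {O : Type w} {L : O → O → Type v}

/-- Concatenation. -/
def append {x y z : O} : Word L x y → Word L y z → Word L x z
  | .nil _, t => t
  | .cons l s, t => .cons l (append s t)

/-- The word `s l t`. -/
def insert {x y z r : O} (s : Word L x y) (l : L y z) (t : Word L z r) : Word L x r :=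
  s.append (.cons l t)

/-- The sum of `f l` over the letters `l` of a word. -/
def total (f : ∀ ⦃x y : O⦄, L x y → ℤ) {x y : O} : Word L x y → ℤ
  | .nil _ => 0
  | .cons l t => f l + total f t

/-- The sum of `φ s t` over all the decompositions of a word as `s t`. -/
def sumSplits {M : Type*} [AddCommMonoid M] {x y : O} (r : Word L x y)
    (φ : ∀ ⦃m : O⦄, Word L x m → Word L m y → M) : M :=
  match r with
  | .nil _ => φ (.nil _) (.nil _)
  | .cons l t => φ (.nil _) (.cons l t) + sumSplits t (fun _ s₁ s₂ => φ (.cons l s₁) s₂)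

/-- The sum of `φ s r t` over all the decompositions of a word as `s r t`. -/
def sumSplits₃ {M : Type*} [AddCommMonoid M] {x y : O} (r : Word L x y)
    (φ : ∀ ⦃m n : O⦄, Word L x m → Word L m n → Word L n y → M) : M :=
  r.sumSplits fun _ s t => t.sumSplits fun _ t₁ t₂ => φ s t₁ t₂

/-- Adding a letter to the first piece of a word cut in pieces (if there is one). -/
def extendFirst {x y z : O} (l : L x y) : Word (Word L) y z → List (Word (Word L) x z)
  | .nil _ => []
  | .cons s c => [.cons (.cons l s) c]

/-- The list of all the ways to cut a word in consecutive nonempty pieces. -/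
def cuts {x y : O} : Word L x y → List (Word (Word L) x y)
  | .nil x => [.nil x]
  | .cons l t => (cuts t).flatMap fun c => .cons (.cons l (.nil _)) c :: extendFirst l c

/-- Replacing each letter `l` of a word by one of the letters of the list `φ l`, in all
possible ways. -/
def mapList {O₂ : Type w₁} {L₂ : O₂ → O₂ → Type v₁} {F₀ : O → O₂}
    (φ : ∀ ⦃x y : O⦄, L x y → List (L₂ (F₀ x) (F₀ y))) {x y : O} :
    Word L x y → List (Word L₂ (F₀ x) (F₀ y))
  | .nil x => [.nil (F₀ x)]
  | .cons l t => (φ l).flatMap fun l' => (mapList φ t).map fun t' => .cons l' t'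

/-- The list with the letter `l` if the word is the one letter word `l`; else the empty list. -/
def single {x y : O} : Word L x y → List (L x y)
  | .cons l (.nil _) => [l]
  | _ => []

/-- Whether a word is empty. -/
def isNil {x y : O} : Word L x y → Bool
  | .nil _ => true
  | .cons _ _ => false

end Word

/-! ### `A∞`-categories and `A∞`-morphisms -/

section AInfinity

variable {k : Type u} [Field k] {O : Type w} {O₂ : Type w₁}

/-- The total degree of a word of homogeneous elements of `Q[1]`. -/
def GradedQuiver.sdeg (Q : GradedQuiver.{u, v, w} k O) {x y : O} (s : Word Q.Letter x y) : ℤ :=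
  s.total fun _ _ l => l.1 - 1

/-- A family of maps `Q[1] ⊗ ⋯ ⊗ Q[1] → R[1]` of degree `e` over a map `F₀` of objects, on
words of homogeneous elements. -/
abbrev WordFamily (Q : GradedQuiver.{u, v, w} k O) (R : GradedQuiver.{u, v₁, w₁} k O₂)
    (F₀ : O → O₂) (e : ℤ) :=
  ∀ ⦃x y : O⦄ (s : Word Q.Letter x y), R.Hom (F₀ x) (F₀ y) (Q.sdeg s + e + 1)

variable {Q : GradedQuiver.{u, v, w} k O} {R : GradedQuiver.{u, v₁, w₁} k O₂} {F₀ : O → O₂} {e : ℤ}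

/-- Linearity in each letter, and no component without inputs. -/
structure WordFamily.IsMultilinear (F : WordFamily Q R F₀ e) : Prop where
  map_add : ∀ {x y z r : O} (s : Word Q.Letter x y) {p : ℤ} (a b : Q.Hom y z p)
    (t : Word Q.Letter z r), R.toTot (F (s.insert ⟨p, a + b⟩ t)) =
      R.toTot (F (s.insert ⟨p, a⟩ t)) + R.toTot (F (s.insert ⟨p, b⟩ t))
  map_smul : ∀ {x y z r : O} (s : Word Q.Letter x y) {p : ℤ} (c : k) (a : Q.Hom y z p)
    (t : Word Q.Letter z r),
    R.toTot (F (s.insert ⟨p, c • a⟩ t)) = c • R.toTot (F (s.insert ⟨p, a⟩ t))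
  map_nil : ∀ x : O, F (Word.nil x) = 0

/-- `∑ (-1)^|s| F (s, m r, t)`, over the decompositions `s r t` of a word with `r` nonempty. -/
def WordFamily.insertSum (F : WordFamily Q R F₀ e) (m : WordFamily Q Q id 1) {x y : O}
    (q : Word Q.Letter x y) : R.Tot (F₀ x) (F₀ y) :=
  q.sumSplits₃ fun _ _ s r t =>
    if r.isNil then 0 else (Q.sdeg s).negOnePow • R.toTot (F (s.insert ⟨_, m r⟩ t))

/-- `∑ n (F r₁, …, F r_l)`, over the ways to cut a word in nonempty pieces `r₁ ⋯ r_l`. -/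
def WordFamily.cutSum (n : WordFamily R R id 1) (F : WordFamily Q R F₀ 0) {x y : O}
    (q : Word Q.Letter x y) : R.Tot (F₀ x) (F₀ y) :=
  (q.cuts.flatMap (Word.mapList (L₂ := R.Letter) (F₀ := F₀)
    fun _ _ r => [⟨_, F r⟩])).map (fun c => R.toTot (n c)) |>.sum

/-- `m` is an `A∞`-structure on `Q` (with the sign convention on `Q[1]`). -/
structure IsAInfinityStructure (m : WordFamily Q Q id 1) : Prop where
  multilinear : m.IsMultilinear
  stasheff : ∀ {x y : O} (q : Word Q.Letter x y), m.insertSum m q = 0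

/-- `F`, together with the map `F₀` of objects, is an `A∞`-morphism from the `A∞`-category
`(Q, m)` to the `A∞`-category `(R, n)`. -/
structure IsAInfinityMorphism (m : WordFamily Q Q id 1) (n : WordFamily R R id 1)
    (F₀ : O → O₂) (F : WordFamily Q R F₀ 0) : Prop where
  source : IsAInfinityStructure m
  target : IsAInfinityStructure n
  multilinear : F.IsMultilinear
  morphism : ∀ {x y : O} (q : Word Q.Letter x y), F.insertSum m q = WordFamily.cutSum n F q

end AInfinity

/-! ### Operations with several outputs -/

section Multi

variable {k : Type u} [Field k] {O : Type w} {O₂ : Type w₁}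

/-- The inputs `x̄ⁿ, …, x̄¹` of a disc with `n` outputs: `n` words (possibly empty) of
homogeneous elements of `A`. The word `one s` is the only one, from `x` to `y`; in
`cons s b`, the word `s` goes from `x` to `z`, and the next one starts at `z'`. The list
records the pairs `(z, z')` between consecutive words. -/
inductive Blocks (A : GradedQuiver.{u, v, w} k O) : O → O → List (O × O) → Type (max w v)
  | one {x y : O} (s : Word A.Letter x y) : Blocks A x y []
  | cons {x z z' y : O} {g : List (O × O)} (s : Word A.Letter x z) (b : Blocks A z' y g) :
      Blocks A x y ((z, z') :: g)

/-- Adding a letter in front of the first word. -/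
def Blocks.consLetter {A : GradedQuiver.{u, v, w} k O} {x x' y : O} {g : List (O × O)}
    (a : A.Letter x x') : Blocks A x' y g → Blocks A x y g
  | .one s => .one (.cons a s)
  | .cons s b => .cons (.cons a s) b

/-- Joining two sequences of words, with a letter between the last word of the first and the
first word of the second. -/
def Blocks.join {A : GradedQuiver.{u, v, w} k O} {x z z' y : O} {g₁ g₂ : List (O × O)} :
    Blocks A x z g₁ → A.Letter z z' → Blocks A z' y g₂ → Blocks A x y (g₁ ++ g₂)
  | .one s, l, .one t => .one (s.insert l t)
  | .one s, l, .cons t b => .cons (s.insert l t) b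
  | .cons s b, l, c => .cons s (b.join l c)

/-- The sum of the degrees in `A[1]` of all the inputs. -/
def Blocks.sdeg {A : GradedQuiver.{u, v, w} k O} {x y : O} {g : List (O × O)} :
    Blocks A x y g → ℤ
  | .one s => A.sdeg s
  | .cons s b => A.sdeg s + b.sdeg

/-- The space of outputs `⨂ Hom_B (F₀ z') (F₀ z)`, over the pairs `(z, z')` in `g`,
tensored with `Hom_B (F₀ x) (F₀ y)`. -/
abbrev Outputs (B : GradedQuiver.{u, v₁, w₁} k O₂) (F₀ : O → O₂) (g : List (O × O)) (x y : O) :=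
  (⨂[k] i : Fin g.length, B.Tot (F₀ (g.get i).2) (F₀ (g.get i).1)) ⊗[k] B.Tot (F₀ x) (F₀ y)

/-- The outputs of total degree `N`, for the degrees in the factors `B[-d]`. -/
def Outputs.homogeneous (d : ℤ) (B : GradedQuiver.{u, v₁, w₁} k O₂) (F₀ : O → O₂)
    (g : List (O × O)) (x y : O) (N : ℤ) : Submodule k (Outputs B F₀ g x y) :=
  Submodule.span k {τ | ∃ (p : Fin g.length → ℤ) (q : ℤ)
    (b : ∀ i, B.Hom (F₀ (g.get i).2) (F₀ (g.get i).1) (p i)) (c : B.Hom (F₀ x) (F₀ y) q),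
    (∑ i, (p i + d)) + (q + d) = N ∧
      τ = PiTensorProduct.tprod k (fun i => B.toTot (b i)) ⊗ₜ[k] B.toTot c}

/-- Multilinear operations with inputs in `A[1]`, cyclically arranged in `n ≥ 1` words, and `n`
outputs in `B[-d]`, which have degree `e` after the shift by `d + 1`; no operation with one
output and no input. -/
structure Multi (d : ℤ) (A : GradedQuiver.{u, v, w} k O) (B : GradedQuiver.{u, v₁, w₁} k O₂)
    (F₀ : O → O₂) (e : ℤ) where
  toFun : ∀ {x y : O} {g : List (O × O)}, Blocks A x y g → Outputs B F₀ g x y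
  map_add : ∀ {x z z' y : O} {g₁ g₂ : List (O × O)} (s : Blocks A x z g₁) {p : ℤ}
    (a b : A.Hom z z' p) (t : Blocks A z' y g₂),
    toFun (s.join ⟨p, a + b⟩ t) = toFun (s.join ⟨p, a⟩ t) + toFun (s.join ⟨p, b⟩ t)
  map_smul : ∀ {x z z' y : O} {g₁ g₂ : List (O × O)} (s : Blocks A x z g₁) {p : ℤ} (c : k)
    (a : A.Hom z z' p) (t : Blocks A z' y g₂),
    toFun (s.join ⟨p, c • a⟩ t) = c • toFun (s.join ⟨p, a⟩ t)
  degree : ∀ {x y : O} {g : List (O × O)} (s : Blocks A x y g),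
    toFun s ∈ Outputs.homogeneous d B F₀ g x y (s.sdeg + e + d + 1)
  uncurved : ∀ x : O, toFun (Blocks.one (Word.nil x)) = 0

end Multi

/-! ### Words in `A ⊕ B^*[d-1]` and contraction with functionals -/

section Mixed

variable {k : Type u} [Field k] {O : Type w} {O₂ : Type w₁}

/-- Homogeneous elements of `B^*[d-1]` from `x` to `y`: an element of degree `p` is a functional
on the component of degree `-(p + d - 1)` of the space of morphisms from `F₀ y` to `F₀ x`. -/
abbrev FLetter (d : ℤ) (B : GradedQuiver.{u, v₁, w₁} k O₂) (F₀ : O → O₂) (x y : O) :=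
  Σ p : ℤ, Module.Dual k (B.Hom (F₀ y) (F₀ x) (-(p + d - 1)))

/-- Homogeneous elements of `A` or of `B^*[d-1]`. -/
abbrev PLetter (d : ℤ) (A : GradedQuiver.{u, v, w} k O) (B : GradedQuiver.{u, v₁, w₁} k O₂)
    (F₀ : O → O₂) (x y : O) :=
  A.Letter x y ⊕ FLetter d B F₀ x y

/-- The graded quiver `A ⊕ B^*[d-1]`, where `B` is pulled back along the map `F₀`. -/
def mixed (d : ℤ) (A : GradedQuiver.{u, v, w} k O) (B : GradedQuiver.{u, v₁, w₁} k O₂)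
    (F₀ : O → O₂) : GradedQuiver.{u, max v v₁ u, w} k O where
  Hom x y p := A.Hom x y p × Module.Dual k (B.Hom (F₀ y) (F₀ x) (-(p + d - 1)))

variable {d : ℤ} {A : GradedQuiver.{u, v, w} k O} {B : GradedQuiver.{u, v₁, w₁} k O₂}
  {F₀ : O → O₂} {e : ℤ}

/-- The terms of a word in `A ⊕ B^*[d-1]`, each letter being the sum of its two parts. -/
def expand {x y : O} (s : Word (mixed d A B F₀).Letter x y) :
    List (Word (PLetter d A B F₀) x y) :=
  Word.mapList (L₂ := PLetter d A B F₀) (F₀ := id)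
    (fun _ _ l => [Sum.inl ⟨l.1, l.2.1⟩, Sum.inr ⟨l.1, l.2.2⟩]) s

/-- The degree of a letter in `(A ⊕ B^*[d-1])[1]`. -/
def PLetter.sdeg ⦃x y : O⦄ : PLetter d A B F₀ x y → ℤ
  | .inl a => a.1 - 1
  | .inr f => f.1 - 1

/-- The degree of a letter if it is in `A[1]`, else `0`. -/
def PLetter.sdegA ⦃x y : O⦄ : PLetter d A B F₀ x y → ℤ
  | .inl a => a.1 - 1
  | .inr _ => 0

/-- The degree of a letter if it is in `B^*[d]`, else `0`. -/
def PLetter.sdegF ⦃x y : O⦄ : PLetter d A B F₀ x y → ℤ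
  | .inl _ => 0
  | .inr f => f.1 - 1

/-- The degree of a word in `(A ⊕ B^*[d-1])[1]`. -/
def pdeg {x y : O} (s : Word (PLetter d A B F₀) x y) : ℤ := s.total PLetter.sdeg

/-- The value of a functional, extended by zero, on the total space. -/
def FLetter.eval {x y : O} (f : FLetter d B F₀ x y) : B.Tot (F₀ y) (F₀ x) →ₗ[k] k :=
  f.2 ∘ₗ DirectSum.component k ℤ (fun p => B.Hom (F₀ y) (F₀ x) p) (-(f.1 + d - 1))

/-- A functional for each pair in a list of pairs of objects. -/
inductive FList (d : ℤ) (B : GradedQuiver.{u, v₁, w₁} k O₂) (F₀ : O → O₂) :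
    List (O × O) → Type (max u v₁ w)
  | nil : FList d B F₀ []
  | cons {z z' : O} {g : List (O × O)} (f : FLetter d B F₀ z z') (t : FList d B F₀ g) :
      FList d B F₀ ((z, z') :: g)

/-- The functional of a given index. -/
def FList.get : {g : List (O × O)} → FList d B F₀ g → (i : Fin g.length) →
    FLetter d B F₀ (g.get i).1 (g.get i).2
  | _, .cons f _, ⟨0, _⟩ => f
  | _, .cons _ t, ⟨i + 1, h⟩ => t.get ⟨i, Nat.lt_of_succ_lt_succ h⟩

/-- Concatenation. -/
def FList.append {g₁ g₂ : List (O × O)} : FList d B F₀ g₁ → FList d B F₀ g₂ →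
    FList d B F₀ (g₁ ++ g₂)
  | .nil, t => t
  | .cons f s, t => .cons f (s.append t)

/-- Applying the functionals to all the outputs but the last one:
`w_1 ⊗ ⋯ ⊗ w_{n-1} ⊗ w_n ↦ f^1(w_1) ⋯ f^{n-1}(w_{n-1}) w_n`. -/
def FList.contract {g : List (O × O)} (f : FList d B F₀ g) (x y : O) :
    Outputs B F₀ g x y →ₗ[k] B.Tot (F₀ x) (F₀ y) :=
  (TensorProduct.lid k _).toLinearMap ∘ₗ TensorProduct.map
    (PiTensorProduct.lift ((MultilinearMap.mkPiAlgebra k (Fin g.length) k).compLinearMap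
      fun i => (f.get i).eval)) LinearMap.id

/-- A word of homogeneous elements, separated in words in `A` and functionals. -/
structure Parsed (d : ℤ) (A : GradedQuiver.{u, v, w} k O) (B : GradedQuiver.{u, v₁, w₁} k O₂)
    (F₀ : O → O₂) (x y : O) where
  gaps : List (O × O)
  blocks : Blocks A x y gaps
  functionals : FList d B F₀ gaps

/-- The word `ā^n f^{n-1} ā^{n-1} ⋯ f^1 ā^1` gives the words `ā^n, …, ā^1` in `A` and the
functionals `f^{n-1}, …, f^1`. -/
def parse {x y : O} : Word (PLetter d A B F₀) x y → Parsed d A B F₀ x y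
  | .nil x => ⟨[], .one (.nil x), .nil⟩
  | .cons (.inl a) t => ⟨_, (parse t).blocks.consLetter a, (parse t).functionals⟩
  | .cons (.inr f) t => ⟨_, .cons (.nil _) (parse t).blocks, .cons f (parse t).functionals⟩

/-- Joining two separated words with a letter in `A`. -/
def Parsed.join {x z z' y : O} (s : Parsed d A B F₀ x z) (a : A.Letter z z')
    (t : Parsed d A B F₀ z' y) : Parsed d A B F₀ x y :=
  ⟨_, s.blocks.join a t.blocks, s.functionals.append t.functionals⟩

theorem Blocks.consLetter_join {x' x z z' y : O} {g₁ g₂ : List (O × O)} (l : A.Letter x' x)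
    (s : Blocks A x z g₁) (a : A.Letter z z') (t : Blocks A z' y g₂) :
    (s.join a t).consLetter l = (s.consLetter l).join a t := by
  cases s with
  | one s => cases t <;> rfl
  | cons s b => rfl

theorem parse_insert {x z z' y : O} (s : Word (PLetter d A B F₀) x z) (a : A.Letter z z')
    (t : Word (PLetter d A B F₀) z' y) :
    parse (s.insert (.inl a) t) = (parse s).join a (parse t) := by
  induction s with
  | nil x =>
    change (⟨_, (parse t).blocks.consLetter a, (parse t).functionals⟩ : Parsed d A B F₀ _ _) =
      ⟨_, (Blocks.one (.nil x)).join a (parse t).blocks, FList.nil.append (parse t).functionals⟩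
    rcases parse t with ⟨g, b, f⟩
    cases b <;> rfl
  | cons l s ih =>
    have ih' := ih a
    rcases l with l | f
    · change (⟨_, (parse (s.insert (.inl a) t)).blocks.consLetter l,
        (parse (s.insert (.inl a) t)).functionals⟩ : Parsed d A B F₀ _ _) = _
      rw [ih']
      change (⟨_, (((parse s).blocks.join a (parse t).blocks).consLetter l), _⟩ :
        Parsed d A B F₀ _ _) = ⟨_, ((parse s).blocks.consLetter l).join a (parse t).blocks, _⟩
      rw [Blocks.consLetter_join]
      rfl
    · change (⟨_, .cons (.nil _) (parse (s.insert (.inl a) t)).blocks,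
        .cons f (parse (s.insert (.inl a) t)).functionals⟩ : Parsed d A B F₀ _ _) = _
      rw [ih']
      rfl

end Mixed

/-! ### The induced operations on words -/

section Operations

variable {k : Type u} [Field k] {O : Type w} {O₂ : Type w₁}
variable {d : ℤ} {A : GradedQuiver.{u, v, w} k O} {B : GradedQuiver.{u, v₁, w₁} k O₂}
  {F₀ : O → O₂} {e : ℤ}

namespace Multi

/-- The operation `F` applied to the words in `A`, with the outputs but the last one contracted
with the functionals; no sign. -/
def contrParsed (F : Multi d A B F₀ e) {x y : O} (s : Parsed d A B F₀ x y) :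
    B.Tot (F₀ x) (F₀ y) :=
  s.functionals.contract x y (F.toFun s.blocks)

/-- The operation `F` applied to the words `ā^n, …, ā^1` of `s = ā^n f^{n-1} ā^{n-1} ⋯ f^1 ā^1`,
with the first `n-1` outputs contracted with `f^{n-1}, …, f^1`; no sign. -/
def contr (F : Multi d A B F₀ e) {x y : O} (s : Word (PLetter d A B F₀) x y) :
    B.Tot (F₀ x) (F₀ y) :=
  F.contrParsed (parse s)

/-- The Koszul sign exponent of a word, read from left to right; `P` is the degree
of what comes before the current block of letters in `A`, and `c` is the degree of the letters
of that block already read. -/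
def exponentAux (d e : ℤ) {x y : O} (P c : ℤ) : Word (PLetter d A B F₀) x y → ℤ
  | .nil _ => 0
  | .cons (.inl a) t => (a.1 - 1) * P + exponentAux d e P (c + (a.1 - 1)) t
  | .cons (.inr f) t =>
      (f.1 - 1) * (P + c) + (e + 1) * (f.1 - 1) + d + exponentAux d e (P + c) 0 t

/-- The Koszul sign of a word. -/
def koszul (d e : ℤ) {x y : O} (s : Word (PLetter d A B F₀) x y) : ℤˣ :=
  (exponentAux d e 0 0 s).negOnePow

/-- The part in `B` of the operation induced by `F` on words in `A ⊕ B^*[d-1]`. -/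
def hatTot (F : Multi d A B F₀ e) {x y : O} (s : Word (PLetter d A B F₀) x y) :
    B.Tot (F₀ x) (F₀ y) :=
  koszul d e s • F.contr s

/-- The component of degree `n` of `hatTot`; for `F` as above and `n = pdeg s + e + 1` this is
everything. -/
def hat (F : Multi d A B F₀ e) {x y : O} (s : Word (PLetter d A B F₀) x y) (n : ℤ) :
    B.Hom (F₀ x) (F₀ y) n :=
  F.hatTot s n

/-- The pairing `Γ(F̂(s), f)`, where `Γ(sa, tf) = (-1)^(|sa||tf| + |tf|) f(a)`. -/
def closed (F : Multi d A B F₀ e) {x y : O} (s : Word (PLetter d A B F₀) x y)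
    (f : FLetter d B F₀ y x) : k :=
  ((pdeg s + e) * (f.1 - 1) + (f.1 - 1)).negOnePow • f.eval (F.hatTot s)

/-- The decomposition `q f a` of a word, where `f` is the last letter in `B^*[d-1]`. -/
structure LastFunctional (d : ℤ) (A : GradedQuiver.{u, v, w} k O)
    (B : GradedQuiver.{u, v₁, w₁} k O₂) (F₀ : O → O₂) (x y : O) where
  src : O
  tgt : O
  before : Word (PLetter d A B F₀) x src
  functional : FLetter d B F₀ src tgt
  after : Word (PLetter d A B F₀) tgt y

/-- The decomposition of a word at its last functional, if there is one. -/
def lastFunctional {x y : O} : Word (PLetter d A B F₀) x y → Option (LastFunctional d A B F₀ x y)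
  | .nil _ => none
  | .cons l t =>
    match lastFunctional t, l with
    | some r, l => some ⟨r.src, r.tgt, .cons l r.before, r.functional, r.after⟩
    | none, .inl _ => none
    | none, .inr f => some ⟨_, _, .nil _, f, t⟩

/-- The operation `F` on the cyclic word `s b`, with `b` in `A` and `s = q f a` with `f` the last
functional: it is `closed` at `(a b q, f)`, up to the Koszul sign of the rotation. It is zero if
there is no functional. -/
def cyc (F : Multi d A B F₀ e) {x y : O} (s : Word (PLetter d A B F₀) x y)
    (b : A.Letter y x) : k :=
  match lastFunctional s with
  | none => 0
  | some r =>
    ((pdeg r.after + (b.1 - 1)) * (pdeg r.before + (r.functional.1 - 1))).negOnePow •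
      F.closed (r.after.insert (.inl b) r.before) r.functional

theorem contr_add (F : Multi d A B F₀ e) {x z z' y : O} (s : Word (PLetter d A B F₀) x z)
    {p : ℤ} (a b : A.Hom z z' p) (t : Word (PLetter d A B F₀) z' y) :
    F.contr (s.insert (.inl ⟨p, a + b⟩) t) =
      F.contr (s.insert (.inl ⟨p, a⟩) t) + F.contr (s.insert (.inl ⟨p, b⟩) t) := by
  simp only [contr, parse_insert]
  simp only [contrParsed, Parsed.join, F.map_add]
  exact LinearMap.map_add _ _ _

theorem contr_smul (F : Multi d A B F₀ e) {x z z' y : O} (s : Word (PLetter d A B F₀) x z)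
    {p : ℤ} (c : k) (a : A.Hom z z' p) (t : Word (PLetter d A B F₀) z' y) :
    F.contr (s.insert (.inl ⟨p, c • a⟩) t) = c • F.contr (s.insert (.inl ⟨p, a⟩) t) := by
  simp only [contr, parse_insert]
  simp only [contrParsed, Parsed.join, F.map_smul]
  exact LinearMap.map_smul _ _ _

theorem pdeg_insert {x z z' y : O} (s : Word (PLetter d A B F₀) x z) {p : ℤ}
    (a b : A.Hom z z' p) (t : Word (PLetter d A B F₀) z' y) :
    pdeg (s.insert (.inl ⟨p, a⟩) t) = pdeg (s.insert (.inl ⟨p, b⟩) t) := by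
  induction s with
  | nil x => rfl
  | cons l s ih =>
    have h := ih a b
    simp only [pdeg, Word.insert, Word.append, Word.total] at h ⊢
    rw [h]

theorem exponentAux_insert {x z z' y : O} (s : Word (PLetter d A B F₀) x z) {p : ℤ}
    (a b : A.Hom z z' p) (t : Word (PLetter d A B F₀) z' y) (P c : ℤ) :
    exponentAux d e P c (s.insert (.inl ⟨p, a⟩) t) =
      exponentAux d e P c (s.insert (.inl ⟨p, b⟩) t) := by
  induction s generalizing P c with
  | nil x => rfl
  | cons l s ih =>
    rcases l with l | f <;> simp only [Word.insert, Word.append, exponentAux] at ih ⊢ <;>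
      rw [ih]

theorem closed_add (F : Multi d A B F₀ e) {x z z' y : O} (s : Word (PLetter d A B F₀) x z)
    {p : ℤ} (a b : A.Hom z z' p) (t : Word (PLetter d A B F₀) z' y) (f : FLetter d B F₀ y x) :
    F.closed (s.insert (.inl ⟨p, a + b⟩) t) f =
      F.closed (s.insert (.inl ⟨p, a⟩) t) f + F.closed (s.insert (.inl ⟨p, b⟩) t) f := by
  simp only [closed, hatTot, koszul, contr_add, pdeg_insert s (a + b) a t, pdeg_insert s b a t,
    exponentAux_insert s (a + b) a t, exponentAux_insert s b a t, smul_add, LinearMap.map_add]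

theorem closed_smul (F : Multi d A B F₀ e) {x z z' y : O} (s : Word (PLetter d A B F₀) x z)
    {p : ℤ} (c : k) (a : A.Hom z z' p) (t : Word (PLetter d A B F₀) z' y)
    (f : FLetter d B F₀ y x) :
    F.closed (s.insert (.inl ⟨p, c • a⟩) t) f = c • F.closed (s.insert (.inl ⟨p, a⟩) t) f := by
  simp only [closed, hatTot, koszul, contr_smul, pdeg_insert s (c • a) a t,
    exponentAux_insert s (c • a) a t, Units.smul_def, map_zsmul, LinearMap.map_smul, smul_comm c]

/-- The functional `b ↦ (-1)^|s| cyc(s, b)`, on the component of the degree given by `n`; this is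
the part in `A^*` of the operation induced by `F` on words in `A ⊕ B^*[d-1]`. -/
def dualHat (F : Multi d A B F₀ e) {x y : O} (s : Word (PLetter d A B F₀) x y) (n : ℤ) :
    Module.Dual k (A.Hom (id y) (id x) (-(n + d - 1))) where
  toFun b := (pdeg s).negOnePow • F.cyc s ⟨_, b⟩
  map_add' a b := by
    unfold cyc
    rcases lastFunctional s with _ | r
    · simp
    · simp only
      rw [closed_add, smul_add, smul_add]
  map_smul' c b := by
    unfold cyc
    rcases lastFunctional s with _ | r
    · simp
    · simp only [RingHom.id_apply]
      rw [closed_smul]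
      simp only [smul_comm c]

/-- Invariance under cyclic rotations, with Koszul signs: for a word `q f a`, where the letters
of `a` are in `A`, rotating the block `a` and the last output to the other side. -/
def IsCyclic (F : Multi d A B F₀ e) : Prop :=
  ∀ {x y z z' : O} (q : Word (PLetter d A B F₀) x z) (f : FLetter d B F₀ z z')
    (a : Word (PLetter d A B F₀) z' y) (f' : FLetter d B F₀ y x), lastFunctional a = none →
    f'.eval (F.contr (q.insert (.inr f) a)) =
      (pdeg a * q.total PLetter.sdegA +
        (f.1 - 1) * (q.total PLetter.sdegF + (f'.1 - 1))).negOnePow •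
      f.eval (F.contr (a.insert (.inr f') q))

end Multi

end Operations

/-! ### Pre-Calabi-Yau structures and morphisms -/

section PreCY

variable {k : Type u} [Field k] {O : Type w} {O₂ : Type w₁}
variable {d : ℤ} {A : GradedQuiver.{u, v, w} k O} {B : GradedQuiver.{u, v₁, w₁} k O₂}
  {F₀ : O → O₂}

/-- The necklace composition of `M` with itself, contracted with the functionals in
the cyclic word `s f`: the sum over the diagrams made of two discs, one output of the first being
an input of the second. In the first sum, the inner disc has as its other outputs functionals of a
subword of `s`; in the second, `f` is one of these. -/
def necklaceSum (M : Multi d A A id 1) {x y : O} (s : Word (PLetter d A A id) x y)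
    (f : FLetter d A id y x) : k :=
  (s.sumSplits₃ fun _ _ u r t => if r.isNil then 0 else
      (pdeg u).negOnePow • M.closed (u.insert (.inl ⟨_, M.hat r (pdeg r + 1 + 1)⟩) t) f) +
  s.sumSplits₃ fun _ _ u r t =>
    (pdeg u * (pdeg r + pdeg t + (f.1 - 1)) + pdeg r).negOnePow •
      M.cyc r ⟨_, M.hat (t.insert (.inr f) u) (pdeg (t.insert (.inr f) u) + 1 + 1)⟩

/-- A `d`-pre-Calabi-Yau structure on `A`. -/
structure IsPreCY (M : Multi d A A id 1) : Prop where
  cyclic : M.IsCyclic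
  necklace : ∀ {x y : O} (s : Word (PLetter d A A id) x y) (f : FLetter d A id y x),
    necklaceSum M s f = 0

/-- `φ_A` on a word of homogeneous letters, as a list of summands: the part in `A^*[d-1]`, made
of all of `Φ`, and the letter itself if there is only one and it is in `A`. -/
def lettersA (Φ : Multi d A B F₀ 0) ⦃x y : O⦄ (r : Word (PLetter d A B F₀) x y) :
    List (PLetter d A A id (id x) (id y)) :=
  .inr ⟨pdeg r + 0 + 1, Φ.dualHat r _⟩ :: r.single.flatMap fun l =>
    match l with
    | .inl a => [.inl a]
    | .inr _ => []

/-- `φ_B` on a word of homogeneous letters, as a list of summands: the part in `B`, made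
of all of `Φ`, and the letter itself if there is only one and it is in `B^*[d-1]`. -/
def lettersB (Φ : Multi d A B F₀ 0) ⦃x y : O⦄ (r : Word (PLetter d A B F₀) x y) :
    List (PLetter d B B id (F₀ x) (F₀ y)) :=
  .inl ⟨pdeg r + 0 + 1, Φ.hat r _⟩ :: r.single.flatMap fun l =>
    match l with
    | .inl _ => []
    | .inr f => [.inr f]

/-- All the ways to cut a word in nonempty pieces and to apply `φ_A` to the pieces. -/
def piecesA (Φ : Multi d A B F₀ 0) {x y : O} (s : Word (PLetter d A B F₀) x y) :
    List (Word (PLetter d A A id) x y) :=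
  s.cuts.flatMap (Word.mapList (L₂ := PLetter d A A id) (F₀ := id) (lettersA Φ))

/-- All the ways to cut a word in nonempty pieces and to apply `φ_B` to the pieces. -/
def piecesB (Φ : Multi d A B F₀ 0) {x y : O} (s : Word (PLetter d A B F₀) x y) :
    List (Word (PLetter d B B id) (F₀ x) (F₀ y)) :=
  s.cuts.flatMap (Word.mapList (L₂ := PLetter d B B id) (F₀ := F₀) (lettersB Φ))

/-- The sum of the diagrams with one disc `M_A` each of whose outputs is an input of a disc `Φ`,
contracted with the functionals in the cyclic word `s f`. The functional `f` belongs to the disc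
`Φ` whose word is `t f u`. -/
def multinecklaceSum (M : Multi d A A id 1) (Φ : Multi d A B F₀ 0) {x y : O}
    (s : Word (PLetter d A B F₀) x y) (f : FLetter d B F₀ y x) : k :=
  s.sumSplits₃ fun _ _ u r t =>
    (pdeg u * (pdeg r + pdeg t + (f.1 - 1))).negOnePow •
      ((piecesA Φ r).map fun z =>
        M.closed z ⟨pdeg (t.insert (.inr f) u) + 0 + 1, Φ.dualHat (t.insert (.inr f) u) _⟩).sum

/-- The sum of the diagrams with one disc `M_B` each of whose inputs is an output of a disc `Φ`,
contracted with the functionals in the cyclic word `s f`. In the first sum, `f` is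
applied to an output of `M_B`; in the second, to an output of the disc `Φ` whose word
is `t f u`. -/
def preSum (M : Multi d B B id 1) (Φ : Multi d A B F₀ 0) {x y : O}
    (s : Word (PLetter d A B F₀) x y) (f : FLetter d B F₀ y x) : k :=
  ((piecesB Φ s).map fun z => M.closed z f).sum +
  s.sumSplits₃ fun _ _ u r t =>
    (pdeg u * (pdeg r + pdeg t + (f.1 - 1))).negOnePow •
      ((piecesB Φ r).map fun z =>
        M.cyc z ⟨pdeg (t.insert (.inr f) u) + 0 + 1, Φ.hat (t.insert (.inr f) u) _⟩).sum

/-- `(F₀, Φ)` is a morphism of `d`-pre-Calabi-Yau categories from `(A, M_A)` to `(B, M_B)`. -/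
structure IsPreCYMorphism (MA : Multi d A A id 1) (MB : Multi d B B id 1)
    (Φ : Multi d A B F₀ 0) : Prop where
  cyclic : Φ.IsCyclic
  morphism : ∀ {x y : O} (s : Word (PLetter d A B F₀) x y) (f : FLetter d B F₀ y x),
    multinecklaceSum MA Φ s f = preSum MB Φ s f

/-! ### The `A∞`-structures and the maps `φ_A` and `φ_B` -/

/-- The structure on `A ⊕ A^*[d-1]` given by `M`. -/
def boundaryStructure (M : Multi d A A id 1) :
    WordFamily (mixed d A A id) (mixed d A A id) id 1 := fun _ _ s =>
  ((expand s).map fun r => (M.hat r _, M.dualHat r _)).sum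

/-- The structure on `A ⊕ B^*[d-1]` given by `M_A`, `M_B` and `Φ`. The part in `A` is made of
`M_A` with each output but one in an input of a disc `Φ`; the part in `B^*[d-1]` is made of
`M_B` with an output of a disc `Φ` in each input but one. -/
def mixedStructure (MA : Multi d A A id 1) (MB : Multi d B B id 1) (Φ : Multi d A B F₀ 0) :
    WordFamily (mixed d A B F₀) (mixed d A B F₀) id 1 := fun _ _ s =>
  ((expand s).map fun r => (((piecesA Φ r).map fun z => MA.hat z _).sum,
    ((piecesB Φ r).map fun z => MB.dualHat z _).sum)).sum

/-- `φ_A : A[1] ⊕ B^*[d] → A[1] ⊕ A^*[d]`: the identity on `A[1]`, plus `Φ` with all the outputs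
contracted with the functionals of the word. -/
def phiA (Φ : Multi d A B F₀ 0) : WordFamily (mixed d A B F₀) (mixed d A A id) id 0 :=
  fun _ _ s => ((expand s).map fun r =>
    ((r.single.map fun l => match l with
        | .inl a => A.toTot a.2 ((mixed d A B F₀).sdeg s + 0 + 1)
        | .inr _ => 0).sum, Φ.dualHat r _)).sum

/-- `φ_B : A[1] ⊕ B^*[d] → B[1] ⊕ B^*[d]`: the identity on `B^*[d]`, plus `Φ` with all the
outputs but one contracted with the functionals of the word. -/
def phiB (Φ : Multi d A B F₀ 0) : WordFamily (mixed d A B F₀) (mixed d B B id) F₀ 0 :=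
  fun x y s => ((expand s).map fun r =>
    (Φ.hat r _, (r.single.map fun l => match l with
        | .inl _ => 0
        | .inr f => DirectSum.of (fun p => Module.Dual k (B.Hom (F₀ y) (F₀ x) (-(p + d - 1))))
            f.1 f.2 ((mixed d A B F₀).sdeg s + 0 + 1)).sum)).sum

end PreCY

end

/-! ### Sums over decompositions of words -/

namespace Word

variable {O : Type w} {L : O → O → Type v} {O₂ : Type w₁} {L₂ : O₂ → O₂ → Type v₁} {F₀ : O → O₂}
variable {M : Type*} [AddCommMonoid M] {N : Type*} [AddCommMonoid N]

/-! Every operation `F` becomes a scalar function of cyclic words, `Multi.form`: the value of a disc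
all of whose inputs and outputs are filled. Cyclic invariance, together with the sign conventions,
says exactly that `form` has Koszul signs under rotation (`form_rotate`). Closing a cyclic word with
a functional reads `hat`, closing it with an element of `A` reads `dualHat`. An identity between
`hat`s and one between `dualHat`s are therefore the same scalar identity on cyclic words, seen from
two kinds of closing letter.

The equations in the hypotheses are only given for cyclic words closed by a functional. Their two
sides are equivariant under rotation, so they extend to all cyclic words (`eq_zero_of_rotate`): a
functional, if there is one, can be rotated to the end; without nonzero functionals every term
vanishes.

The second ingredient is the exchange `form_dualHat`: contracting an output of `F` with the
functional that `G` defines is the same as inserting that output in the free input of `G`. Both are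
the diagram in which an edge joins the two discs, seen from one disc or the other. Applied to `M`
twice, it makes the sum over the two arcs of a cyclic word symmetric, hence rotation equivariant,
and turns the necklace equation into the Stasheff identities (`form_stasheff`).

For a morphism, a cyclic word is cut in pieces, `φ_A` or `φ_B` is applied to the pieces, and `M_A`
or `M_B` is evaluated on the result (`cyclicCutSum`). The exchange is applied to the piece of the
closing letter `l`: this piece becomes a disc `Φ` in which the operation of `A ⊕ B^*[d-1]` is
inserted. The only term left over is the one where `l` is a piece by itself and the identity summand
of `φ` is used; it occurs for `φ_A` if `l` is in `A` and for `φ_B` if `l` is a functional. The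
equality of the two cyclic sums (`form_eq`) is thus the `A^*`-part of the equation for `φ_A`
together with the `B`-part of the equation for `φ_B`. The other two parts hold by definition of the
operation of `A ⊕ B^*[d-1]` (`sumSplits₃_identityA`, `sumSplits₃_identityB`).

That this operation is an `A∞`-structure is then a consequence. Its `A`-part is the `A`-part of
`M_A` applied to the values of `φ_A`, and its `B^*`-part is the `B^*`-part of `M_B` applied to the
values of `φ_B`. By the morphism equations, its Stasheff sums are the matching parts of those of the
two targets, on words of values of `φ_A` or `φ_B` (`sumSplits₃_cutSum_eq_zero`). -/

@[simp] theorem nil_append {x y : O} (s : Word L x y) : (nil x).append s = s := rfl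

@[simp] theorem cons_append {x y z r : O} (l : L x y) (s : Word L y z) (t : Word L z r) :
    (cons l s).append t = cons l (s.append t) := rfl

theorem append_assoc {x y z r : O} (s : Word L x y) (t : Word L y z) (q : Word L z r) :
    (s.append t).append q = s.append (t.append q) := by
  induction s with
  | nil => rfl
  | cons l s ih => simp [ih]

@[simp] theorem nil_insert {y z r : O} (l : L y z) (t : Word L z r) :
    (nil y).insert l t = cons l t := rfl

@[simp] theorem cons_insert {x' x y z r : O} (a : L x' x) (s : Word L x y) (l : L y z)
    (t : Word L z r) : (cons a s).insert l t = cons a (s.insert l t) := rfl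

theorem append_insert {x' x y z r : O} (q : Word L x' x) (s : Word L x y) (l : L y z)
    (t : Word L z r) : (q.append s).insert l t = q.append (s.insert l t) :=
  append_assoc ..

theorem insert_append {x y z r r' : O} (s : Word L x y) (l : L y z)
    (t : Word L z r) (q : Word L r r') : (s.insert l t).append q = s.insert l (t.append q) :=
  append_assoc ..

theorem insert_insert {x y z r r' r'' : O} (s : Word L x y) (l : L y z)
    (t : Word L z r) (l' : L r r') (q : Word L r' r'') :
    (s.insert l t).insert l' q = s.insert l (t.insert l' q) :=
  append_assoc ..

@[simp] theorem total_nil (f : ∀ ⦃x y : O⦄, L x y → ℤ) (x : O) : (nil x : Word L x x).total f = 0 :=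
  rfl

@[simp] theorem total_cons (f : ∀ ⦃x y : O⦄, L x y → ℤ) {x y z : O} (l : L x y) (s : Word L y z) :
    (cons l s).total f = f l + s.total f := rfl

@[simp] theorem total_append (f : ∀ ⦃x y : O⦄, L x y → ℤ) {x y z : O} (s : Word L x y)
    (t : Word L y z) : (s.append t).total f = s.total f + t.total f := by
  induction s with
  | nil => simp
  | cons l s ih => simp [ih, add_assoc]

@[simp] theorem total_insert (f : ∀ ⦃x y : O⦄, L x y → ℤ) {x y z r : O} (s : Word L x y)
    (l : L y z) (t : Word L z r) : (s.insert l t).total f = s.total f + (f l + t.total f) :=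
  total_append ..

theorem sumSplits_cons {x y z : O} (l : L x y) (t : Word L y z)
    (φ : ∀ ⦃m : O⦄, Word L x m → Word L m z → M) :
    (cons l t).sumSplits φ = φ (nil _) (cons l t) + t.sumSplits (fun _ a b => φ (cons l a) b) :=
  rfl

theorem sumSplits_nil {x : O} (φ : ∀ ⦃m : O⦄, Word L x m → Word L m x → M) :
    (nil x : Word L x x).sumSplits φ = φ (nil _) (nil _) :=
  rfl

/-- Knowing that `a` and `b` recompose `r` is what allows signs, which depend on the degrees of the
pieces, to be compared termwise. -/
theorem sumSplits_congr {x y : O} (r : Word L x y)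
    {φ ψ : ∀ ⦃m : O⦄, Word L x m → Word L m y → M}
    (h : ∀ ⦃m : O⦄ (a : Word L x m) (b : Word L m y), a.append b = r → φ a b = ψ a b) :
    r.sumSplits φ = r.sumSplits ψ := by
  induction r with
  | nil x => exact h _ _ rfl
  | cons l t ih =>
    rw [sumSplits_cons, sumSplits_cons, h _ _ rfl]
    congr 1
    exact ih fun m a b hab => h _ _ (by simp [hab])

theorem sumSplits_add {x y : O} (r : Word L x y)
    (φ ψ : ∀ ⦃m : O⦄, Word L x m → Word L m y → M) :
    r.sumSplits (fun _ a b => φ a b + ψ a b) = r.sumSplits φ + r.sumSplits ψ := by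
  induction r with
  | nil x => rfl
  | cons l t ih =>
    simp only [sumSplits_cons, ih]
    abel

theorem sumSplits_zero {x y : O} (r : Word L x y) :
    r.sumSplits (fun _ _ _ => (0 : M)) = 0 := by
  induction r with
  | nil x => rfl
  | cons l t ih => simp [sumSplits_cons, ih]

theorem map_sumSplits {G : Type*} [FunLike G M N] [AddMonoidHomClass G M N] (f : G) {x y : O}
    (r : Word L x y) (φ : ∀ ⦃m : O⦄, Word L x m → Word L m y → M) :
    f (r.sumSplits φ) = r.sumSplits (fun _ a b => f (φ a b)) := by
  induction r with
  | nil x => rfl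
  | cons l t ih => simp [sumSplits_cons, ih]

theorem smul_sumSplits {R : Type*} [DistribSMul R M] (c : R) {x y : O}
    (r : Word L x y) (φ : ∀ ⦃m : O⦄, Word L x m → Word L m y → M) :
    c • r.sumSplits φ = r.sumSplits (fun _ a b => c • φ a b) :=
  map_sumSplits (DistribSMul.toAddMonoidHom M c) r φ

theorem sumSplits_list_sum {ι : Type*} (l : List ι) {x y : O} (r : Word L x y)
    (φ : ι → ∀ ⦃m : O⦄, Word L x m → Word L m y → M) :
    r.sumSplits (fun _ a b => (l.map fun i => φ i a b).sum) =
      (l.map fun i => r.sumSplits (φ i)).sum := by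
  induction l with
  | nil => exact sumSplits_zero r
  | cons i l ih => simp [sumSplits_add, ih]

theorem sumSplits_comm {O' : Type*} {L' : O' → O' → Type*} {x y : O} {x' y' : O'}
    (r : Word L x y) (s : Word L' x' y')
    (φ : ∀ ⦃m : O⦄, Word L x m → Word L m y → ∀ ⦃m' : O'⦄, Word L' x' m' → Word L' m' y' → M) :
    r.sumSplits (fun _ a b => s.sumSplits fun _ c e => φ a b c e) =
      s.sumSplits (fun _ c e => r.sumSplits fun _ a b => φ a b c e) := by
  induction r with
  | nil x => rfl
  | cons l t ih => simp [sumSplits_cons, sumSplits_add, ih]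

/-- Both sides run over the decompositions of `r` in three words. This coassociativity performs the
regroupings of nested sums below. -/
theorem sumSplits_assoc {x y : O} (r : Word L x y)
    (φ : ∀ ⦃m n : O⦄, Word L x m → Word L m n → Word L n y → M) :
    r.sumSplits (fun _ q c => q.sumSplits fun _ a b => φ a b c) =
      r.sumSplits (fun _ a q => q.sumSplits fun _ b c => φ a b c) := by
  induction r with
  | nil x => rfl
  | cons l t ih =>
    simp only [sumSplits_cons, sumSplits_nil, sumSplits_add, ih]
    abel

theorem sumSplits_insert {x y z r : O} (s : Word L x y) (l : L y z) (t : Word L z r)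
    (φ : ∀ ⦃m : O⦄, Word L x m → Word L m r → M) :
    (s.insert l t).sumSplits φ = s.sumSplits (fun _ a b => φ a (b.insert l t)) +
      t.sumSplits (fun _ a b => φ (s.insert l a) b) := by
  induction s with
  | nil x => rfl
  | cons l' s ih => simp only [cons_insert, sumSplits_cons, ih, add_assoc]

theorem sumSplits₃_congr {x y : O} (r : Word L x y)
    {φ ψ : ∀ ⦃m n : O⦄, Word L x m → Word L m n → Word L n y → M}
    (h : ∀ ⦃m n : O⦄ (a : Word L x m) (b : Word L m n) (c : Word L n y),
      a.append (b.append c) = r → φ a b c = ψ a b c) :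
    r.sumSplits₃ φ = r.sumSplits₃ ψ :=
  sumSplits_congr _ fun _ a q hq => sumSplits_congr _ fun _ b c hb => h a b c (by rw [hb, hq])

theorem sumSplits₃_add {x y : O} (r : Word L x y)
    (φ ψ : ∀ ⦃m n : O⦄, Word L x m → Word L m n → Word L n y → M) :
    r.sumSplits₃ (fun _ _ a b c => φ a b c + ψ a b c) = r.sumSplits₃ φ + r.sumSplits₃ ψ := by
  simp only [sumSplits₃, sumSplits_add]

theorem sumSplits₃_zero {x y : O} (r : Word L x y) :
    r.sumSplits₃ (fun _ _ _ _ _ => (0 : M)) = 0 := by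
  simp only [sumSplits₃, sumSplits_zero]

theorem map_sumSplits₃ {G : Type*} [FunLike G M N] [AddMonoidHomClass G M N] (f : G) {x y : O}
    (r : Word L x y) (φ : ∀ ⦃m n : O⦄, Word L x m → Word L m n → Word L n y → M) :
    f (r.sumSplits₃ φ) = r.sumSplits₃ (fun _ _ a b c => f (φ a b c)) := by
  simp only [sumSplits₃, map_sumSplits]

theorem smul_sumSplits₃ {R : Type*} [DistribSMul R M] (c : R) {x y : O}
    (r : Word L x y) (φ : ∀ ⦃m n : O⦄, Word L x m → Word L m n → Word L n y → M) :
    c • r.sumSplits₃ φ = r.sumSplits₃ (fun _ _ a b e => c • φ a b e) :=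
  map_sumSplits₃ (DistribSMul.toAddMonoidHom M c) r φ

theorem sumSplits_eq_of_nil_right {x y : O} (r : Word L x y)
    (φ : ∀ ⦃m : O⦄, Word L x m → Word L m y → M)
    (h : ∀ ⦃m n : O⦄ (a : Word L x m) (l : L m n) (b : Word L n y), φ a (cons l b) = 0) :
    r.sumSplits φ = φ r (nil y) := by
  induction r with
  | nil x => rfl
  | cons l t ih =>
    rw [sumSplits_cons, h, zero_add]
    exact ih _ fun m n a l' b => h _ _ _

theorem sumSplits_eq_of_nil_left {x y : O} (r : Word L x y)
    (φ : ∀ ⦃m : O⦄, Word L x m → Word L m y → M)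
    (h : ∀ ⦃m n : O⦄ (l : L x m) (a : Word L m n) (b : Word L n y), φ (cons l a) b = 0) :
    r.sumSplits φ = φ (nil x) r := by
  cases r with
  | nil x => rfl
  | cons l t =>
    rw [sumSplits_cons]
    simp only [h, sumSplits_zero, add_zero]

/-- The number of letters. -/
def length {x y : O} : Word L x y → ℕ
  | .nil _ => 0
  | .cons _ t => length t + 1

theorem length_append {x y z : O} (s : Word L x y) (t : Word L y z) :
    (s.append t).length = s.length + t.length := by
  induction s with
  | nil => simp [length]
  | cons l s ih => simp [length, ih]; omega

/-- Structural induction is too weak for cut words: removing the first piece can remove many letters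
at once. -/
theorem strong_induction {P : ∀ ⦃x y : O⦄, Word L x y → Prop}
    (h : ∀ ⦃x y : O⦄ (s : Word L x y),
      (∀ ⦃x' y' : O⦄ (t : Word L x' y'), t.length < s.length → P t) → P s)
    ⦃x y : O⦄ (s : Word L x y) : P s := by
  generalize hn : s.length = n
  induction n using Nat.strong_induction_on generalizing x y with
  | _ n ih => exact h s fun x' y' t ht => ih t.length (hn ▸ ht) t rfl

/-- The length of the suffix in a decomposition of `t`. -/
theorem length_lt_cons {x y z r : O} {a : Word L y r} {b : Word L r z} {t : Word L y z}
    (h : a.append b = t) (l : L x y) : b.length < (cons l t).length := by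
  have := length_append a b
  rw [h] at this
  simp [length]; omega

/-! ### Words with replaced letters and words cut in pieces. -/

theorem sum_mapList_nil (φ : ∀ ⦃x y : O⦄, L x y → List (L₂ (F₀ x) (F₀ y))) (x : O)
    (K : Word L₂ (F₀ x) (F₀ x) → M) :
    ((mapList φ (nil x : Word L x x)).map K).sum = K (nil _) := by
  simp [mapList]

theorem sum_mapList_cons (φ : ∀ ⦃x y : O⦄, L x y → List (L₂ (F₀ x) (F₀ y))) {x y z : O}
    (l : L x y) (t : Word L y z) (K : Word L₂ (F₀ x) (F₀ z) → M) :
    ((mapList φ (cons l t)).map K).sum =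
      ((φ l).map fun l' => ((mapList φ t).map fun t' => K (cons l' t')).sum).sum := by
  simp [mapList, List.flatMap, List.map_flatten, List.sum_flatten, Function.comp_def]

theorem sum_mapList_append (φ : ∀ ⦃x y : O⦄, L x y → List (L₂ (F₀ x) (F₀ y))) {x y z : O}
    (s : Word L x y) (t : Word L y z) (K : Word L₂ (F₀ x) (F₀ z) → M) :
    ((mapList φ (s.append t)).map K).sum =
      ((mapList φ s).map fun s' => ((mapList φ t).map fun t' => K (s'.append t')).sum).sum := by
  induction s with
  | nil x => rw [sum_mapList_nil]; rfl
  | cons l s ih =>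
    rw [cons_append, sum_mapList_cons, sum_mapList_cons]
    simp only [ih]
    rfl

theorem sum_list_comm {ι κ : Type*} (l : List ι) (l' : List κ) (f : ι → κ → M) :
    (l.map fun i => (l'.map fun j => f i j).sum).sum =
      (l'.map fun j => (l.map fun i => f i j).sum).sum := by
  induction l with
  | nil => simp
  | cons i l ih => simp [List.sum_map_add, ih]

theorem sum_mapList_sumSplits (φ : ∀ ⦃x y : O⦄, L x y → List (L₂ (F₀ x) (F₀ y))) {x y : O}
    (q : Word L x y) (G : ∀ ⦃m : O₂⦄, Word L₂ (F₀ x) m → Word L₂ m (F₀ y) → M) :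
    ((mapList φ q).map fun q' => q'.sumSplits G).sum =
      q.sumSplits (fun _ a b =>
        ((mapList φ a).map fun a' => ((mapList φ b).map fun b' => G a' b').sum).sum) := by
  induction q with
  | nil x => simp [sumSplits_nil, mapList]
  | cons l t ih =>
    rw [sum_mapList_cons]
    simp only [sumSplits_cons, sum_mapList_nil, sum_mapList_cons, List.sum_map_add]
    congr 1
    rw [sumSplits_list_sum]
    congr 2
    funext l'
    exact ih fun m a b => G (cons l' a) b

/-- The sum of `K z` over the words `z` obtained by cutting a word in nonempty pieces, and
replacing each piece `r` by a letter of the list `φ r`. -/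
def cutSum (φ : ∀ ⦃x y : O⦄, Word L x y → List (L₂ (F₀ x) (F₀ y))) {x y : O} (q : Word L x y)
    (K : Word L₂ (F₀ x) (F₀ y) → M) : M :=
  ((q.cuts.flatMap (mapList φ)).map K).sum

variable (φ : ∀ ⦃x y : O⦄, Word L x y → List (L₂ (F₀ x) (F₀ y)))

theorem sum_flatMap {ι κ : Type*} (l : List ι) (f : ι → List κ) (K : κ → M) :
    ((l.flatMap f).map K).sum = (l.map fun i => ((f i).map K).sum).sum := by
  induction l with
  | nil => simp
  | cons i l ih => simp [ih]

/-- The recursion defining `cuts` only ever enlarges the first piece. Unrolling it amounts to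
choosing the first piece `cons l a`, then cutting the remainder `b`; all inductions on cut words use
this form. -/
theorem sum_cuts_cons {x y z : O} (l : L x y) (t : Word L y z)
    (H : Word (Word L) x z → M) : ((cuts (cons l t)).map H).sum =
      t.sumSplits fun _ a b => ((cuts b).map fun c => H (cons (cons l a) c)).sum := by
  induction t generalizing x with
  | nil y => simp [cuts, sumSplits_nil, extendFirst]
  | cons l₂ t ih =>
    have h := ih l₂ fun c => ((extendFirst l c).map H).sum
    rw [cuts, sum_flatMap, sumSplits_cons]
    simp only [List.map_cons, List.sum_cons, List.sum_map_add, h]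
    congr 1
    simp [extendFirst]

@[simp] theorem cutSum_nil (x : O) (K : Word L₂ (F₀ x) (F₀ x) → M) :
    cutSum φ (nil x) K = K (nil _) := by
  simp [cutSum, cuts, mapList]

theorem cutSum_cons {x y z : O} (l : L x y) (t : Word L y z)
    (K : Word L₂ (F₀ x) (F₀ z) → M) : cutSum φ (cons l t) K =
      t.sumSplits fun _ a b =>
        ((φ (cons l a)).map fun l' => cutSum φ b fun z => K (cons l' z)).sum := by
  rw [cutSum, sum_flatMap, sum_cuts_cons]
  simp only [sum_mapList_cons, cutSum, sum_flatMap]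
  congr 1
  funext m a b
  rw [sum_list_comm]

theorem cutSum_add {x y : O} (q : Word L x y) (K K' : Word L₂ (F₀ x) (F₀ y) → M) :
    cutSum φ q (fun z => K z + K' z) = cutSum φ q K + cutSum φ q K' :=
  List.sum_map_add ..

theorem cutSum_zero {x y : O} (q : Word L x y) :
    cutSum φ q (fun _ => (0 : M)) = 0 := by
  simp [cutSum]

theorem map_cutSum {G : Type*} [FunLike G M N] [AddMonoidHomClass G M N] (f : G) {x y : O}
    (q : Word L x y) (K : Word L₂ (F₀ x) (F₀ y) → M) :
    f (cutSum φ q K) = cutSum φ q (fun z => f (K z)) := by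
  simp [cutSum, map_list_sum, Function.comp_def]

theorem smul_cutSum {R : Type*} [DistribSMul R M] (c : R) {x y : O}
    (q : Word L x y) (K : Word L₂ (F₀ x) (F₀ y) → M) :
    c • cutSum φ q K = cutSum φ q (fun z => c • K z) :=
  map_cutSum φ (DistribSMul.toAddMonoidHom M c) q K

theorem cutSum_list_sum {ι : Type*} (l : List ι) {x y : O} (q : Word L x y)
    (K : ι → Word L₂ (F₀ x) (F₀ y) → M) :
    cutSum φ q (fun z => (l.map fun i => K i z).sum) = (l.map fun i => cutSum φ q (K i)).sum := by
  simp only [cutSum]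
  rw [sum_list_comm]

theorem cutSum_sumSplits_comm {O' : Type*} {L' : O' → O' → Type*} {x y : O} {x' y' : O'}
    (q : Word L x y) (s : Word L' x' y')
    (K : Word L₂ (F₀ x) (F₀ y) → ∀ ⦃m : O'⦄, Word L' x' m → Word L' m y' → M) :
    cutSum φ q (fun z => s.sumSplits (K z)) =
      s.sumSplits fun _ a b => cutSum φ q fun z => K z a b :=
  (sumSplits_list_sum ..).symm

theorem cutSum_comm {O' O₂' : Type*} {L' : O' → O' → Type*} {L₂' : O₂' → O₂' → Type*}
    {F₀' : O' → O₂'} (φ' : ∀ ⦃x y : O'⦄, Word L' x y → List (L₂' (F₀' x) (F₀' y)))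
    {x y : O} {x' y' : O'}
    (q : Word L x y) (s : Word L' x' y')
    (K : Word L₂ (F₀ x) (F₀ y) → Word L₂' (F₀' x') (F₀' y') → M) :
    cutSum φ q (fun z => cutSum φ' s fun z' => K z z') =
      cutSum φ' s fun z' => cutSum φ q fun z => K z z' :=
  sum_list_comm ..

/-- Splitting words obtained by cutting is cutting the two parts of a split word. -/
theorem cutSum_sumSplits {x y : O} (q : Word L x y)
    (G : ∀ ⦃m : O₂⦄, Word L₂ (F₀ x) m → Word L₂ m (F₀ y) → M) :
    cutSum φ q (fun z => z.sumSplits G) =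
      q.sumSplits fun _ a b => cutSum φ a fun z => cutSum φ b fun z' => G z z' := by
  induction q using strong_induction with
  | h q ih =>
  cases q with
  | nil x => simp [sumSplits_nil]
  | cons l t =>
    rw [cutSum_cons, sumSplits_cons]
    simp only [sumSplits_cons, cutSum_add, List.sum_map_add, sumSplits_add]
    congr 1
    -- The splitting point is before the first piece.
    · simp only [cutSum_nil]
      rw [cutSum_cons]
    -- The first piece is on the left of the splitting point: it is set aside, and the induction
    -- hypothesis applies to what follows it.
    · simp only [cutSum_cons]
      rw [sumSplits_assoc]
      refine sumSplits_congr _ fun m a b hab => ?_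
      rw [sumSplits_list_sum]
      congr 2
      funext l'
      exact ih b (length_lt_cons hab l) fun _ c e => G (cons l' c) e

/-- The piece that contains a given letter. -/
theorem cutSum_insert {x y z r : O} (s : Word L x y) (l : L y z) (t : Word L z r)
    (K : Word L₂ (F₀ x) (F₀ r) → M) :
    cutSum φ (s.insert l t) K = s.sumSplits fun _ a b => t.sumSplits fun _ c e =>
      cutSum φ a fun z₁ => ((φ (b.insert l c)).map fun l' =>
        cutSum φ e fun z₂ => K (z₁.insert l' z₂)).sum := by
  induction s using strong_induction with
  | h s ih =>
  cases s with
  | nil x =>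
    rw [nil_insert, cutSum_cons, sumSplits_nil]
    simp
  | cons l₁ s =>
    -- Either the first piece already contains `l`, or it ends before `l` and the induction
    -- hypothesis applies to the remainder. The two sides list these cases in opposite orders.
    rw [cons_insert, cutSum_cons, sumSplits_insert, sumSplits_cons, add_comm]
    congr 1
    · simp
    · symm
      calc _ = s.sumSplits fun _ p q => p.sumSplits fun _ a b => t.sumSplits fun _ c e =>
            ((φ (cons l₁ a)).map fun l' => cutSum φ b fun z₁ => ((φ (q.insert l c)).map fun l'' =>
              cutSum φ e fun z₂ => K (cons l' (z₁.insert l'' z₂))).sum).sum :=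
            sumSplits_congr _ fun m p q _ => by
              rw [sumSplits_comm]
              refine sumSplits_congr _ fun m c e _ => ?_
              rw [cutSum_cons]
              rfl
        _ = _ := by
            rw [sumSplits_assoc]
            refine sumSplits_congr _ fun m a b hab => ?_
            simp only [sumSplits_list_sum]
            congr 2
            funext l'
            exact (ih b (length_lt_cons hab l₁) l fun z => K (cons l' z)).symm

/-- Rewriting a sum over cut words by a condition which holds for these words. -/
theorem cutSum_congr {x y : O} (q : Word L x y) {K K' : Word L₂ (F₀ x) (F₀ y) → M}
    (P : ∀ ⦃x y : O⦄, Word L x y → Word L₂ (F₀ x) (F₀ y) → Prop)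
    (hnil : ∀ x, P (nil x) (nil (F₀ x)))
    (hcons : ∀ ⦃x y z r : O⦄ (l : L x y) (a : Word L y z) (b : Word L z r) l',
      l' ∈ φ (cons l a) → ∀ z', P b z' → P (cons l (a.append b)) (cons l' z'))
    (h : ∀ z, P q z → K z = K' z) : cutSum φ q K = cutSum φ q K' := by
  induction q using strong_induction with
  | h q ih =>
  cases q with
  | nil => simpa using h _ (hnil _)
  | cons l t =>
    rw [cutSum_cons, cutSum_cons]
    refine sumSplits_congr _ fun m a b hab => ?_
    refine congrArg List.sum (List.map_congr_left fun l' hl' => ?_)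
    refine ih b (length_lt_cons hab l) fun z hz => h _ ?_
    rw [← hab]
    exact hcons l a b l' hl' z hz

/-- If each letter in `φ r` has the degree of the piece `r`, the cut word `z` has the degree of `q`.
Signs that involve `z` can then be computed from `q`. -/
theorem cutSum_congr_total {x y : O} (q : Word L x y) {K K' : Word L₂ (F₀ x) (F₀ y) → M}
    (f : ∀ ⦃x y : O⦄, L x y → ℤ) (f' : ∀ ⦃x y : O₂⦄, L₂ x y → ℤ)
    (hφ : ∀ ⦃x y : O⦄ (r : Word L x y), ∀ l' ∈ φ r, f' l' = r.total f)
    (h : ∀ z, z.total f' = q.total f → K z = K' z) : cutSum φ q K = cutSum φ q K' := by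
  refine cutSum_congr φ q (fun _ _ s z => z.total f' = s.total f) (fun _ => rfl) ?_ h
  intro x y z r l a b l' hl' z' hz'
  have := hφ _ l' hl'
  simp only [total_cons, total_append] at this ⊢
  omega

end Word

/-! ### Signs and rotations -/

/-- Signs depend only on exponents modulo `2`. Each comparison of signs below becomes a polynomial
identity over `ZMod 2` in the degrees involved, often settled by trying all values. -/
theorem Int.negOnePow_congr {m n : ℤ} (h : (m : ZMod 2) = n) : m.negOnePow = n.negOnePow := by
  rw [Int.negOnePow_eq_iff]
  rw [ZMod.intCast_eq_intCast_iff_dvd_sub] at h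
  rw [← even_neg, neg_sub, even_iff_two_dvd]
  exact_mod_cast h

theorem negOnePow_smul_congr {X : Type*} [SMul ℤˣ X] {m n : ℤ} (a : X) (h : (m : ZMod 2) = n) :
    m.negOnePow • a = n.negOnePow • a := by
  rw [Int.negOnePow_congr h]

theorem negOnePow_smul_of_cast {X : Type*} [AddCommGroup X] {m : ℤ} (a : X)
    (h : (m : ZMod 2) = 0) : m.negOnePow • a = a := by
  rw [Int.negOnePow_congr (n := 0) (by simpa using h), Int.negOnePow_zero, one_smul]

theorem negOnePow_smul_smul {X : Type*} [AddCommGroup X] (m n : ℤ) (a : X) :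
    m.negOnePow • n.negOnePow • a = (m + n).negOnePow • a := by
  rw [smul_smul, Int.negOnePow_add]

theorem map_negOnePow_smul {X Y G : Type*} [AddCommGroup X] [AddCommGroup Y] [FunLike G X Y]
    [AddMonoidHomClass G X Y] (f : G) (n : ℤ) (a : X) :
    f (n.negOnePow • a) = n.negOnePow • f a := by
  rw [Units.smul_def, Units.smul_def, map_zsmul]

theorem smul_negOnePow_comm {k X : Type*} [Ring k] [AddCommGroup X] [Module k X] (c : k) (n : ℤ)
    (a : X) : c • n.negOnePow • a = n.negOnePow • c • a := by
  rw [Units.smul_def, Units.smul_def, smul_comm]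

/-- A function of cyclic words with Koszul signs under the rotation of a letter has Koszul
signs under all rotations. -/
theorem Word.rotate {O : Type w} {L : O → O → Type v} (deg : ∀ ⦃x y : O⦄, L x y → ℤ)
    {X : Type*} [AddCommGroup X] (Z : ∀ ⦃x y : O⦄, Word L x y → L y x → X)
    (h : ∀ ⦃x y z : O⦄ (a : L x y) (s : Word L y z) (l : L z x), Z (.cons a s) l =
      (deg a * (s.total deg + deg l)).negOnePow • Z (s.append (.cons l (.nil _))) a)
    ⦃x y z r : O⦄ (q : Word L x y) (l₀ : L y z) (t : Word L z r) (l : L r x) :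
    Z (q.insert l₀ t) l = ((q.total deg + deg l₀) * (t.total deg + deg l)).negOnePow •
      Z (t.insert l q) l₀ := by
  induction q generalizing r with
  | nil x =>
    rw [Word.nil_insert, h]
    simp [Word.insert]
  | cons a q ih =>
    rw [Word.cons_insert, h, Word.insert_append, ih, negOnePow_smul_smul, Word.append_insert,
      ← Word.insert]
    refine negOnePow_smul_congr _ ?_
    simp only [Word.total_insert, Word.total_cons, Word.total_nil]
    push_cast
    generalize (deg a : ZMod 2) = a, (deg l : ZMod 2) = b, (deg l₀ : ZMod 2) = c,
      (q.total deg : ZMod 2) = e, (t.total deg : ZMod 2) = f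
    decide +revert

/-! ### Operations as functions of cyclic words -/

section Forms

variable {k : Type u} [Field k] {O : Type w} {O₂ : Type w₁}
variable {d : ℤ} {A : GradedQuiver.{u, v, w} k O} {B : GradedQuiver.{u, v₁, w₁} k O₂}
  {F₀ : O → O₂} {e : ℤ}

theorem pdeg_eq_total {x y : O} (s : Word (PLetter d A B F₀) x y) :
    pdeg s = s.total PLetter.sdeg := rfl

theorem pdeg_eq_add {x y : O} (s : Word (PLetter d A B F₀) x y) :
    pdeg s = s.total PLetter.sdegA + s.total PLetter.sdegF := by
  induction s with
  | nil x => rfl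
  | cons l s ih =>
    rw [pdeg_eq_total] at *
    simp only [Word.total_cons, ih]
    rcases l with l | l <;> simp [PLetter.sdeg, PLetter.sdegA, PLetter.sdegF] <;> ring

namespace Multi

theorem lastFunctional_inl {x y z : O} (a : A.Letter x y) {s : Word (PLetter d A B F₀) y z}
    (h : lastFunctional s = none) : lastFunctional (.cons (.inl a) s) = none := by
  simp [lastFunctional, h]

theorem lastFunctional_eq_none_of_inl {x y z : O} {a : A.Letter x y}
    {s : Word (PLetter d A B F₀) y z}
    (h : lastFunctional (.cons (.inl a) s) = none) : lastFunctional s = none := by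
  rcases hs : lastFunctional s with _ | r
  · rfl
  · simp [lastFunctional, hs] at h

theorem lastFunctional_inr_ne_none {x y z : O} (f : FLetter d B F₀ x y)
    (s : Word (PLetter d A B F₀) y z) : lastFunctional (.cons (.inr f) s) ≠ none := by
  rcases hs : lastFunctional s with _ | r <;> simp [lastFunctional, hs]

theorem lastFunctional_append_inl {x y z : O} {s : Word (PLetter d A B F₀) x y}
    (a : A.Letter y z) (h : lastFunctional s = none) :
    lastFunctional (s.append (.cons (.inl a) (.nil _))) = none := by
  induction s with
  | nil x => rfl
  | cons l s ih =>
    rcases l with l | f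
    · exact lastFunctional_inl _ (ih a (lastFunctional_eq_none_of_inl h))
    · exact absurd h (lastFunctional_inr_ne_none f s)

theorem lastFunctional_insert {x y z r : O} (q : Word (PLetter d A B F₀) x y)
    (f : FLetter d B F₀ y z) {a : Word (PLetter d A B F₀) z r} (h : lastFunctional a = none) :
    lastFunctional (q.insert (.inr f) a) = some ⟨_, _, q, f, a⟩ := by
  induction q with
  | nil x => simp [lastFunctional, h]
  | cons l q ih => simp [lastFunctional, ih f]

theorem lastFunctional_none_or {x y : O} (s : Word (PLetter d A B F₀) x y) :
    lastFunctional s = none ∨ ∃ (z z' : O) (q : Word (PLetter d A B F₀) x z)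
      (f : FLetter d B F₀ z z') (a : Word (PLetter d A B F₀) z' y),
      s = q.insert (.inr f) a ∧ lastFunctional a = none := by
  induction s with
  | nil x => exact .inl rfl
  | cons l s ih =>
    rcases ih with h | ⟨z, z', q, f, a, rfl, ha⟩
    · rcases l with l | f
      · exact .inl (lastFunctional_inl l h)
      · exact .inr ⟨_, _, .nil _, f, s, rfl, h⟩
    · exact .inr ⟨_, _, .cons l q, f, a, rfl, ha⟩

theorem exponentAux_of_none {x y : O} {s : Word (PLetter d A B F₀) x y}
    (h : lastFunctional s = none) (P c : ℤ) : exponentAux d e P c s = pdeg s * P := by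
  induction s generalizing c with
  | nil x => simp [exponentAux, pdeg]
  | cons l s ih =>
    rcases l with l | f
    · rw [exponentAux, ih (lastFunctional_eq_none_of_inl h)]
      simp only [pdeg, Word.total_cons, PLetter.sdeg]
      ring
    · exact absurd h (lastFunctional_inr_ne_none f s)

theorem exponentAux_insert_inr {x y z r : O} (q : Word (PLetter d A B F₀) x y)
    (f : FLetter d B F₀ y z) {a : Word (PLetter d A B F₀) z r} (h : lastFunctional a = none)
    (P c : ℤ) : exponentAux d e P c (q.insert (.inr f) a) = exponentAux d e P c q +
      (f.1 - 1) * (P + c + q.total PLetter.sdegA) + (e + 1) * (f.1 - 1) + d +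
        pdeg a * (P + c + q.total PLetter.sdegA) := by
  induction q generalizing P c with
  | nil x =>
    simp [exponentAux, exponentAux_of_none h]
  | cons l q ih =>
    rcases l with l | g <;>
      simp only [Word.cons_insert, exponentAux, ih, Word.total_cons, PLetter.sdegA] <;> ring

/-- The prefix degree enters the exponent linearly, multiplied by the degree of each letter that is
read. -/
theorem exponentAux_add {x y : O} (q : Word (PLetter d A B F₀) x y) (X P c : ℤ) :
    exponentAux d e (P + X) c q = exponentAux d e P c q + X * pdeg q := by
  induction q generalizing P c with
  | nil x => simp [exponentAux, pdeg]
  | cons l q ih =>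
    rcases l with l | f
    · simp only [exponentAux, ih, pdeg, Word.total_cons, PLetter.sdeg]
      ring
    · simp only [exponentAux, add_right_comm P X c, ih, pdeg, Word.total_cons, PLetter.sdeg]
      ring

theorem exponentAux_insert_of_none {x y z r : O} {a : Word (PLetter d A B F₀) x y}
    (h : lastFunctional a = none) (f : FLetter d B F₀ y z) (q : Word (PLetter d A B F₀) z r)
    (P c : ℤ) : exponentAux d e P c (a.insert (.inr f) q) = pdeg a * P +
      (f.1 - 1) * (P + c + pdeg a) + (e + 1) * (f.1 - 1) + d +
        exponentAux d e (P + c + pdeg a) 0 q := by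
  induction a generalizing P c with
  | nil x => simp [exponentAux, pdeg]
  | cons l a ih =>
    rcases l with l | g
    · simp only [Word.cons_insert, exponentAux, ih (lastFunctional_eq_none_of_inl h), pdeg,
        Word.total_cons, PLetter.sdeg]
      ring_nf
    · exact absurd h (lastFunctional_inr_ne_none g a)

/-- The value of `F` on the cyclic word `s l`. -/
noncomputable def form (F : Multi d A B F₀ e) ⦃x y : O⦄ (s : Word (PLetter d A B F₀) x y) :
    PLetter d A B F₀ y x → k
  | .inl b => F.cyc s b
  | .inr f => F.closed s f

/-- The exponents from `koszul`, from the pairing `Γ` and from `IsCyclic` add up to the Koszul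
exponent of the rotation. This is the point where the sign conventions have to agree; beyond it only
Koszul signs of rotations matter. -/
theorem closed_rotate {F : Multi d A B F₀ e} (hF : F.IsCyclic) {x y z z' : O}
    (q : Word (PLetter d A B F₀) x z) (f : FLetter d B F₀ z z')
    {a : Word (PLetter d A B F₀) z' y} (f' : FLetter d B F₀ y x) (ha : lastFunctional a = none) :
    F.closed (q.insert (.inr f) a) f' =
      ((pdeg q + (f.1 - 1)) * (pdeg a + (f'.1 - 1))).negOnePow •
        F.closed (a.insert (.inr f') q) f := by
  have h := hF q f a f' ha
  simp only [closed, hatTot, koszul, map_negOnePow_smul, h, negOnePow_smul_smul,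
    exponentAux_insert_inr q f ha, exponentAux_insert_of_none ha f' q]
  refine negOnePow_smul_congr _ ?_
  -- On the right, `q` is read after `a`. Removing the contribution of that prefix leaves the same
  -- exponent of `q` on both sides, which cancels.
  rw [exponentAux_add]
  simp only [pdeg_eq_total, Word.total_insert, PLetter.sdeg]
  simp only [← pdeg_eq_total, pdeg_eq_add q]
  push_cast
  generalize ((f.1 : ℤ) : ZMod 2) = f₁, ((f'.1 : ℤ) : ZMod 2) = f₂,
    (pdeg a : ZMod 2) = a, (q.total PLetter.sdegA : ZMod 2) = q₁,
    (q.total PLetter.sdegF : ZMod 2) = q₂, (exponentAux d e 0 0 q : ZMod 2) = E,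
    (d : ZMod 2) = d, (e : ZMod 2) = e
  decide +revert

end Multi
end Forms

/-! ### Rotation of the values on cyclic words. -/

section Linearity

variable {k : Type u} [Field k] {O : Type w} {O₂ : Type w₁}
variable {d : ℤ} {A : GradedQuiver.{u, v, w} k O} {B : GradedQuiver.{u, v₁, w₁} k O₂}
  {F₀ : O → O₂} {e : ℤ}

namespace Multi

theorem cyc_of_none (F : Multi d A B F₀ e) {x y : O} {s : Word (PLetter d A B F₀) x y}
    (h : lastFunctional s = none) (b : A.Letter y x) : F.cyc s b = 0 := by
  simp [cyc, h]

theorem cyc_insert (F : Multi d A B F₀ e) {x y z z' : O} (q : Word (PLetter d A B F₀) x z)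
    (f : FLetter d B F₀ z z') {a : Word (PLetter d A B F₀) z' y} (h : lastFunctional a = none)
    (b : A.Letter y x) : F.cyc (q.insert (.inr f) a) b =
      ((pdeg a + (b.1 - 1)) * (pdeg q + (f.1 - 1))).negOnePow • F.closed (a.insert (.inl b) q) f := by
  simp [cyc, lastFunctional_insert q f h]

/-- Since `cyc` is itself defined by rotating the last functional to the end, the two sides often
reduce to the same closed value, or both vanish for lack of a functional. Cyclic invariance, through
`closed_rotate`, is needed only when different functionals close the two sides: the first letter is
a functional and so is the last letter or some letter of `s`. -/
theorem form_rotate_letter {F : Multi d A B F₀ e} (hF : F.IsCyclic) ⦃x y z : O⦄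
    (l₁ : PLetter d A B F₀ x y) (s : Word (PLetter d A B F₀) y z) (l : PLetter d A B F₀ z x) :
    F.form (.cons l₁ s) l =
      (PLetter.sdeg l₁ * (s.total PLetter.sdeg + PLetter.sdeg l)).negOnePow •
        F.form (s.append (.cons l (.nil _))) l₁ := by
  rcases l with b | f
  · rcases lastFunctional_none_or s with hs | ⟨_, _, q, f, t, rfl, ht⟩
    · have hs' := lastFunctional_append_inl b hs
      rcases l₁ with a | g
      · simp only [form]
        rw [cyc_of_none F (lastFunctional_inl a hs), cyc_of_none F hs', smul_zero]
      · have := F.cyc_insert (.nil _) g hs b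
        rw [Word.nil_insert] at this
        simp only [form]
        rw [this]
        refine negOnePow_smul_congr _ ?_
        simp only [pdeg, Word.total_nil, PLetter.sdeg]
        push_cast
        ring
    · have ht' := lastFunctional_append_inl b ht
      rw [Word.insert_append]
      rcases l₁ with a | g
      · simp only [form]
        rw [← Word.cons_insert, F.cyc_insert _ f ht, F.cyc_insert _ f ht', negOnePow_smul_smul,
          Word.append_insert, ← Word.insert]
        refine negOnePow_smul_congr _ ?_
        simp only [pdeg, Word.total_nil, Word.total_cons, Word.total_insert,
          PLetter.sdeg]
        push_cast
        generalize ((a.1 : ℤ) : ZMod 2) = a, ((b.1 : ℤ) : ZMod 2) = b, ((f.1 : ℤ) : ZMod 2) = f,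
          ((q.total PLetter.sdeg : ℤ) : ZMod 2) = q, ((t.total PLetter.sdeg : ℤ) : ZMod 2) = t
        decide +revert
      · simp only [form]
        rw [← Word.cons_insert, F.cyc_insert _ f ht, closed_rotate hF _ _ _ ht',
          negOnePow_smul_smul, Word.append_insert, ← Word.insert]
        refine negOnePow_smul_congr _ ?_
        simp only [pdeg, Word.total_nil, Word.total_cons, Word.total_insert,
          PLetter.sdeg]
        push_cast
        generalize ((g.1 : ℤ) : ZMod 2) = a, ((b.1 : ℤ) : ZMod 2) = b, ((f.1 : ℤ) : ZMod 2) = f,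
          ((q.total PLetter.sdeg : ℤ) : ZMod 2) = q, ((t.total PLetter.sdeg : ℤ) : ZMod 2) = t
        decide +revert
  · rcases l₁ with a | g
    · have := F.cyc_insert s f (a := .nil _) rfl a
      rw [Word.nil_insert] at this
      simp only [form]
      rw [← Word.insert, this, negOnePow_smul_smul]
      refine (negOnePow_smul_of_cast _ ?_).symm
      simp only [pdeg, Word.total_nil, PLetter.sdeg]
      push_cast
      generalize ((a.1 : ℤ) : ZMod 2) = a, ((f.1 : ℤ) : ZMod 2) = f,
        ((s.total PLetter.sdeg : ℤ) : ZMod 2) = q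
      decide +revert
    · have := closed_rotate hF s f (a := .nil _) g rfl
      rw [Word.nil_insert] at this
      simp only [form]
      rw [← Word.insert, this, negOnePow_smul_smul]
      refine (negOnePow_smul_of_cast _ ?_).symm
      simp only [pdeg, Word.total_nil, PLetter.sdeg]
      push_cast
      generalize ((g.1 : ℤ) : ZMod 2) = a, ((f.1 : ℤ) : ZMod 2) = f,
        ((s.total PLetter.sdeg : ℤ) : ZMod 2) = q
      decide +revert

theorem form_rotate {F : Multi d A B F₀ e} (hF : F.IsCyclic) ⦃x y z r : O⦄
    (q : Word (PLetter d A B F₀) x y) (l₀ : PLetter d A B F₀ y z)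
    (t : Word (PLetter d A B F₀) z r) (l : PLetter d A B F₀ r x) :
    F.form (q.insert l₀ t) l =
      ((pdeg q + PLetter.sdeg l₀) * (pdeg t + PLetter.sdeg l)).negOnePow •
        F.form (t.insert l q) l₀ :=
  Word.rotate PLetter.sdeg F.form (form_rotate_letter hF) q l₀ t l

end Multi

/-! ### Linearity in the letters -/

/-- `Comb c c' l₁ l₂ l` says that `l₁`, `l₂` and `l` are of the same kind and degree, and that
`l = c l₁ + c' l₂`. -/
inductive PLetter.Comb {x y : O} (c c' : k) : PLetter d A B F₀ x y → PLetter d A B F₀ x y →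
    PLetter d A B F₀ x y → Prop
  | inl (p : ℤ) (a b : A.Hom x y p) :
      Comb c c' (.inl ⟨p, a⟩) (.inl ⟨p, b⟩) (.inl ⟨p, c • a + c' • b⟩)
  | inr (p : ℤ) (f g : Module.Dual k (B.Hom (F₀ y) (F₀ x) (-(p + d - 1)))) :
      Comb c c' (.inr ⟨p, f⟩) (.inr ⟨p, g⟩) (.inr ⟨p, c • f + c' • g⟩)

theorem PLetter.Comb.sdeg_left {x y : O} {c c' : k} {l₁ l₂ l : PLetter d A B F₀ x y}
    (h : Comb c c' l₁ l₂ l) : l₁.sdeg = l.sdeg := by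
  cases h <;> rfl

theorem PLetter.Comb.sdeg_right {x y : O} {c c' : k} {l₁ l₂ l : PLetter d A B F₀ x y}
    (h : Comb c c' l₁ l₂ l) : l₂.sdeg = l.sdeg := by
  cases h <;> rfl

/-- Linearity of a function of homogeneous letters. -/
def IsLetterLinear {X : Type*} [AddCommGroup X] [Module k X] {x y : O}
    (K : PLetter d A B F₀ x y → X) : Prop :=
  ∀ ⦃c c' : k⦄ ⦃l₁ l₂ l : PLetter d A B F₀ x y⦄, PLetter.Comb c c' l₁ l₂ l →
    K l = c • K l₁ + c' • K l₂

/-- Linearity of a function of words in each letter. -/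
def IsWordLinear {X : Type*} [AddCommGroup X] [Module k X] {x y : O}
    (K : Word (PLetter d A B F₀) x y → X) : Prop :=
  ∀ ⦃z z' : O⦄ (q : Word (PLetter d A B F₀) x z) (t : Word (PLetter d A B F₀) z' y),
    IsLetterLinear fun l => K (q.insert l t)

namespace IsLetterLinear

variable {X : Type*} [AddCommGroup X] [Module k X] {x y : O} {K : PLetter d A B F₀ x y → X}

theorem inl_zero (h : IsLetterLinear K) (p : ℤ) : K (.inl ⟨p, 0⟩) = 0 := by
  simpa using h (.inl (c := 0) (c' := 0) p 0 0)

theorem inr_zero (h : IsLetterLinear K) (p : ℤ) : K (.inr ⟨p, 0⟩) = 0 := by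
  simpa using h (.inr (c := 0) (c' := 0) p 0 0)

theorem inl_add (h : IsLetterLinear K) (p : ℤ) (a b : A.Hom x y p) :
    K (.inl ⟨p, a + b⟩) = K (.inl ⟨p, a⟩) + K (.inl ⟨p, b⟩) := by
  simpa using h (.inl (c := 1) (c' := 1) p a b)

theorem inr_add (h : IsLetterLinear K) (p : ℤ)
    (a b : Module.Dual k (B.Hom (F₀ y) (F₀ x) (-(p + d - 1)))) :
    K (.inr ⟨p, a + b⟩) = K (.inr ⟨p, a⟩) + K (.inr ⟨p, b⟩) := by
  simpa using h (.inr (c := 1) (c' := 1) p a b)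

theorem inl_sum (h : IsLetterLinear K) (p : ℤ) {ι : Type*} (l : List ι) (a : ι → A.Hom x y p) :
    K (.inl ⟨p, (l.map a).sum⟩) = (l.map fun i => K (.inl ⟨p, a i⟩)).sum := by
  induction l with
  | nil => exact h.inl_zero p
  | cons i l ih => simp [h.inl_add, ih]

theorem inr_sum (h : IsLetterLinear K) (p : ℤ) {ι : Type*} (l : List ι)
    (a : ι → Module.Dual k (B.Hom (F₀ y) (F₀ x) (-(p + d - 1)))) :
    K (.inr ⟨p, (l.map a).sum⟩) = (l.map fun i => K (.inr ⟨p, a i⟩)).sum := by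
  induction l with
  | nil => exact h.inr_zero p
  | cons i l ih => simp [h.inr_add, ih]

theorem sign (h : IsLetterLinear K) (n : PLetter d A B F₀ x y → ℤ)
    (hn : ∀ l l' : PLetter d A B F₀ x y, l.sdeg = l'.sdeg → n l = n l') :
    IsLetterLinear fun l => (n l).negOnePow • K l :=
  fun c₁ c₂ l₁ l₂ l hl => by
    change (n l).negOnePow • K l = c₁ • (n l₁).negOnePow • K l₁ + c₂ • (n l₂).negOnePow • K l₂
    rw [h hl, hn _ _ hl.sdeg_left, hn _ _ hl.sdeg_right, smul_negOnePow_comm,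
      smul_negOnePow_comm, smul_add]

end IsLetterLinear

namespace Multi

/-- The closing letter enters through the evaluation of a functional or through the linear map
`dualHat`, so no cyclic invariance is needed here. -/
theorem form_linear_letter (F : Multi d A B F₀ e) {x y : O} (s : Word (PLetter d A B F₀) x y) :
    IsLetterLinear (F.form s) := by
  intro c c' l₁ l₂ l h
  cases h with
  | inl p a b =>
    -- Any degree is the degree `-(n + d - 1)` on which `dualHat s n` is defined, for a suitable
    -- `n`.
    obtain ⟨n, rfl⟩ : ∃ n : ℤ, p = -(n + d - 1) := ⟨1 - d - p, by ring⟩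
    have h₁ : ∀ b, F.form s (.inl ⟨_, b⟩) = (pdeg s).negOnePow • F.dualHat s n b := fun b => by
      simp [dualHat, form, smul_smul]
    rw [h₁, h₁, h₁, _root_.map_add, _root_.map_smul, _root_.map_smul, smul_add,
      smul_negOnePow_comm, smul_negOnePow_comm]
  | inr p f g =>
    simp only [form, closed]
    simp only [FLetter.eval, LinearMap.comp_apply, LinearMap.add_apply, LinearMap.smul_apply,
      smul_add]
    rw [smul_negOnePow_comm, smul_negOnePow_comm]

/-- A rotation brings any letter, functional or not, to the closing position, where linearity is
known; the sign depends only on degrees. -/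
theorem form_linear {F : Multi d A B F₀ e} (hF : F.IsCyclic) {x y : O} (l : PLetter d A B F₀ y x) :
    IsWordLinear fun s : Word (PLetter d A B F₀) x y => F.form s l := by
  intro z z' q t
  rw [show (fun l' => F.form (q.insert l' t) l) = _ from funext fun l' => form_rotate hF q l' t l]
  exact (F.form_linear_letter _).sign _ fun l l' h => by rw [h]

/-- Together with `form_inl`, this is the dictionary between scalar identities on cyclic words and
identities between `hat`s and `dualHat`s. -/
theorem form_inr (F : Multi d A B F₀ e) {x y : O} (s : Word (PLetter d A B F₀) x y)
    (p : ℤ) (f : Module.Dual k (B.Hom (F₀ x) (F₀ y) (-(p + d - 1)))) :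
    F.form s (.inr ⟨p, f⟩) = ((pdeg s + e) * (p - 1) + (p - 1)).negOnePow • f (F.hat s _) :=
  rfl

theorem form_inl (F : Multi d A B F₀ e) {x y : O} (s : Word (PLetter d A B F₀) x y)
    (n : ℤ) (b : A.Hom y x (-(n + d - 1))) :
    F.form s (.inl ⟨_, b⟩) = (pdeg s).negOnePow • F.dualHat s n b := by
  simp [dualHat, form, smul_smul]

end Multi
end Linearity

/-! ### Degrees -/

section Degrees

variable {k : Type u} [Field k] {O : Type w} {O₂ : Type w₁} {O₃ : Type w₂}
variable {d : ℤ} {A : GradedQuiver.{u, v, w} k O} {B : GradedQuiver.{u, v₁, w₁} k O₂}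
  {C : GradedQuiver.{u, v₂, w₂} k O₃} {F₀ : O → O₂} {G₀ : O₂ → O₃} {e e' : ℤ}

theorem GradedQuiver.toTot_apply (Q : GradedQuiver.{u, v, w} k O) {x y : O} {p : ℤ}
    (a : Q.Hom x y p) : Q.toTot a p = a := by
  simp [toTot]

theorem GradedQuiver.toTot_apply_of_ne (Q : GradedQuiver.{u, v, w} k O) {x y : O} {p n : ℤ}
    (a : Q.Hom x y p) (h : p ≠ n) : Q.toTot a n = 0 := by
  rw [toTot]
  exact DirectSum.of_eq_of_ne _ _ _ h.symm

/-- The total degree in `B^*[d]` of the functionals of a list. -/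
def FList.sdeg : {g : List (O × O)} → FList d B F₀ g → ℤ
  | _, .nil => 0
  | _, .cons f t => (f.1 - 1) + t.sdeg

theorem FList.sdeg_eq_sum {g : List (O × O)} (f : FList d B F₀ g) :
    f.sdeg = ∑ i, ((f.get i).1 - 1) := by
  induction f with
  | nil => rfl
  | @cons z z' g f t ih =>
    rw [sdeg, ih]
    exact (Fin.sum_univ_succ (n := g.length)
      fun i => (((FList.cons f t).get i).1 - 1)).symm

theorem Blocks.sdeg_consLetter {x x' y : O} {g : List (O × O)} (a : A.Letter x x')
    (b : Blocks A x' y g) : (b.consLetter a).sdeg = (a.1 - 1) + b.sdeg := by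
  cases b with
  | one s => rfl
  | cons s b => exact add_assoc ..

theorem sdeg_parse {x y : O} (s : Word (PLetter d A B F₀) x y) :
    (parse s).blocks.sdeg + (parse s).functionals.sdeg = pdeg s := by
  induction s with
  | nil x => rfl
  | cons l s ih =>
    rw [pdeg_eq_total] at ih
    rw [pdeg_eq_total, Word.total_cons, ← ih]
    rcases l with a | f
    · simp only [parse, Blocks.sdeg_consLetter, PLetter.sdeg]
      ring
    · simp only [parse, Blocks.sdeg, FList.sdeg, PLetter.sdeg]
      change 0 + _ + _ = _
      ring

theorem FLetter.eval_toTot_of_ne {x y : O} (f : FLetter d B F₀ x y) {p : ℤ}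
    (b : B.Hom (F₀ y) (F₀ x) p) (h : p ≠ -(f.1 + d - 1)) : f.eval (B.toTot b) = 0 := by
  have : (DirectSum.component k ℤ (fun p => B.Hom (F₀ y) (F₀ x) p) (-(f.1 + d - 1)))
      (B.toTot b) = 0 := B.toTot_apply_of_ne b h
  rw [eval, LinearMap.comp_apply, this, map_zero]

/-- A functional of degree `p` only sees the component of degree `-(p + d - 1)`, which has degree
`-(p - 1)` in `B[-d]`. Contracting with it therefore raises the total degree of the remaining
outputs by `p - 1`; the shift by `-d` is that of the last output. -/
theorem FList.contract_apply_eq_zero {g : List (O × O)} (f : FList d B F₀ g) {x y : O} {N n : ℤ}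
    {τ : Outputs B F₀ g x y} (hτ : τ ∈ Outputs.homogeneous d B F₀ g x y N)
    (h : n ≠ N - d + f.sdeg) : f.contract x y τ n = 0 := by
  induction hτ using Submodule.span_induction with
  | zero => rw [map_zero]; rfl
  | add a b _ _ ha hb => rw [map_add, DirectSum.add_apply, ha, hb, add_zero]
  | smul c a _ ha => rw [map_smul, DirectSum.smul_apply, ha, smul_zero]
  | mem τ hτ =>
    obtain ⟨p, q, b, c, hN, rfl⟩ := hτ
    simp only [contract, LinearMap.comp_apply, TensorProduct.map_tmul, PiTensorProduct.lift.tprod,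
      LinearEquiv.coe_coe, TensorProduct.lid_tmul, LinearMap.id_apply, DirectSum.smul_apply,
      MultilinearMap.compLinearMap_apply, MultilinearMap.mkPiAlgebra_apply]
    -- Either all the functionals meet their own degree, which fixes the degree of the last output,
    -- or one factor of the product of values is zero.
    by_cases hp : ∀ i, p i = -((f.get i).1 + d - 1)
    · rw [B.toTot_apply_of_ne, smul_zero]
      rintro rfl
      apply h
      have : ∑ i, (p i + d) = - f.sdeg := by
        rw [f.sdeg_eq_sum, ← Finset.sum_neg_distrib]
        exact Finset.sum_congr rfl fun i _ => by rw [hp]; ring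
      omega
    · push Not at hp
      obtain ⟨i, hi⟩ := hp
      rw [Finset.prod_eq_zero (Finset.mem_univ i) ((f.get i).eval_toTot_of_ne _ hi), zero_smul]

namespace Multi

theorem hatTot_apply_eq_zero (F : Multi d A B F₀ e) {x y : O} (s : Word (PLetter d A B F₀) x y)
    {n : ℤ} (h : n ≠ pdeg s + e + 1) : F.hatTot s n = 0 := by
  have : F.contr s n = 0 := (parse s).functionals.contract_apply_eq_zero (F.degree _) (by
    rw [← sdeg_parse] at h
    intro hn
    apply h
    rw [hn]
    ring)
  change DirectSum.component k ℤ (fun p => B.Hom (F₀ x) (F₀ y) p) n (F.hatTot s) = 0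
  rw [hatTot, koszul, map_negOnePow_smul, show DirectSum.component k ℤ _ n (F.contr s) = 0 from this,
    smul_zero]

theorem hat_eq_zero (F : Multi d A B F₀ e) {x y : O} (s : Word (PLetter d A B F₀) x y)
    {n : ℤ} (h : n ≠ pdeg s + e + 1) : F.hat s n = 0 :=
  F.hatTot_apply_eq_zero s h

theorem closed_eq_zero (F : Multi d A B F₀ e) {x y : O} (s : Word (PLetter d A B F₀) x y)
    (f : FLetter d B F₀ y x) (h : pdeg s + (f.1 - 1) + e ≠ -d - 1) : F.closed s f = 0 := by
  have : f.eval (F.hatTot s) = f.2 (F.hat s (-(f.1 + d - 1))) := rfl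
  rw [closed, this, F.hat_eq_zero s (by omega), map_zero, smul_zero]

theorem form_eq_zero (F : Multi d A B F₀ e) {x y : O} (s : Word (PLetter d A B F₀) x y)
    (l : PLetter d A B F₀ y x) (h : pdeg s + l.sdeg + e ≠ -d - 1) : F.form s l = 0 := by
  rcases l with b | f
  · rcases lastFunctional_none_or s with hs | ⟨_, _, q, f, a, rfl, ha⟩
    · exact F.cyc_of_none hs b
    · rw [form, F.cyc_insert q f ha, closed_eq_zero, smul_zero]
      simp only [pdeg_eq_total, Word.total_insert, PLetter.sdeg] at h ⊢
      omega
  · exact F.closed_eq_zero s f h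

theorem dualHat_eq_zero (F : Multi d A B F₀ e) {x y : O} (s : Word (PLetter d A B F₀) x y)
    {n : ℤ} (h : n ≠ pdeg s + e + 1) : F.dualHat s n = 0 := by
  ext b
  have := F.form_inl s n b
  rw [F.form_eq_zero _ _ (by simp only [PLetter.sdeg]; omega)] at this
  rw [LinearMap.zero_apply, ← one_smul ℤˣ (F.dualHat s n b), ← Int.negOnePow_even _
    (Even.add_self (pdeg s)), ← negOnePow_smul_smul, ← this, smul_zero]

/-- Contracting an output of `F` with the functional given by `G` is inserting the output of `F`
in `G`. -/
theorem form_dualHat (F : Multi d A B F₀ e) (G : Multi d B C G₀ e') {x y : O}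
    (r : Word (PLetter d A B F₀) x y) (z : Word (PLetter d B C G₀) (F₀ y) (F₀ x)) {m n : ℤ}
    (hm : m = pdeg z + e' + 1) (hn : n = pdeg r + e + 1) :
    F.form r (.inr ⟨m, G.dualHat z m⟩) =
      ((pdeg r + e + 1) * (pdeg z + e') + pdeg z).negOnePow • G.form z (.inl ⟨n, F.hat r n⟩) := by
  rw [F.form_inr]
  by_cases h : n = -(m + d - 1)
  · subst h
    have := G.form_inl z m (F.hat r _)
    rw [this, negOnePow_smul_smul]
    refine negOnePow_smul_congr _ ?_
    rw [hm]
    push_cast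
    generalize (pdeg r : ZMod 2) = a, (pdeg z : ZMod 2) = b, (e : ZMod 2) = e, (e' : ZMod 2) = e'
    decide +revert
  · rw [F.hat_eq_zero r (hn ▸ Ne.symm h), map_zero, smul_zero, G.form_eq_zero, smul_zero]
    simp only [PLetter.sdeg]
    omega

/-- Linearity in a functional or in an input is deduced by duality: functionals separate the points
of a vector space, and paired with a functional the statement is `form_linear`. -/
theorem hat_linear {F : Multi d A B F₀ e} (hF : F.IsCyclic) (x y : O) (n : ℤ) :
    IsWordLinear fun s : Word (PLetter d A B F₀) x y => F.hat s n := by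
  intro z z' q t c c' l₁ l₂ l hl
  obtain ⟨p, rfl⟩ : ∃ p : ℤ, n = -(p + d - 1) := ⟨1 - d - n, by ring⟩
  rw [← sub_eq_zero]
  refine (Module.forall_dual_apply_eq_zero_iff k _).1 fun f => ?_
  have h := form_linear hF (.inr ⟨p, f⟩) q t hl
  have h₁ : pdeg (q.insert l₁ t) = pdeg (q.insert l t) := by
    simp only [pdeg_eq_total, Word.total_insert, hl.sdeg_left]
  have h₂ : pdeg (q.insert l₂ t) = pdeg (q.insert l t) := by
    simp only [pdeg_eq_total, Word.total_insert, hl.sdeg_right]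
  simp only [F.form_inr, h₁, h₂, smul_negOnePow_comm, ← smul_add] at h
  rw [_root_.map_sub, _root_.map_add, _root_.map_smul, _root_.map_smul, sub_eq_zero]
  -- The three values carry the same sign, because the three letters have the same degree; it can be
  -- cancelled.
  exact MulAction.injective _ h

theorem dualHat_linear {F : Multi d A B F₀ e} (hF : F.IsCyclic) (x y : O) (n : ℤ) :
    IsWordLinear fun s : Word (PLetter d A B F₀) x y => F.dualHat s n := by
  intro z z' q t c c' l₁ l₂ l hl
  ext b
  have h := form_linear hF (.inl ⟨_, b⟩) q t hl
  have h₁ : pdeg (q.insert l₁ t) = pdeg (q.insert l t) := by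
    simp only [pdeg_eq_total, Word.total_insert, hl.sdeg_left]
  have h₂ : pdeg (q.insert l₂ t) = pdeg (q.insert l t) := by
    simp only [pdeg_eq_total, Word.total_insert, hl.sdeg_right]
  simp only [F.form_inl, h₁, h₂, smul_negOnePow_comm, ← smul_add] at h
  exact MulAction.injective _ h

theorem hat_nil (F : Multi d A B F₀ e) (x : O) (n : ℤ) :
    F.hat (.nil x) n = 0 := by
  have : F.contr (Word.nil x : Word (PLetter d A B F₀) x x) = 0 := by
    rw [contr, parse, contrParsed, F.uncurved, map_zero]
  rw [hat, hatTot, this, smul_zero]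
  rfl

end Multi

/-! ### Words without nonzero functionals -/

/-- All the functionals in the word are zero. -/
def IsNull {x y : O} : Word (PLetter d A B F₀) x y → Prop
  | .nil _ => True
  | .cons (.inl _) t => IsNull t
  | .cons (.inr f) t => f.2 = 0 ∧ IsNull t

theorem isNull_append {x y z : O} (s : Word (PLetter d A B F₀) x y)
    (t : Word (PLetter d A B F₀) y z) : IsNull (s.append t) ↔ IsNull s ∧ IsNull t := by
  induction s with
  | nil x => simp [IsNull]
  | cons l s ih => rcases l with a | f <;> simp [IsNull, ih, and_assoc]

theorem isNull_of_lastFunctional {x y : O} {s : Word (PLetter d A B F₀) x y}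
    (h : Multi.lastFunctional s = none) : IsNull s := by
  induction s with
  | nil x => trivial
  | cons l s ih =>
    rcases l with a | f
    · exact ih (Multi.lastFunctional_eq_none_of_inl h)
    · exact absurd h (Multi.lastFunctional_inr_ne_none f s)

namespace Multi

/-- The value is a closed value whose last letter is one of the functionals of the cyclic word,
hence a zero functional; without functionals it is zero by definition. -/
theorem form_eq_zero_of_isNull {F : Multi d A B F₀ e} {x y : O}
    {s : Word (PLetter d A B F₀) x y} {l : PLetter d A B F₀ y x}
    (h : IsNull (s.append (.cons l (.nil _)))) : F.form s l = 0 := by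
  rw [isNull_append] at h
  rcases l with b | ⟨p, f⟩
  · rcases lastFunctional_none_or s with hs | ⟨_, _, q, ⟨p, f⟩, a, rfl, ha⟩
    · exact F.cyc_of_none hs b
    · have hf : f = 0 := ((isNull_append _ _).1 h.1).2.1
      rw [form, F.cyc_insert q _ ha, hf]
      change _ • F.form _ (.inr _) = 0
      rw [(F.form_linear_letter _).inr_zero, smul_zero]
  · have hf : f = 0 := h.2.1
    rw [hf, (F.form_linear_letter _).inr_zero]

theorem dualHat_of_isNull {F : Multi d A B F₀ e} {x y : O}
    {s : Word (PLetter d A B F₀) x y} (h : IsNull s) (n : ℤ) : F.dualHat s n = 0 := by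
  ext b
  have : F.form s (.inl ⟨_, b⟩) = _ := F.form_inl s n b
  rw [form_eq_zero_of_isNull (by rw [isNull_append]; exact ⟨h, trivial⟩)] at this
  refine MulAction.injective (pdeg s).negOnePow ?_
  dsimp only
  rw [← this, LinearMap.zero_apply, smul_zero]

end Multi
end Degrees

/-! ### Sums over decompositions of cyclic words -/

namespace Word

variable {O : Type w} {L : O → O → Type v} {O₂ : Type w₁} {L₂ : O₂ → O₂ → Type v₁} {F₀ : O → O₂}
variable {X : Type*} [AddCommGroup X]

/-- The sum over the ways to cut the cyclic word `s l` in pieces, to apply `φ` to the pieces, and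
`Z` to the cyclic word obtained; the piece of `l` is `t l q`. -/
def cyclicCutSum (deg : ∀ ⦃x y : O⦄, L x y → ℤ)
    (φ : ∀ ⦃x y : O⦄, Word L x y → List (L₂ (F₀ x) (F₀ y)))
    (Z : ∀ ⦃x y : O₂⦄, Word L₂ x y → L₂ y x → X) ⦃x y : O⦄ (s : Word L x y) (l : L y x) : X :=
  s.sumSplits₃ fun _ _ q r t =>
    (q.total deg * (r.total deg + t.total deg + deg l)).negOnePow •
      cutSum φ r fun z => ((φ (t.insert l q)).map fun l' => Z z l').sum

theorem negOnePow_smul_list_sum {ι : Type*} (n : ℤ) (l : List ι) (f : ι → X) :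
    n.negOnePow • (l.map f).sum = (l.map fun i => n.negOnePow • f i).sum := by
  induction l with
  | nil => simp
  | cons i l ih => simp [smul_add, ih]

theorem cyclicCutSum_rotate_letter {deg : ∀ ⦃x y : O⦄, L x y → ℤ}
    {deg₂ : ∀ ⦃x y : O₂⦄, L₂ x y → ℤ}
    {φ : ∀ ⦃x y : O⦄, Word L x y → List (L₂ (F₀ x) (F₀ y))}
    (hφ : ∀ ⦃x y : O⦄ (r : Word L x y), ∀ l' ∈ φ r, deg₂ l' = r.total deg)
    {Z : ∀ ⦃x y : O₂⦄, Word L₂ x y → L₂ y x → X}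
    (hZ : ∀ ⦃x y z : O₂⦄ (a : L₂ x y) (s : Word L₂ y z) (l : L₂ z x), Z (.cons a s) l =
      (deg₂ a * (s.total deg₂ + deg₂ l)).negOnePow • Z (s.append (.cons l (.nil _))) a)
    ⦃x y z : O⦄ (a : L x y) (s : Word L y z) (l : L z x) :
    cyclicCutSum deg φ Z (.cons a s) l = (deg a * (s.total deg + deg l)).negOnePow •
      cyclicCutSum deg φ Z (s.append (.cons l (.nil _))) a := by
  rw [← Word.insert, cyclicCutSum, cyclicCutSum, sumSplits₃, sumSplits₃, sumSplits_insert,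
    sumSplits_cons, sumSplits_cons]
  simp only [sumSplits_insert, sumSplits_nil, sumSplits_add, smul_add, smul_sumSplits]
  have hadd (p q r p' q' r' : X) (h₁ : r = p') (h₂ : q = q') (h₃ : p = r') :
      p + q + r = p' + q' + r' := by
    rw [h₁, h₂, h₃]
    abel
  -- Three kinds of cuts: `l` and `a` are consecutive inside one piece; they are in different
  -- pieces; or the whole cyclic word is a single piece which starts with `a` and ends with `l`.
  -- Only in the second case does the resulting word have to be rotated by `hZ`.
  refine hadd _ _ _ _ _ _ ?_ ?_ ?_
  · refine sumSplits_congr _ fun m q w hw => sumSplits_congr _ fun n r t hr => ?_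
    subst hw hr
    rw [negOnePow_smul_smul, insert_insert]
    refine negOnePow_smul_congr _ ?_
    simp only [total_cons, total_append, total_insert, total_nil]
    push_cast
    generalize (deg a : ZMod 2) = a, (deg l : ZMod 2) = b, (q.total deg : ZMod 2) = q,
      (r.total deg : ZMod 2) = r, (t.total deg : ZMod 2) = t
    decide +revert
  · simp only [cutSum_cons, cutSum_insert, sumSplits_nil, cutSum_nil, smul_sumSplits, total_nil, zero_mul,
      Int.negOnePow_zero, one_smul]
    rw [sumSplits_assoc]
    refine sumSplits_congr _ fun m q w hw => sumSplits_congr _ fun n c t hc => ?_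
    subst hw hc
    rw [negOnePow_smul_smul, smul_cutSum, ← cutSum_list_sum]
    refine cutSum_congr_total φ c deg deg₂ hφ fun z hz => ?_
    rw [sum_list_comm, negOnePow_smul_list_sum]
    refine congrArg List.sum (List.map_congr_left fun l' hl' => ?_)
    rw [negOnePow_smul_list_sum]
    refine congrArg List.sum (List.map_congr_left fun l₂ hl₂ => ?_)
    rw [hZ, ← Word.insert]
    refine negOnePow_smul_congr _ ?_
    rw [hφ _ _ hl', hφ _ _ hl₂, hz]
    simp only [total_cons, total_append, total_insert, total_nil]
    push_cast
    generalize (deg a : ZMod 2) = a, (deg l : ZMod 2) = b, (q.total deg : ZMod 2) = q,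
      (c.total deg : ZMod 2) = r, (t.total deg : ZMod 2) = t
    decide +revert
  · simp only [cutSum_nil]
    rw [negOnePow_smul_smul]
    refine negOnePow_smul_congr _ ?_
    simp only [total_cons, total_insert, total_nil]
    push_cast
    generalize (deg a : ZMod 2) = a, (deg l : ZMod 2) = b, (s.total deg : ZMod 2) = q
    decide +revert

/-- The sum of `C r (t l q)` over the ways to cut the cyclic word `s l` in two arcs `r` and
`t l q`. -/
def cyclicArcSum (deg : ∀ ⦃x y : O⦄, L x y → ℤ)
    (C : ∀ ⦃x y : O⦄, Word L x y → Word L y x → X) ⦃x y : O⦄ (s : Word L x y) (l : L y x) : X :=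
  s.sumSplits₃ fun _ _ q r t =>
    (q.total deg * (r.total deg + t.total deg + deg l)).negOnePow • C r (t.insert l q)

theorem cyclicArcSum_rotate_letter {deg : ∀ ⦃x y : O⦄, L x y → ℤ}
    {C : ∀ ⦃x y : O⦄, Word L x y → Word L y x → X} (hC : ∀ x (s : Word L x x), C (.nil x) s = 0)
    (hsymm : ∀ ⦃x y : O⦄ (r : Word L x y) (t : Word L y x),
      C r t = (r.total deg * t.total deg).negOnePow • C t r)
    ⦃x y z : O⦄ (a : L x y) (s : Word L y z) (l : L z x) :
    cyclicArcSum deg C (.cons a s) l = (deg a * (s.total deg + deg l)).negOnePow •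
      cyclicArcSum deg C (s.append (.cons l (.nil _))) a := by
  rw [← Word.insert, cyclicArcSum, cyclicArcSum, sumSplits₃, sumSplits₃, sumSplits_insert,
    sumSplits_cons, sumSplits_cons]
  simp only [sumSplits_insert, sumSplits_nil, sumSplits_add, smul_add, smul_sumSplits, hC,
    smul_zero, add_zero, zero_add]
  -- If `a` and `l` are in the same arc, the arcs agree on both sides. If the cut is between `l` and
  -- `a`, the arcs exchange their roles, which is where the symmetry of `C` is used. Terms with an
  -- empty arc have been removed by `hC`.
  rw [add_comm]
  refine congrArg₂ (· + ·) ?_ ?_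
  · refine sumSplits_congr _ fun m q w hw => sumSplits_congr _ fun n r t hr => ?_
    subst hw hr
    rw [negOnePow_smul_smul, insert_insert]
    refine negOnePow_smul_congr _ ?_
    simp only [total_cons, total_append, total_insert, total_nil]
    push_cast
    generalize (deg a : ZMod 2) = a, (deg l : ZMod 2) = b, (q.total deg : ZMod 2) = q,
      (r.total deg : ZMod 2) = r, (t.total deg : ZMod 2) = t
    decide +revert
  · refine sumSplits_congr _ fun m q w hw => ?_
    subst hw
    rw [nil_insert, hsymm, negOnePow_smul_smul, negOnePow_smul_smul]
    refine negOnePow_smul_congr _ ?_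
    simp only [total_cons, total_append, total_insert, total_nil]
    push_cast
    generalize (deg a : ZMod 2) = a, (deg l : ZMod 2) = b, (q.total deg : ZMod 2) = q,
      (w.total deg : ZMod 2) = r
    decide +revert

end Word

/-! ### The equation of a pre-Calabi-Yau structure -/

section PreCY

variable {k : Type u} [Field k] {O : Type w} {O₂ : Type w₁}
variable {d : ℤ} {A : GradedQuiver.{u, v, w} k O} {B : GradedQuiver.{u, v₁, w₁} k O₂}
  {F₀ : O → O₂}

theorem IsNull.of_lastFunctional_cases {x y : O} (s : Word (PLetter d A B F₀) x y) :
    IsNull s ∨ ∃ (z z' : O) (q : Word (PLetter d A B F₀) x z) (f : FLetter d B F₀ z z')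
      (a : Word (PLetter d A B F₀) z' y), s = q.insert (.inr f) a := by
  rcases Multi.lastFunctional_none_or s with h | ⟨z, z', q, f, a, h, -⟩
  · exact .inl (isNull_of_lastFunctional h)
  · exact .inr ⟨z, z', q, f, a, h⟩

/-- A function of cyclic words with Koszul signs under rotations vanishes if it vanishes
on cyclic words which end with a functional and on words without nonzero functionals. -/
theorem eq_zero_of_rotate {X : Type*} [AddCommGroup X]
    {Z : ∀ ⦃x y : O⦄, Word (PLetter d A B F₀) x y → PLetter d A B F₀ y x → X}
    (hZ : ∀ ⦃x y z : O⦄ (a : PLetter d A B F₀ x y) (s : Word (PLetter d A B F₀) y z)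
      (l : PLetter d A B F₀ z x), Z (.cons a s) l =
      (a.sdeg * (s.total PLetter.sdeg + l.sdeg)).negOnePow • Z (s.append (.cons l (.nil _))) a)
    (hf : ∀ ⦃x y : O⦄ (s : Word (PLetter d A B F₀) x y) (f : FLetter d B F₀ y x),
      Z s (.inr f) = 0)
    (hnull : ∀ ⦃x y : O⦄ (s : Word (PLetter d A B F₀) x y) (b : A.Letter y x), IsNull s →
      Z s (.inl b) = 0) {x y : O} (s : Word (PLetter d A B F₀) x y) (l : PLetter d A B F₀ y x) :
    Z s l = 0 := by
  rcases l with b | f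
  · rcases IsNull.of_lastFunctional_cases s with hs | ⟨z, z', q, f, a, rfl⟩
    · exact hnull s b hs
    · rw [Word.rotate PLetter.sdeg Z hZ, hf, smul_zero]
  · exact hf s f

theorem isNull_insert {x y z r : O} (q : Word (PLetter d A B F₀) x y) (l : PLetter d A B F₀ y z)
    (t : Word (PLetter d A B F₀) z r) :
    IsNull (q.insert l t) ↔ IsNull q ∧ IsNull (.cons l t) :=
  isNull_append ..

theorem isNull_cons_inl {x y z : O} (a : A.Letter x y) (t : Word (PLetter d A B F₀) y z) :
    IsNull (.cons (.inl a) t) ↔ IsNull t := Iff.rfl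

theorem isNull_cons_inr {x y z : O} (f : FLetter d B F₀ x y) (t : Word (PLetter d A B F₀) y z) :
    IsNull (.cons (.inr f) t) ↔ f.2 = 0 ∧ IsNull t := Iff.rfl

namespace Word

variable {L : O → O → Type v} {M : Type*} [AddCommMonoid M]

theorem single_cons_insert {x y z z' r : O} (a : L x y) (q : Word L y z) (l : L z z')
    (t : Word L z' r) : (cons a (q.insert l t)).single = [] := by
  cases q <;> rfl

theorem single_insert_cons {x y z z' r : O} (q : Word L x y) (l : L y z) (a : L z z')
    (t : Word L z' r) : (q.insert l (cons a t)).single = [] := by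
  cases q with
  | nil => rfl
  | cons a q => exact single_cons_insert ..

theorem sumSplits₃_eq_of_nil {x y : O} (r : Word L x y)
    (φ : ∀ ⦃m n : O⦄, Word L x m → Word L m n → Word L n y → M)
    (h : ∀ ⦃m m' n : O⦄ (l : L x m') (a : Word L m' m) (b : Word L m n) (c : Word L n y),
      φ (cons l a) b c = 0)
    (h' : ∀ ⦃n n' : O⦄ (b : Word L x n) (l : L n n') (c : Word L n' y), φ (nil x) b (cons l c) = 0) :
    r.sumSplits₃ φ = φ (nil x) r (nil y) := by
  rw [sumSplits₃, sumSplits_eq_of_nil_left]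
  · exact sumSplits_eq_of_nil_right _ _ fun m n a l b => h' a l b
  · intro m n l a b
    simp only [h, sumSplits_zero]

end Word

theorem PLetter.sdeg_inl {x y : O} (a : A.Letter x y) :
    PLetter.sdeg (.inl a : PLetter d A B F₀ x y) = a.1 - 1 := rfl

theorem PLetter.sdeg_inr {x y : O} (f : FLetter d B F₀ x y) :
    PLetter.sdeg (.inr f : PLetter d A B F₀ x y) = f.1 - 1 := rfl

theorem isNull_nil (x : O) : IsNull (.nil x : Word (PLetter d A B F₀) x x) := trivial

namespace Multi

variable {M : Multi d A A id 1}

/-- The sum of the two values of `M` on a cyclic word cut in two arcs, one of which gives a letter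
of the word in which the other one is. -/
noncomputable def arcPairing (M : Multi d A A id 1) ⦃x y : O⦄ (r : Word (PLetter d A A id) x y)
    (t : Word (PLetter d A A id) y x) : k :=
  ((pdeg r + 1) * pdeg t).negOnePow • (M.form t (.inl ⟨pdeg r + 1 + 1, M.hat r _⟩) +
    M.form t (.inr ⟨pdeg r + 1 + 1, M.dualHat r _⟩))

theorem arcPairing_nil (x : O) (s : Word (PLetter d A A id) x x) :
    M.arcPairing (.nil x) s = 0 := by
  rw [arcPairing, M.hat_nil, dualHat_of_isNull (isNull_nil x), (M.form_linear_letter s).inl_zero,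
    (M.form_linear_letter s).inr_zero, add_zero, smul_zero]

/-- The exchange `form_dualHat` swaps the two summands: inserting the output of the arc `r` in the
arc `t` is contracting that output with the functional defined by `t`. -/
theorem arcPairing_symm ⦃x y : O⦄ (r : Word (PLetter d A A id) x y)
    (t : Word (PLetter d A A id) y x) : M.arcPairing r t =
      (r.total PLetter.sdeg * t.total PLetter.sdeg).negOnePow • M.arcPairing t r := by
  have h₁ := M.form_dualHat M t r (m := pdeg r + 1 + 1) (n := pdeg t + 1 + 1) rfl rfl
  have h₂ := M.form_dualHat M r t (m := pdeg t + 1 + 1) (n := pdeg r + 1 + 1) rfl rfl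
  simp only [arcPairing]
  erw [h₁, h₂]
  simp only [smul_add, negOnePow_smul_smul]
  rw [add_comm]
  simp only [pdeg_eq_total]
  refine congrArg₂ (· + ·) (negOnePow_smul_congr _ ?_) (negOnePow_smul_congr _ ?_) <;>
  · push_cast
    generalize (r.total PLetter.sdeg : ZMod 2) = a, (t.total PLetter.sdeg : ZMod 2) = b
    decide +revert

/-- Rotating `t l q` followed by the value of the arc `r` puts this value back in its place between
`q` and `t`. The result is the Stasheff sum paired with `l`. -/
theorem cyclicArcSum_arcPairing (hM : M.IsCyclic) ⦃x y : O⦄ (s : Word (PLetter d A A id) x y)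
    (l : PLetter d A A id y x) : Word.cyclicArcSum PLetter.sdeg M.arcPairing s l =
      s.sumSplits₃ fun _ _ q r t => (pdeg q).negOnePow •
        (M.form (q.insert (.inl ⟨pdeg r + 1 + 1, M.hat r _⟩) t) l +
          M.form (q.insert (.inr ⟨pdeg r + 1 + 1, M.dualHat r _⟩) t) l) := by
  refine Word.sumSplits₃_congr _ fun m n q r t h => ?_
  rw [form_rotate hM q _ t l, form_rotate hM q _ t l, arcPairing]
  simp only [smul_add]
  simp only [negOnePow_smul_smul]
  simp only [pdeg_eq_total, Word.total_insert, PLetter.sdeg_inl, PLetter.sdeg_inr]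
  refine congrArg₂ (· + ·) (negOnePow_smul_congr _ ?_) (negOnePow_smul_congr _ ?_) <;>
  · push_cast
    generalize (r.total PLetter.sdeg : ZMod 2) = a, (t.total PLetter.sdeg : ZMod 2) = b,
      (q.total PLetter.sdeg : ZMod 2) = c, ((PLetter.sdeg l : ℤ) : ZMod 2) = l
    decide +revert

/-- The two sums in `necklaceSum` are the two summands of `arcPairing`, the second one read from the
other disc through `form_dualHat`. -/
theorem cyclicArcSum_functional (hM : M.IsCyclic) ⦃x y : O⦄ (s : Word (PLetter d A A id) x y)
    (f : FLetter d A id y x) : Word.cyclicArcSum PLetter.sdeg M.arcPairing s (.inr f) =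
      necklaceSum M s f := by
  rw [necklaceSum, ← Word.sumSplits₃_add]
  refine Word.sumSplits₃_congr _ fun m n q r t h => ?_
  have h₁ := M.form_dualHat M (t.insert (.inr f) q) r (m := pdeg r + 1 + 1)
    (n := pdeg (t.insert (.inr f) q) + 1 + 1) rfl rfl
  -- Empty subwords may be included in the first sum, since there is no operation without input and
  -- with one output.
  have h₂ : (if r.isNil then 0 else (pdeg q).negOnePow •
      M.form (q.insert (.inl ⟨pdeg r + 1 + 1, M.hat r _⟩) t) (.inr f)) = (pdeg q).negOnePow •
      M.form (q.insert (.inl ⟨pdeg r + 1 + 1, M.hat r _⟩) t) (.inr f) := by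
    cases r with
    | nil =>
      rw [M.hat_nil, show M.form (q.insert (.inl ⟨_, 0⟩) t) (.inr f) = 0 from
        (form_linear hM (.inr f) q t).inl_zero _]
      simp
    | cons => rfl
  change _ = (if r.isNil then 0 else (pdeg q).negOnePow •
      M.form (q.insert (.inl ⟨pdeg r + 1 + 1, M.hat r _⟩) t) (.inr f)) + _ • M.form r (.inl _)
  rw [h₂, form_rotate hM, arcPairing, smul_add, smul_add]
  erw [h₁]
  simp only [negOnePow_smul_smul]
  simp only [pdeg_eq_total, Word.total_insert, PLetter.sdeg_inl, PLetter.sdeg_inr]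
  refine congrArg₂ (· + ·) (negOnePow_smul_congr _ ?_) (negOnePow_smul_congr _ ?_) <;>
  · push_cast
    generalize (r.total PLetter.sdeg : ZMod 2) = a, (t.total PLetter.sdeg : ZMod 2) = b,
      (q.total PLetter.sdeg : ZMod 2) = c, ((f.1 : ℤ) : ZMod 2) = l
    decide +revert

/-- The Stasheff identities on words of homogeneous letters, paired with a letter. -/
theorem form_stasheff (hM : IsPreCY M) ⦃x y : O⦄ (s : Word (PLetter d A A id) x y)
    (l : PLetter d A A id y x) : (s.sumSplits₃ fun _ _ q r t => (pdeg q).negOnePow •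
        (M.form (q.insert (.inl ⟨pdeg r + 1 + 1, M.hat r _⟩) t) l +
          M.form (q.insert (.inr ⟨pdeg r + 1 + 1, M.dualHat r _⟩) t) l)) = 0 := by
  rw [← cyclicArcSum_arcPairing hM.cyclic]
  refine eq_zero_of_rotate (Z := Word.cyclicArcSum PLetter.sdeg M.arcPairing) ?_ ?_ ?_ s l
  · exact Word.cyclicArcSum_rotate_letter arcPairing_nil arcPairing_symm
  · intro x y s f
    rw [cyclicArcSum_functional hM.cyclic, hM.necklace]
  -- If all the functionals are zero, `dualHat r` is zero as well, so that inserting a value of `M`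
  -- creates no nonzero functional.
  · intro x y s b hs
    rw [cyclicArcSum_arcPairing hM.cyclic, ← Word.sumSplits₃_zero s]
    refine Word.sumSplits₃_congr _ fun m n q r t h => ?_
    rw [← h, isNull_append, isNull_append] at hs
    obtain ⟨hq, hr, ht⟩ := hs
    rw [form_eq_zero_of_isNull, form_eq_zero_of_isNull, add_zero, smul_zero]
    · simp only [isNull_append, isNull_insert, isNull_cons_inl, isNull_cons_inr]
      exact ⟨⟨hq, dualHat_of_isNull hr _, ht⟩, trivial⟩
    · simp only [isNull_append, isNull_insert, isNull_cons_inl]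
      exact ⟨⟨hq, ht⟩, trivial⟩

end Multi
end PreCY

/-! ### The equation of a morphism -/

section Morphisms

variable {k : Type u} [Field k] {O : Type w} {O₂ : Type w₁}
variable {d : ℤ} {A : GradedQuiver.{u, v, w} k O} {B : GradedQuiver.{u, v₁, w₁} k O₂}
  {F₀ : O → O₂} {Φ : Multi d A B F₀ 0} {MA : Multi d A A id 1} {MB : Multi d B B id 1}

theorem mem_single {L : O → O → Type v} {x y : O} {r : Word L x y} {l : L x y} (h : l ∈ r.single) :
    r = .cons l (.nil y) := by
  match r, h with
  | .cons a (.nil _), h =>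
    rw [Word.single, List.mem_singleton] at h
    rw [h]

theorem sdeg_of_mem_lettersA ⦃x y : O⦄ (r : Word (PLetter d A B F₀) x y) (l)
    (h : l ∈ lettersA Φ r) : PLetter.sdeg l = r.total PLetter.sdeg := by
  simp only [lettersA, List.mem_cons, List.mem_flatMap] at h
  rcases h with rfl | ⟨l', hl', h⟩
  · simp only [PLetter.sdeg, pdeg_eq_total]
    ring
  · rw [mem_single hl']
    rcases l' with a | f
    · simp only [List.mem_singleton] at h
      rw [h]
      exact (add_zero _).symm
    · simp at h

theorem sdeg_of_mem_lettersB ⦃x y : O⦄ (r : Word (PLetter d A B F₀) x y) (l)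
    (h : l ∈ lettersB Φ r) : PLetter.sdeg l = r.total PLetter.sdeg := by
  simp only [lettersB, List.mem_cons, List.mem_flatMap] at h
  rcases h with rfl | ⟨l', hl', h⟩
  · simp only [PLetter.sdeg, pdeg_eq_total]
    ring
  · rw [mem_single hl']
    rcases l' with a | f
    · simp at h
    · simp only [List.mem_singleton] at h
      rw [h]
      exact (add_zero _).symm

/-- The list `lettersA Φ r` always contains a functional, even if `r` has none; this functional is
then zero. Hence the notion `IsNull` rather than the absence of functionals. -/
theorem isNull_of_mem_lettersA ⦃x y : O⦄ {r : Word (PLetter d A B F₀) x y} (hr : IsNull r) {l}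
    (h : l ∈ lettersA Φ r) : IsNull (.cons l (.nil y)) := by
  simp only [lettersA, List.mem_cons, List.mem_flatMap] at h
  rcases h with rfl | ⟨l', hl', h⟩
  · exact ⟨Multi.dualHat_of_isNull hr _, trivial⟩
  · rcases l' with a | f
    · simp only [List.mem_singleton] at h
      rw [h]
      trivial
    · simp at h

theorem isNull_of_mem_lettersB ⦃x y : O⦄ {r : Word (PLetter d A B F₀) x y} (hr : IsNull r) {l}
    (h : l ∈ lettersB Φ r) : IsNull (.cons l (.nil (F₀ y))) := by
  simp only [lettersB, List.mem_cons, List.mem_flatMap] at h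
  rcases h with rfl | ⟨l', hl', h⟩
  · trivial
  · rw [mem_single hl'] at hr
    rcases l' with a | f
    · simp at h
    · simp only [List.mem_singleton] at h
      rw [h]
      exact ⟨hr.1, trivial⟩

theorem cyclicCutSum_eq_zero_of_isNull {O₃ : Type w₂} {C : GradedQuiver.{u, v₂, w₂} k O₃}
    {G₀ : O → O₃}
    {M : Multi d C C id 1} {φ : ∀ ⦃x y : O⦄, Word (PLetter d A B F₀) x y →
      List (PLetter d C C id (G₀ x) (G₀ y))}
    (hφ : ∀ ⦃x y : O⦄ {r : Word (PLetter d A B F₀) x y}, IsNull r → ∀ l ∈ φ r,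
      IsNull (.cons l (.nil (G₀ y)))) {x y : O} (s : Word (PLetter d A B F₀) x y)
    (b : A.Letter y x) (hs : IsNull s) :
    Word.cyclicCutSum PLetter.sdeg φ M.form s (.inl b) = 0 := by
  rw [Word.cyclicCutSum, ← Word.sumSplits₃_zero s]
  refine Word.sumSplits₃_congr _ fun m n q r t h => ?_
  rw [← h, isNull_append, isNull_append] at hs
  obtain ⟨hq, hr, ht⟩ := hs
  rw [← Word.cutSum_zero φ r]
  refine (congrArg _ (Word.cutSum_congr φ r (fun _ _ s z => IsNull s → IsNull z)
    (fun x _ => isNull_nil _) ?_ ?_)).trans (by rw [Word.cutSum_zero, smul_zero])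
  · intro x y z r l a b l' hl' z' hz' hlab
    rw [← Word.cons_append, isNull_append] at hlab
    exact (isNull_append (.cons l' (.nil _)) z').2 ⟨hφ hlab.1 _ hl', hz' hlab.2⟩
  · intro z hz
    refine List.sum_eq_zero fun c hc => ?_
    obtain ⟨l', hl', rfl⟩ := List.mem_map.1 hc
    refine Multi.form_eq_zero_of_isNull ((isNull_append _ _).2 ⟨hz hr, hφ ?_ _ hl'⟩)
    exact (isNull_insert _ _ _).2 ⟨ht, hq⟩

theorem IsLetterLinear.inl_cutSum {C : GradedQuiver.{u, v₁, w₁} k O₂} {O₃ : Type*}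
    {L : O → O → Type*} {L₂ : O₃ → O₃ → Type*} {G₀ : O → O₃}
    {D : GradedQuiver.{u, v, w} k O} {E₀ : O → O₂} {X : Type*} [AddCommGroup X] [Module k X]
    {x' y' : O} {K : PLetter d D C E₀ x' y' → X} (hK : IsLetterLinear K)
    (φ : ∀ ⦃x y : O⦄, Word L x y → List (L₂ (G₀ x) (G₀ y))) {x y : O} (r : Word L x y) (n : ℤ)
    (a : Word L₂ (G₀ x) (G₀ y) → D.Hom x' y' n) :
    K (.inl ⟨n, Word.cutSum φ r a⟩) = Word.cutSum φ r fun z => K (.inl ⟨n, a z⟩) :=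
  hK.inl_sum n _ a

theorem IsLetterLinear.inr_cutSum {C : GradedQuiver.{u, v₁, w₁} k O₂} {O₃ : Type*}
    {L : O → O → Type*} {L₂ : O₃ → O₃ → Type*} {G₀ : O → O₃}
    {D : GradedQuiver.{u, v, w} k O} {E₀ : O → O₂} {X : Type*} [AddCommGroup X] [Module k X]
    {x' y' : O} {K : PLetter d D C E₀ x' y' → X} (hK : IsLetterLinear K)
    (φ : ∀ ⦃x y : O⦄, Word L x y → List (L₂ (G₀ x) (G₀ y))) {x y : O} (r : Word L x y) (n : ℤ)
    (a : Word L₂ (G₀ x) (G₀ y) → Module.Dual k (C.Hom (E₀ y') (E₀ x') (-(n + d - 1)))) :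
    K (.inr ⟨n, Word.cutSum φ r a⟩) = Word.cutSum φ r fun z => K (.inr ⟨n, a z⟩) :=
  hK.inr_sum n _ a

/-- Applying a function to a letter if it is in `A`. -/
def PLetter.onA {X : Type*} [Zero X] {x y : O} (K : A.Letter x y → X) : PLetter d A B F₀ x y → X
  | .inl a => K a
  | .inr _ => 0

/-- Applying a function to a letter if it is in `B^*[d-1]`. -/
def PLetter.onF {X : Type*} [Zero X] {x y : O} (K : FLetter d B F₀ x y → X) :
    PLetter d A B F₀ x y → X
  | .inl _ => 0
  | .inr f => K f

/-- The part in `A` of the structure on `A ⊕ B^*[d-1]`, on words of homogeneous letters. -/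
def mixedA (MA : Multi d A A id 1) (Φ : Multi d A B F₀ 0) {x y : O}
    (r : Word (PLetter d A B F₀) x y) (n : ℤ) : A.Hom x y n :=
  Word.cutSum (lettersA Φ) r fun z => MA.hat z n

/-- The part in `B^*[d-1]` of the structure on `A ⊕ B^*[d-1]`, on words of homogeneous letters. -/
def mixedB (MB : Multi d B B id 1) (Φ : Multi d A B F₀ 0) {x y : O}
    (r : Word (PLetter d A B F₀) x y) (n : ℤ) :
    Module.Dual k (B.Hom (F₀ y) (F₀ x) (-(n + d - 1))) :=
  Word.cutSum (lettersB Φ) r fun z => MB.dualHat z n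

/-- The piece `t l q` of the closing letter gives a functional, contracted with an output of `MA`.
By `form_dualHat` that output is inserted in the disc `Φ` of this piece instead; summed over the
cuts of `r` it is `mixedA`, and a rotation puts it in place of `r`. -/
theorem cutSum_form_dualHat (hΦ : Φ.IsCyclic) {x y z z' : O}
    (q : Word (PLetter d A B F₀) x z) (r : Word (PLetter d A B F₀) z z')
    (t : Word (PLetter d A B F₀) z' y) (l : PLetter d A B F₀ y x) :
    (pdeg q * (pdeg r + pdeg t + l.sdeg)).negOnePow • Word.cutSum (lettersA Φ) r (fun z =>
      MA.form z (.inr ⟨pdeg (t.insert l q) + 0 + 1, Φ.dualHat (t.insert l q) _⟩)) =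
    (pdeg q).negOnePow • Φ.form (q.insert (.inl ⟨pdeg r + 1 + 1, mixedA MA Φ r _⟩) t) l := by
  have h : Word.cutSum (lettersA Φ) r (fun z =>
      MA.form z (.inr ⟨pdeg (t.insert l q) + 0 + 1, Φ.dualHat (t.insert l q) _⟩)) =
      ((pdeg r + 1) * pdeg (t.insert l q)).negOnePow •
        Φ.form (t.insert l q) (.inl ⟨pdeg r + 1 + 1, mixedA MA Φ r _⟩) := by
    rw [mixedA, (Φ.form_linear_letter (t.insert l q)).inl_cutSum, Word.smul_cutSum]
    refine Word.cutSum_congr_total (lettersA Φ) r PLetter.sdeg PLetter.sdeg sdeg_of_mem_lettersA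
      fun z hz => ?_
    have hz' : pdeg z = pdeg r := hz
    rw [← hz']
    refine (MA.form_dualHat Φ z (t.insert l q) (n := pdeg z + 1 + 1) rfl rfl).trans ?_
    refine negOnePow_smul_congr _ ?_
    push_cast
    generalize (pdeg z : ZMod 2) = a, (pdeg (t.insert l q) : ZMod 2) = b
    decide +revert
  rw [h, Multi.form_rotate hΦ q _ t l, negOnePow_smul_smul, negOnePow_smul_smul]
  refine negOnePow_smul_congr _ ?_
  simp only [pdeg_eq_total, Word.total_insert, PLetter.sdeg_inl]
  push_cast
  generalize (r.total PLetter.sdeg : ZMod 2) = a, (t.total PLetter.sdeg : ZMod 2) = b,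
    (q.total PLetter.sdeg : ZMod 2) = c, ((PLetter.sdeg l : ℤ) : ZMod 2) = l
  decide +revert

/-- The same exchange with the roles reversed: the output of `Φ` fed to `MB` becomes the functional
`mixedB` contracted with an output of `Φ`. Here `MB`, of degree `1`, is the disc that gives the
functional, whence the minus sign; it moves this sum to the side of the `mixedA` terms in the
equation of a morphism. -/
theorem cutSum_form_hat (hΦ : Φ.IsCyclic) {x y z z' : O}
    (q : Word (PLetter d A B F₀) x z) (r : Word (PLetter d A B F₀) z z')
    (t : Word (PLetter d A B F₀) z' y) (l : PLetter d A B F₀ y x) :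
    (pdeg q * (pdeg r + pdeg t + l.sdeg)).negOnePow • Word.cutSum (lettersB Φ) r (fun z =>
      MB.form z (.inl ⟨pdeg (t.insert l q) + 0 + 1, Φ.hat (t.insert l q) _⟩)) =
    -((pdeg q).negOnePow • Φ.form (q.insert (.inr ⟨pdeg r + 1 + 1, mixedB MB Φ r _⟩) t) l) := by
  have h : Word.cutSum (lettersB Φ) r (fun z =>
      MB.form z (.inl ⟨pdeg (t.insert l q) + 0 + 1, Φ.hat (t.insert l q) _⟩)) =
      ((pdeg r + 1) * pdeg (t.insert l q) + 1).negOnePow •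
        Φ.form (t.insert l q) (.inr ⟨pdeg r + 1 + 1, mixedB MB Φ r _⟩) := by
    rw [mixedB, (Φ.form_linear_letter (t.insert l q)).inr_cutSum, Word.smul_cutSum]
    refine Word.cutSum_congr_total (lettersB Φ) r PLetter.sdeg PLetter.sdeg sdeg_of_mem_lettersB
      fun z hz => ?_
    have hz' : pdeg z = pdeg r := hz
    rw [← hz']
    refine Eq.trans ?_ (congrArg _
      (Φ.form_dualHat MB (t.insert l q) z (n := pdeg (t.insert l q) + 0 + 1) rfl rfl).symm)
    rw [negOnePow_smul_smul]
    refine (negOnePow_smul_of_cast _ ?_).symm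
    push_cast
    generalize (pdeg z : ZMod 2) = a, (pdeg (t.insert l q) : ZMod 2) = b
    decide +revert
  rw [h, Multi.form_rotate hΦ q _ t l, negOnePow_smul_smul, negOnePow_smul_smul]
  rw [← Units.neg_smul, ← Int.negOnePow_succ]
  refine negOnePow_smul_congr _ ?_
  simp only [pdeg_eq_total, Word.total_insert, PLetter.sdeg_inr]
  push_cast
  generalize (r.total PLetter.sdeg : ZMod 2) = a, (t.total PLetter.sdeg : ZMod 2) = b,
    (q.total PLetter.sdeg : ZMod 2) = c, ((PLetter.sdeg l : ℤ) : ZMod 2) = l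
  decide +revert

theorem sum_lettersA {X : Type*} [AddCommMonoid X] {x y : O}
    (r : Word (PLetter d A B F₀) x y) (K : PLetter d A A id x y → X) :
    ((lettersA Φ r).map K).sum =
      K (.inr ⟨pdeg r + 0 + 1, Φ.dualHat r _⟩) +
      (r.single.map (PLetter.onA fun a => K (.inl a))).sum := by
  rw [lettersA, List.map_cons, List.sum_cons, Word.sum_flatMap]
  congr 3
  funext l'
  rcases l' with a | f <;> simp [PLetter.onA]

theorem sum_lettersB {X : Type*} [AddCommMonoid X] {x y : O}
    (r : Word (PLetter d A B F₀) x y) (K : PLetter d B B id (F₀ x) (F₀ y) → X) :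
    ((lettersB Φ r).map K).sum =
      K (.inl ⟨pdeg r + 0 + 1, Φ.hat r _⟩) +
      (r.single.map (PLetter.onF (A := A) (F₀ := F₀) fun f => K (.inr f))).sum := by
  rw [lettersB, List.map_cons, List.sum_cons, Word.sum_flatMap]
  congr 3
  funext l'
  rcases l' with a | f <;> simp [PLetter.onF]

/-- The value of a sum over cyclic words cut in pieces, where the piece of the last letter has
only that letter. -/
theorem sumSplits₃_single {L : O → O → Type v} {O₃ : Type*} {L₂ : O₃ → O₃ → Type*} {G₀ : O → O₃}
    {X : Type*} [AddCommGroup X]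
    (φ : ∀ ⦃x y : O⦄, Word L x y → List (L₂ (G₀ x) (G₀ y))) {x y : O} (s : Word L x y) (l : L y x)
    (c : ∀ ⦃m n : O⦄, Word L x m → Word L m n → Word L n y → ℤˣ)
    (hc : c (.nil x) s (.nil y) = 1)
    (K : ∀ ⦃m n : O⦄, Word L₂ (G₀ m) (G₀ n) → L n m → X) :
    (s.sumSplits₃ fun _ _ q r t => c q r t • Word.cutSum φ r fun z =>
      ((t.insert l q).single.map fun l' => K z l').sum) = Word.cutSum φ s fun z => K z l := by
  rw [Word.sumSplits₃_eq_of_nil, hc, one_smul]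
  · simp [Word.single]
  · intro m m' n l' a b e
    simp [Word.single_insert_cons, Word.cutSum_zero]
  · intro n n' b l' e
    simp [Word.single_cons_insert, Word.cutSum_zero]

/-- The summand `dualHat` for the piece of `l` gives the insertions. The identity summand requires
that piece to be `l` alone and `l` to be in `A`; the rest of the cyclic word is then `s`, which
gives the last term. -/
theorem cyclicCutSum_lettersA (hΦ : Φ.IsCyclic) {x y : O} (s : Word (PLetter d A B F₀) x y)
    (l : PLetter d A B F₀ y x) : Word.cyclicCutSum PLetter.sdeg (lettersA Φ) MA.form s l =
      (s.sumSplits₃ fun _ _ q r t => (pdeg q).negOnePow •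
        Φ.form (q.insert (.inl ⟨pdeg r + 1 + 1, mixedA MA Φ r _⟩) t) l) +
      Word.cutSum (lettersA Φ) s fun z => PLetter.onA (fun b => MA.form z (.inl b)) l := by
  simp only [← cutSum_form_dualHat hΦ]
  have h := sumSplits₃_single (lettersA Φ) s l
      (fun _ _ q r t => (pdeg q * (pdeg r + pdeg t + l.sdeg)).negOnePow)
      (by simp [pdeg]) (fun _ _ z => PLetter.onA fun b => MA.form z (.inl b))
  refine Eq.trans ?_ (congrArg (_ + ·) h)
  rw [← Word.sumSplits₃_add]
  refine Word.sumSplits₃_congr _ fun m n q r t h => ?_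
  rw [← smul_add]
  refine congrArg _ (Eq.trans ?_ (Word.cutSum_add _ _ _ _))
  simp only [sum_lettersA]
  rfl

theorem cyclicCutSum_lettersB (hΦ : Φ.IsCyclic) {x y : O} (s : Word (PLetter d A B F₀) x y)
    (l : PLetter d A B F₀ y x) : Word.cyclicCutSum PLetter.sdeg (lettersB Φ) MB.form s l =
      (s.sumSplits₃ fun _ _ q r t => -((pdeg q).negOnePow •
        Φ.form (q.insert (.inr ⟨pdeg r + 1 + 1, mixedB MB Φ r _⟩) t) l)) +
      Word.cutSum (lettersB Φ) s fun z => PLetter.onF (A := A) (F₀ := F₀) (fun f => MB.form z (.inr f)) l := by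
  simp only [← cutSum_form_hat hΦ]
  have h := sumSplits₃_single (lettersB Φ) s l
      (fun _ _ q r t => (pdeg q * (pdeg r + pdeg t + l.sdeg)).negOnePow)
      (by simp [pdeg]) (fun _ _ z => PLetter.onF (A := A) (F₀ := F₀) fun f => MB.form z (.inr f))
  refine Eq.trans ?_ (congrArg (_ + ·) h)
  rw [← Word.sumSplits₃_add]
  refine Word.sumSplits₃_congr _ fun m n q r t h => ?_
  rw [← smul_add]
  refine congrArg _ (Eq.trans ?_ (Word.cutSum_add _ _ _ _))
  simp only [sum_lettersB]

/-- The piece of `f` has no identity summand, because `f` is not in `A`. -/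
theorem multinecklaceSum_eq {x y : O} (s : Word (PLetter d A B F₀) x y) (f : FLetter d B F₀ y x) :
    multinecklaceSum MA Φ s f =
      Word.cyclicCutSum PLetter.sdeg (lettersA Φ) MA.form s (.inr f) := by
  refine Word.sumSplits₃_congr _ fun m n q r t h => congrArg _ ?_
  refine congrArg (Word.cutSum (lettersA Φ) r) (funext fun z => ?_)
  rw [sum_lettersA]
  refine (add_zero _).symm.trans (congrArg₂ (· + ·) rfl ?_)
  refine (List.sum_eq_zero fun c hc => ?_).symm
  obtain ⟨l', hl', rfl⟩ := List.mem_map.1 hc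
  have := mem_single hl'
  cases t with
  | nil =>
    cases q with
    | nil => cases this; rfl
    | cons a q => cases this
  | cons a t => cases t <;> cases this

/-- The identity summand of `φ_B` on the piece reduced to `f` gives the first sum of `preSum`, where
`f` is applied to an output of `MB`. -/
theorem preSum_eq {x y : O} (s : Word (PLetter d A B F₀) x y) (f : FLetter d B F₀ y x) :
    preSum MB Φ s f =
      Word.cyclicCutSum PLetter.sdeg (lettersB Φ) MB.form s (.inr f) := by
  rw [preSum, add_comm]
  have h := sumSplits₃_single (lettersB Φ) s (.inr f)
      (fun _ _ q r t => (pdeg q * (pdeg r + pdeg t + (f.1 - 1))).negOnePow)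
      (by simp [pdeg]) (fun _ _ z => PLetter.onF (A := A) (F₀ := F₀) fun f => MB.form z (.inr f))
  refine (congrArg _ h.symm).trans ?_
  rw [← Word.sumSplits₃_add]
  refine Word.sumSplits₃_congr _ fun m n q r t h => ?_
  rw [← smul_add]
  refine congrArg _ ?_
  refine (Word.cutSum_add _ _ _ _).symm.trans ?_
  simp only [sum_lettersB]
  rfl

/-- The equation of morphisms of pre-Calabi-Yau categories, on all cyclic words. -/
theorem IsPreCYMorphism.cyclicCutSum_eq (hΦ : IsPreCYMorphism MA MB Φ) (hA : MA.IsCyclic)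
    (hB : MB.IsCyclic) {x y : O} (s : Word (PLetter d A B F₀) x y)
    (l : PLetter d A B F₀ y x) : Word.cyclicCutSum PLetter.sdeg (lettersA Φ) MA.form s l =
      Word.cyclicCutSum PLetter.sdeg (lettersB Φ) MB.form s l := by
  rw [← sub_eq_zero]
  refine eq_zero_of_rotate (Z := fun _ _ s l =>
    Word.cyclicCutSum PLetter.sdeg (lettersA Φ) MA.form s l -
      Word.cyclicCutSum PLetter.sdeg (lettersB Φ) MB.form s l) ?_ ?_ ?_ s l
  · intro x y z a s l
    rw [smul_sub]
    exact congrArg₂ (· - ·)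
      (Word.cyclicCutSum_rotate_letter sdeg_of_mem_lettersA (Multi.form_rotate_letter hA) a s l)
      (Word.cyclicCutSum_rotate_letter sdeg_of_mem_lettersB (Multi.form_rotate_letter hB) a s l)
  · intro x y s f
    rw [← multinecklaceSum_eq, ← preSum_eq, hΦ.morphism, sub_self]
  · intro x y s b hs
    rw [cyclicCutSum_eq_zero_of_isNull (fun _ _ _ h _ => isNull_of_mem_lettersA h) s b hs,
      cyclicCutSum_eq_zero_of_isNull (fun _ _ _ h _ => isNull_of_mem_lettersB h) s b hs, sub_self]

/-- The equations of `A∞`-morphisms on words of homogeneous letters, paired with a letter. -/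
theorem IsPreCYMorphism.form_eq (hΦ : IsPreCYMorphism MA MB Φ) (hA : MA.IsCyclic)
    (hB : MB.IsCyclic) {x y : O} (s : Word (PLetter d A B F₀) x y)
    (l : PLetter d A B F₀ y x) : (s.sumSplits₃ fun _ _ q r t => (pdeg q).negOnePow •
        (Φ.form (q.insert (.inl ⟨pdeg r + 1 + 1, mixedA MA Φ r _⟩) t) l +
          Φ.form (q.insert (.inr ⟨pdeg r + 1 + 1, mixedB MB Φ r _⟩) t) l)) =
      match l with
        | .inl b => - Word.cutSum (lettersA Φ) s fun z => MA.form z (.inl b)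
        | .inr f => Word.cutSum (lettersB Φ) s fun z => MB.form z (.inr f) := by
  have h := hΦ.cyclicCutSum_eq hA hB s l
  rw [cyclicCutSum_lettersA hΦ.cyclic, cyclicCutSum_lettersB hΦ.cyclic] at h
  have hneg := Word.map_sumSplits₃ (negAddMonoidHom : k →+ k) s fun _ _ q r t =>
    (pdeg q).negOnePow • Φ.form (q.insert (.inr ⟨pdeg r + 1 + 1, mixedB MB Φ r _⟩) t) l
  simp only [negAddMonoidHom_apply] at hneg
  rw [← hneg] at h
  simp only [smul_add, Word.sumSplits₃_add]
  -- Exactly one of the two extra terms survives: that of `M_A` if `l` is in `A`, that of `M_B` if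
  -- `l` is a functional.
  rcases l with b | f
  · simp only [PLetter.onA, PLetter.onF, Word.cutSum_zero] at h
    linear_combination h
  · simp only [PLetter.onA, PLetter.onF, Word.cutSum_zero] at h
    linear_combination h

end Morphisms

/-! ### Multilinear families of maps -/

section AInfinity

variable {k : Type u} [Field k] {O : Type w} {O₂ : Type w₁}
variable {Q : GradedQuiver.{u, v, w} k O} {R : GradedQuiver.{u, v₁, w₁} k O₂} {F₀ : O → O₂} {e : ℤ}
  {X : Type*} [AddCommGroup X] [Module k X]

/-- Linearity of a function of words of homogeneous elements in each letter. -/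
structure IsMultilinearOn {x y : O} (K : Word Q.Letter x y → X) : Prop where
  map_add : ∀ {z r : O} (s : Word Q.Letter x z) {p : ℤ} (a b : Q.Hom z r p)
    (t : Word Q.Letter r y), K (s.insert ⟨p, a + b⟩ t) =
      K (s.insert ⟨p, a⟩ t) + K (s.insert ⟨p, b⟩ t)
  map_smul : ∀ {z r : O} (s : Word Q.Letter x z) {p : ℤ} (c : k) (a : Q.Hom z r p)
    (t : Word Q.Letter r y), K (s.insert ⟨p, c • a⟩ t) = c • K (s.insert ⟨p, a⟩ t)

theorem WordFamily.IsMultilinear.toTot {F : WordFamily Q R F₀ e} (hF : F.IsMultilinear) (x y : O) :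
    IsMultilinearOn fun s : Word Q.Letter x y => R.toTot (F s) :=
  ⟨hF.map_add, hF.map_smul⟩

namespace IsMultilinearOn

variable {x y : O} {K : Word Q.Letter x y → X}

/-- A multilinear function of words, as a linear function of the total space for a letter. -/
noncomputable def letterMap (hK : IsMultilinearOn K) {z r : O} (s : Word Q.Letter x z)
    (t : Word Q.Letter r y) : Q.Tot z r →ₗ[k] X :=
  DirectSum.toModule k ℤ X fun p =>
    { toFun := fun a => K (s.insert ⟨p, a⟩ t)
      map_add' := fun a b => hK.map_add s a b t
      map_smul' := fun c a => hK.map_smul s c a t }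

theorem letterMap_toTot (hK : IsMultilinearOn K) {z r : O} (s : Word Q.Letter x z)
    (t : Word Q.Letter r y) {p : ℤ} (a : Q.Hom z r p) :
    hK.letterMap s t (Q.toTot a) = K (s.insert ⟨p, a⟩ t) :=
  DirectSum.toModule_lof ..

theorem map_zero (hK : IsMultilinearOn K) {z r : O} (s : Word Q.Letter x z) (p : ℤ)
    (t : Word Q.Letter r y) : K (s.insert ⟨p, 0⟩ t) = 0 := by
  rw [← hK.letterMap_toTot]
  simp [GradedQuiver.toTot]

end IsMultilinearOn

/-- The only letter which a family of maps gives for a word. -/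
def WordFamily.letter (F : WordFamily Q R F₀ e) ⦃x y : O⦄ (s : Word Q.Letter x y) :
    List (R.Letter (F₀ x) (F₀ y)) :=
  [⟨_, F s⟩]

theorem WordFamily.cutSum_eq (n : WordFamily R R id 1) (F : WordFamily Q R F₀ 0) {x y : O}
    (q : Word Q.Letter x y) : n.cutSum F q = Word.cutSum F.letter q fun z => R.toTot (n z) :=
  rfl

theorem sdeg_of_mem_letter (F : WordFamily Q R F₀ 0) ⦃x y : O⦄ (s : Word Q.Letter x y) :
    ∀ l ∈ F.letter s, l.1 - 1 = s.total fun _ _ l => l.1 - 1 := by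
  intro l hl
  rw [List.mem_singleton.1 hl]
  change Q.sdeg s + 0 + 1 - 1 = Q.sdeg s
  ring

/-- `cutSum`, one piece being that of a given letter. -/
theorem cutSum_letter_insert (F : WordFamily Q R F₀ 0) {x y z r : O}
    {K : Word R.Letter (F₀ x) (F₀ r) → X} (hK : IsMultilinearOn K) (s : Word Q.Letter x y)
    (l : Q.Letter y z) (t : Word Q.Letter z r) :
    Word.cutSum F.letter (s.insert l t) K = s.sumSplits fun _ a b => t.sumSplits fun _ c e =>
      Word.cutSum F.letter a fun z₁ => Word.cutSum F.letter e fun z₂ =>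
        hK.letterMap z₁ z₂ (R.toTot (F (b.insert l c))) := by
  rw [Word.cutSum_insert]
  simp only [hK.letterMap_toTot]
  refine Word.sumSplits_congr _ fun m a b _ => Word.sumSplits_congr _ fun n c e _ => ?_
  refine congrArg (Word.cutSum F.letter a) (funext fun z₁ => ?_)
  rw [WordFamily.letter, List.map_singleton, List.sum_singleton]

/-- Only the piece that contains the varying letter changes: `F` is linear in that letter, and `K`
is linear in the value of `F` on the piece. -/
theorem cutSum_multilinear {F : WordFamily Q R F₀ 0} (hF : F.IsMultilinear) {x y : O}
    {K : Word R.Letter (F₀ x) (F₀ y) → X} (hK : IsMultilinearOn K) :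
    IsMultilinearOn fun q : Word Q.Letter x y => Word.cutSum F.letter q K where
  map_add s p a b t := by
    simp only [cutSum_letter_insert F hK, hF.map_add, map_add, Word.cutSum_add,
      Word.sumSplits_add]
  map_smul s p c a t := by
    simp only [cutSum_letter_insert F hK, hF.map_smul, map_smul, Word.smul_cutSum,
      Word.smul_sumSplits]

/-- With `m` zero on empty words, the condition that `r` is nonempty can be dropped, which makes the
reorderings of sums uniform. -/
theorem WordFamily.IsMultilinear.insertSum_eq {F : WordFamily Q R F₀ e} (hF : F.IsMultilinear)
    {m : WordFamily Q Q id 1} (hm : ∀ x, m (.nil x) = 0) {x y : O} (q : Word Q.Letter x y) :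
    F.insertSum m q = q.sumSplits₃ fun _ _ s r t =>
      (Q.sdeg s).negOnePow • R.toTot (F (s.insert ⟨_, m r⟩ t)) := by
  refine Word.sumSplits₃_congr _ fun _ _ s r t _ => ?_
  cases r with
  | nil x =>
    rw [hm, show R.toTot (F (s.insert ⟨_, 0⟩ t)) = 0 from (hF.toTot _ _).map_zero _ _ _]
    simp
  | cons l r => rfl

/-- Inserting the operations of the source in a morphism is inserting the operations of the
target in the words of its values. -/
theorem sumSplits₃_cutSum {F : WordFamily Q R F₀ 0} (hF : F.IsMultilinear)
    {m : WordFamily Q Q id 1} (hm : ∀ x, m (.nil x) = 0) {n : WordFamily R R id 1}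
    (h : ∀ {x y : O} (q : Word Q.Letter x y), F.insertSum m q = n.cutSum F q)
    {x y : O} {K : Word R.Letter (F₀ x) (F₀ y) → X} (hK : IsMultilinearOn K)
    (q : Word Q.Letter x y) :
    (q.sumSplits₃ fun _ _ s r t =>
      (Q.sdeg s).negOnePow • Word.cutSum F.letter (s.insert ⟨_, m r⟩ t) K) =
    Word.cutSum F.letter q fun z => z.sumSplits₃ fun _ _ s r t =>
      (R.sdeg s).negOnePow • K (s.insert ⟨_, n r⟩ t) := by
  simp only [Word.sumSplits₃]
  rw [Word.cutSum_sumSplits]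
  -- Here `v` is the concatenation of the pieces fed to `n`. By `h`, the sum over the cuts of `v` is
  -- the value of `F.insertSum m` on `v`.
  have hr : (q.sumSplits fun _ a b => Word.cutSum F.letter a fun z => Word.cutSum F.letter b
      fun z' => z'.sumSplits fun _ t₁ t₂ => (R.sdeg z).negOnePow • K (z.insert ⟨_, n t₁⟩ t₂)) =
      q.sumSplits fun _ a b => b.sumSplits fun _ v c => (Q.sdeg a).negOnePow •
        Word.cutSum F.letter a fun z => Word.cutSum F.letter c fun z' =>
          hK.letterMap z z' (F.insertSum m v) := by
    refine Word.sumSplits_congr _ fun _ a b _ => ?_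
    simp only [Word.cutSum_sumSplits]
    rw [Word.cutSum_sumSplits_comm]
    refine Word.sumSplits_congr _ fun _ v c _ => ?_
    rw [Word.smul_cutSum]
    refine Word.cutSum_congr_total F.letter a (fun _ _ l => l.1 - 1)
      (fun _ _ l => l.1 - 1) (sdeg_of_mem_letter F) fun z hz => ?_
    have hz : R.sdeg z = Q.sdeg a := hz
    rw [Word.cutSum_comm, Word.smul_cutSum]
    refine congrArg (Word.cutSum F.letter c) (funext fun z' => ?_)
    rw [h, WordFamily.cutSum_eq, Word.map_cutSum, hz, Word.smul_cutSum]
    simp only [hK.letterMap_toTot]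
  refine Eq.trans ?_ hr.symm
  -- On the other side, the piece containing `m r` is `b` followed by `m r` and `c`. Grouping `b`,
  -- `r`, `c` in one word `v` yields `F.insertSum m v` again.
  calc _ = q.sumSplits fun _ s q' => q'.sumSplits fun _ r t => s.sumSplits fun _ a b =>
        t.sumSplits fun _ c e => (Q.sdeg a).negOnePow • (Q.sdeg b).negOnePow •
          Word.cutSum F.letter a fun z₁ => Word.cutSum F.letter e fun z₂ =>
            hK.letterMap z₁ z₂ (R.toTot (F (b.insert ⟨_, m r⟩ c))) := by
        refine Word.sumSplits_congr _ fun _ s q' _ => Word.sumSplits_congr _ fun _ r t _ => ?_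
        rw [cutSum_letter_insert F hK, Word.smul_sumSplits]
        refine Word.sumSplits_congr _ fun _ a b hab => ?_
        rw [Word.smul_sumSplits]
        refine Word.sumSplits_congr _ fun _ c e _ => ?_
        rw [negOnePow_smul_smul, ← hab]
        congr 2
        exact Word.total_append ..
    _ = q.sumSplits fun _ s q' => s.sumSplits fun _ a b => q'.sumSplits fun _ r t =>
        t.sumSplits fun _ c e => (Q.sdeg a).negOnePow • (Q.sdeg b).negOnePow •
          Word.cutSum F.letter a fun z₁ => Word.cutSum F.letter e fun z₂ =>
            hK.letterMap z₁ z₂ (R.toTot (F (b.insert ⟨_, m r⟩ c))) :=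
        Word.sumSplits_congr _ fun _ s q' _ => Word.sumSplits_comm _ _ _
    _ = q.sumSplits fun _ a p => p.sumSplits fun _ b q' => q'.sumSplits fun _ u e =>
        u.sumSplits fun _ r c => (Q.sdeg a).negOnePow • (Q.sdeg b).negOnePow •
          Word.cutSum F.letter a fun z₁ => Word.cutSum F.letter e fun z₂ =>
            hK.letterMap z₁ z₂ (R.toTot (F (b.insert ⟨_, m r⟩ c))) := by
        rw [Word.sumSplits_assoc]
        refine Word.sumSplits_congr _ fun _ a p _ => Word.sumSplits_congr _ fun _ b q' _ => ?_
        rw [Word.sumSplits_assoc]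
    _ = _ := by
        refine Word.sumSplits_congr _ fun _ a p _ => ?_
        rw [← Word.sumSplits_assoc]
        refine Word.sumSplits_congr _ fun _ v e _ => ?_
        rw [hF.insertSum_eq hm]
        simp only [Word.map_sumSplits₃, map_negOnePow_smul]
        simp only [Word.sumSplits₃, Word.cutSum_sumSplits_comm, Word.smul_sumSplits,
          ← Word.smul_cutSum]

end AInfinity

/-! ### Words of homogeneous letters -/

section Expand

variable {k : Type u} [Field k] {O : Type w} {O₂ : Type w₁} {O₃ : Type w₂}
variable {d : ℤ} {A : GradedQuiver.{u, v, w} k O} {B : GradedQuiver.{u, v₁, w₁} k O₂}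
  {F₀ : O → O₂} {X : Type*} [AddCommGroup X]

/-- The two letters of which a letter of `A ⊕ B^*[d-1]` is the sum. -/
def parts ⦃x y : O⦄ (l : (mixed d A B F₀).Letter x y) : List (PLetter d A B F₀ (id x) (id y)) :=
  [Sum.inl ⟨l.1, l.2.1⟩, Sum.inr ⟨l.1, l.2.2⟩]

/-- The sum of the values of a function on the terms of a word in `A ⊕ B^*[d-1]`. -/
def expandSum {x y : O} (G : Word (PLetter d A B F₀) x y → X)
    (q : Word (mixed d A B F₀).Letter x y) : X :=
  ((expand q).map G).sum

theorem expandSum_nil (x : O) (G : Word (PLetter d A B F₀) x x → X) :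
    expandSum G (.nil x) = G (.nil x) :=
  Word.sum_mapList_nil (F₀ := id) parts x G

theorem expandSum_cons {x y z : O} (G : Word (PLetter d A B F₀) x z → X)
    (l : (mixed d A B F₀).Letter x y) (t : Word (mixed d A B F₀).Letter y z) :
    expandSum G (.cons l t) = expandSum (fun t' => G (.cons (.inl ⟨l.1, l.2.1⟩) t') +
      G (.cons (.inr ⟨l.1, l.2.2⟩) t')) t := by
  refine (Word.sum_mapList_cons (F₀ := id) parts l t G).trans ?_
  rw [expandSum, List.sum_map_add]
  simp [parts]
  rfl

theorem expandSum_insert {x y z r : O} (G : Word (PLetter d A B F₀) x r → X)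
    (s : Word (mixed d A B F₀).Letter x y) (l : (mixed d A B F₀).Letter y z)
    (t : Word (mixed d A B F₀).Letter z r) :
    expandSum G (s.insert l t) = expandSum (fun s' => expandSum (fun t' =>
      G (s'.insert (.inl ⟨l.1, l.2.1⟩) t') + G (s'.insert (.inr ⟨l.1, l.2.2⟩) t')) t) s := by
  refine (Word.sum_mapList_append (F₀ := id) parts s (.cons l t) G).trans ?_
  refine congrArg List.sum (List.map_congr_left fun s' _ => ?_)
  exact expandSum_cons (fun t' => G (s'.append t')) l t

theorem expandSum_add {x y : O} (G G' : Word (PLetter d A B F₀) x y → X)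
    (q : Word (mixed d A B F₀).Letter x y) :
    expandSum (fun r => G r + G' r) q = expandSum G q + expandSum G' q :=
  List.sum_map_add ..

theorem map_expandSum {Y H : Type*} [AddCommGroup Y] [FunLike H X Y]
    [AddMonoidHomClass H X Y] (f : H) {x y : O} (G : Word (PLetter d A B F₀) x y → X)
    (q : Word (mixed d A B F₀).Letter x y) :
    f (expandSum G q) = expandSum (fun r => f (G r)) q := by
  simp [expandSum, map_list_sum, Function.comp_def]

theorem smul_expandSum {R : Type*} [DistribSMul R X] (c : R) {x y : O}
    (G : Word (PLetter d A B F₀) x y → X)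
    (q : Word (mixed d A B F₀).Letter x y) :
    c • expandSum G q = expandSum (fun r => c • G r) q :=
  map_expandSum (DistribSMul.toAddMonoidHom X c) G q

/-- All the terms of a word have its degree, since the two parts of a letter have the same degree.
Signs can therefore be moved in and out of `expandSum`. -/
theorem expandSum_congr {x y : O} {G G' : Word (PLetter d A B F₀) x y → X}
    (q : Word (mixed d A B F₀).Letter x y)
    (h : ∀ r, pdeg r = (mixed d A B F₀).sdeg q → G r = G' r) :
    expandSum G q = expandSum G' q := by
  induction q with
  | nil x => rw [expandSum_nil, expandSum_nil, h _ rfl]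
  | cons l t ih =>
    rw [expandSum_cons, expandSum_cons]
    refine ih fun r hr => ?_
    have hd : (mixed d A B F₀).sdeg (.cons l t) = l.1 - 1 + (mixed d A B F₀).sdeg t := rfl
    rw [h, h] <;> rw [hd, ← hr] <;> rfl

theorem expandSum_sumSplits {x y : O} (q : Word (mixed d A B F₀).Letter x y)
    (G : ∀ ⦃m : O⦄, Word (PLetter d A B F₀) x m → Word (PLetter d A B F₀) m y → X) :
    expandSum (fun r => r.sumSplits G) q =
      q.sumSplits fun _ a b => expandSum (fun a' => expandSum (fun b' => G a' b') b) a :=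
  Word.sum_mapList_sumSplits (F₀ := id) parts q G

theorem expandSum_sumSplits₃ {x y : O} (q : Word (mixed d A B F₀).Letter x y)
    (G : ∀ ⦃m n : O⦄, Word (PLetter d A B F₀) x m → Word (PLetter d A B F₀) m n →
      Word (PLetter d A B F₀) n y → X) :
    expandSum (fun r => r.sumSplits₃ G) q =
      q.sumSplits₃ fun _ _ a b c => expandSum (fun a' => expandSum (fun b' =>
        expandSum (fun c' => G a' b' c') c) b) a := by
  simp only [Word.sumSplits₃]
  rw [expandSum_sumSplits]
  simp only [expandSum_sumSplits]
  refine Word.sumSplits_congr _ fun _ a b _ => ?_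
  exact (Word.sumSplits_list_sum (expand a) b _).symm

theorem expandSum_comm {x y x' y' : O} (q : Word (mixed d A B F₀).Letter x y)
    (q' : Word (mixed d A B F₀).Letter x' y')
    (G : Word (PLetter d A B F₀) x y → Word (PLetter d A B F₀) x' y' → X) :
    expandSum (fun r => expandSum (G r) q') q =
      expandSum (fun r' => expandSum (fun r => G r r') q) q' :=
  Word.sum_list_comm ..

theorem IsWordLinear.expandSum [Module k X] {x y : O} {G : Word (PLetter d A B F₀) x y → X}
    (hG : IsWordLinear G) :
    IsMultilinearOn (Q := mixed d A B F₀) fun q => _root_.expandSum G q where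
  map_add s p a b t := by
    simp only [expandSum_insert, ← expandSum_add]
    refine expandSum_congr _ fun s' _ => expandSum_congr _ fun t' _ => ?_
    have h₁ := (hG s' t').inl_add p a.1 b.1
    have h₂ := (hG s' t').inr_add p a.2 b.2
    refine (congrArg₂ (· + ·) h₁ h₂).trans ?_
    abel
  map_smul s p c a t := by
    simp only [expandSum_insert, smul_expandSum]
    refine expandSum_congr _ fun s' _ => expandSum_congr _ fun t' _ => ?_
    -- The second coefficient is zero, so the linear combination is only a scalar multiple.
    have h₁ := hG s' t' (.inl (c := c) (c' := 0) p a.1 0)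
    have h₂ := hG s' t' (.inr (c := c) (c' := 0) p a.2 0)
    simp only [smul_zero, add_zero, zero_smul] at h₁ h₂
    refine (congrArg₂ (· + ·) h₁ h₂).trans ?_
    rw [smul_add]

variable [Module k X] {R : GradedQuiver.{u, v₂, w₂} k O₃} {H₀ : O → O₃} {e : ℤ}

/-- The family of maps on `A ⊕ B^*[d-1]` given by its values on words of homogeneous letters. -/
def expandFamily (e : ℤ) (G : ∀ ⦃x y : O⦄ (n : ℤ), Word (PLetter d A B F₀) x y →
    R.Hom (H₀ x) (H₀ y) n) : WordFamily (mixed d A B F₀) R H₀ e :=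
  fun _ _ s => expandSum (G _) s

/-- Values on words of homogeneous letters which give a family of maps of degree `e`. -/
structure IsHomogeneousFamily (e : ℤ) (G : ∀ ⦃x y : O⦄ (n : ℤ), Word (PLetter d A B F₀) x y →
    R.Hom (H₀ x) (H₀ y) n) : Prop where
  linear : ∀ ⦃x y : O⦄ (n : ℤ), IsWordLinear (G (x := x) (y := y) n)
  degree : ∀ ⦃x y : O⦄ (n : ℤ) (r : Word (PLetter d A B F₀) x y), n ≠ pdeg r + e + 1 → G n r = 0
  nil : ∀ (x : O) (n : ℤ), G n (.nil x) = 0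

variable {G : ∀ ⦃x y : O⦄ (n : ℤ), Word (PLetter d A B F₀) x y → R.Hom (H₀ x) (H₀ y) n}

/-- Reading the component of an arbitrary degree `n` avoids transporting elements between the spaces
of degrees that are equal but not definitionally so. Outside the expected degree both sides vanish.
-/
theorem toTot_expandFamily (hG : ∀ ⦃x y : O⦄ (n : ℤ) (r : Word (PLetter d A B F₀) x y),
      n ≠ pdeg r + e + 1 → G n r = 0) {x y : O}
    (q : Word (mixed d A B F₀).Letter x y) (n : ℤ) :
    R.toTot (expandFamily e G q) n = expandSum (G n) q := by
  by_cases hn : (mixed d A B F₀).sdeg q + e + 1 = n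
  · subst hn
    exact R.toTot_apply _
  · rw [R.toTot_apply_of_ne _ hn]
    have : expandSum (G n) q = expandSum (fun _ => 0) q :=
      expandSum_congr q fun r hr => hG n r (by rw [hr]; exact Ne.symm hn)
    rw [this, expandSum]
    simp

theorem IsHomogeneousFamily.isMultilinear (hG : IsHomogeneousFamily e G) :
    (expandFamily e G).IsMultilinear where
  map_add s p a b t := by
    refine DFinsupp.ext fun n => ?_
    rw [DirectSum.add_apply]
    simp only [toTot_expandFamily hG.degree]
    exact (hG.linear n).expandSum.map_add s a b t
  map_smul s p c a t := by
    refine DFinsupp.ext fun n => ?_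
    rw [DirectSum.smul_apply]
    simp only [toTot_expandFamily hG.degree]
    exact (hG.linear n).expandSum.map_smul s c a t
  map_nil x := (expandSum_nil x _).trans (hG.nil x _)

theorem Tot_apply_sumSplits₃ {L : O → O → Type*} {x y : O} {x' y' : O₃} (q : Word L x y)
    (φ : ∀ ⦃m n : O⦄, Word L x m → Word L m n → Word L n y → R.Tot x' y') (n : ℤ) :
    (q.sumSplits₃ φ) n = q.sumSplits₃ fun _ _ a b c => φ a b c n :=
  Word.map_sumSplits₃ (DirectSum.component k ℤ (fun p => R.Hom x' y' p) n) q φ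

theorem Tot_apply_cutSum {L : O → O → Type*} {O' : Type*} {L₂ : O' → O' → Type*} {G₀ : O → O'}
    (φ : ∀ ⦃x y : O⦄, Word L x y → List (L₂ (G₀ x) (G₀ y))) {x y : O} {x' y' : O₃}
    (q : Word L x y) (K : Word L₂ (G₀ x) (G₀ y) → R.Tot x' y') (n : ℤ) :
    (Word.cutSum φ q K) n = Word.cutSum φ q fun z => K z n :=
  Word.map_cutSum φ (DirectSum.component k ℤ (fun p => R.Hom x' y' p) n) q K

theorem Tot_apply_negOnePow_smul {x' y' : O₃} (m : ℤ) (a : R.Tot x' y') (n : ℤ) :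
    (m.negOnePow • a) n = m.negOnePow • a n :=
  map_negOnePow_smul (DirectSum.component k ℤ (fun p => R.Hom x' y' p) n) m a

/-- Inserting a family of maps, on words of homogeneous letters. -/
theorem insertSum_expandFamily (hG : IsHomogeneousFamily e G)
    {a : ∀ ⦃x y : O⦄ (n : ℤ), Word (PLetter d A B F₀) x y → A.Hom x y n}
    {b : ∀ ⦃x y : O⦄ (n : ℤ), Word (PLetter d A B F₀) x y →
      Module.Dual k (B.Hom (F₀ y) (F₀ x) (-(n + d - 1)))}
    {m : WordFamily (mixed d A B F₀) (mixed d A B F₀) id 1}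
    (hm : ∀ ⦃x y : O⦄ (q : Word (mixed d A B F₀).Letter x y),
      m q = (expandSum (a _) q, expandSum (b _) q)) (hm' : ∀ x, m (.nil x) = 0) {x y : O}
    (q : Word (mixed d A B F₀).Letter x y) (n : ℤ) :
    ((expandFamily e G).insertSum m q) n = expandSum (fun s => s.sumSplits₃ fun _ _ s r t =>
      (pdeg s).negOnePow • (G n (s.insert (.inl ⟨pdeg r + 1 + 1, a _ r⟩) t) +
        G n (s.insert (.inr ⟨pdeg r + 1 + 1, b _ r⟩) t))) q := by
  rw [hG.isMultilinear.insertSum_eq hm', Tot_apply_sumSplits₃, expandSum_sumSplits₃]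
  refine Word.sumSplits₃_congr _ fun _ _ s r t _ => ?_
  rw [Tot_apply_negOnePow_smul, toTot_expandFamily hG.degree, expandSum_insert, smul_expandSum]
  refine expandSum_congr _ fun s' hs' => ?_
  rw [expandSum_comm, hs', smul_expandSum]
  refine expandSum_congr _ fun t' _ => ?_
  rw [hm]
  -- The two parts of the inserted letter `m r` are sums over the terms of `r`; linearity of `G` in
  -- that letter takes these sums outside.
  have h₁ := (hG.linear n s' t').inl_sum ((mixed d A B F₀).sdeg r + 1 + 1) (expand r) (a _)
  have h₂ := (hG.linear n s' t').inr_sum ((mixed d A B F₀).sdeg r + 1 + 1) (expand r) (b _)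
  refine (congrArg _ (congrArg₂ (· + ·) h₁ h₂)).trans ?_
  rw [← List.sum_map_add]
  refine (smul_expandSum _ _ r).trans ?_
  refine expandSum_congr _ fun r' hr' => ?_
  rw [hr']

/-- Cutting words in `A ⊕ B^*[d-1]`, on words of homogeneous letters. -/
theorem cutSum_expandSum {O₄ : Type*} {C : GradedQuiver.{u, v₂, w₂} k O₃}
    {D : GradedQuiver k O₄} {E₀ : O₃ → O₄}
    {F : WordFamily (mixed d A B F₀) (mixed d C D E₀) H₀ 0}
    {φ : ∀ ⦃x y : O⦄, Word (PLetter d A B F₀) x y → List (PLetter d C D E₀ (H₀ x) (H₀ y))}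
    (hF : ∀ ⦃x y : O⦄ (q : Word (mixed d A B F₀).Letter x y)
      (K : PLetter d C D E₀ (H₀ x) (H₀ y) → X), IsLetterLinear K →
      K (.inl ⟨_, (F q).1⟩) + K (.inr ⟨_, (F q).2⟩) =
        expandSum (fun r => ((φ r).map K).sum) q)
    {x y : O} {K : Word (PLetter d C D E₀) (H₀ x) (H₀ y) → X} (hK : IsWordLinear K)
    (q : Word (mixed d A B F₀).Letter x y) :
    Word.cutSum F.letter q (fun z => expandSum K z) =
      expandSum (fun r => Word.cutSum φ r K) q := by
  induction q using Word.strong_induction with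
  | h q ih =>
  cases q with
  | nil x => rw [Word.cutSum_nil, expandSum_nil, expandSum_nil, Word.cutSum_nil]
  | cons l t =>
    rw [Word.cutSum_cons, expandSum_cons]
    simp only [Word.cutSum_cons, ← Word.sumSplits_add]
    rw [expandSum_sumSplits]
    refine Word.sumSplits_congr _ fun m a b hab => ?_
    -- The letter given by the first piece is replaced by the sum over the lists `φ r`, using `hF`
    -- and the linearity of `K` in its first letter.
    have h : ∀ z : Word (mixed d C D E₀).Letter (H₀ m) (H₀ _),
        expandSum K (.cons ⟨_, F (.cons l a)⟩ z) =
        expandSum (fun r => ((φ r).map fun l' => expandSum (fun z' => K (.cons l' z')) z).sum)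
          (.cons l a) := by
      intro z
      rw [expandSum_cons]
      have : ∀ z' : Word (PLetter d C D E₀) (H₀ m) (H₀ _), K (.cons (.inl ⟨_, (F (.cons l a)).1⟩) z') +
          K (.cons (.inr ⟨_, (F (.cons l a)).2⟩) z') =
          expandSum (fun r => ((φ r).map fun l' => K (.cons l' z')).sum) (.cons l a) :=
        fun z' => hF (.cons l a) (fun l' => K (.cons l' z')) (hK (.nil _) z')
      simp only [this]
      refine (Word.sum_list_comm (expand z) (expand (.cons l a)) _).trans ?_
      refine congrArg List.sum (List.map_congr_left fun r _ => ?_)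
      exact Word.sum_list_comm _ _ _
    rw [WordFamily.letter, List.map_singleton, List.sum_singleton]
    simp only [h]
    -- The induction hypothesis is applied to the remainder `b` with the first letter `l'` held
    -- fixed.
    have h' : ∀ l' : PLetter d C D E₀ (H₀ _) (H₀ m),
        Word.cutSum F.letter b (fun z => expandSum (fun z' => K (.cons l' z')) z) =
          expandSum (fun r => Word.cutSum φ r fun z' => K (.cons l' z')) b :=
      fun l' => ih b (Word.length_lt_cons hab l) (K := fun z' => K (.cons l' z'))
        fun _ _ s t => hK (.cons l' s) t
    have h₂ := Word.cutSum_list_sum F.letter (expand (.cons l a)) b fun r z =>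
      ((φ r).map fun l' => expandSum (fun z' => K (.cons l' z')) z).sum
    refine h₂.trans ?_
    simp only [Word.cutSum_list_sum, h']
    have h₃ : ∀ r, ((φ r).map fun l' => expandSum (fun r' => Word.cutSum φ r' fun z' =>
        K (.cons l' z')) b).sum = expandSum (fun r' => ((φ r).map fun l' => Word.cutSum φ r' fun z' =>
        K (.cons l' z')).sum) b := fun r => Word.sum_list_comm _ _ _
    simp only [h₃]
    refine (expandSum_cons (fun r => expandSum (fun r' => ((φ r).map fun l' =>
      Word.cutSum φ r' fun z' => K (.cons l' z')).sum) b) l a).trans ?_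
    refine expandSum_congr _ fun a' _ => ?_
    exact (expandSum_add _ _ _).symm

end Expand

/-! ### The equations satisfied by the induced operations -/

section Equations

variable {k : Type u} [Field k] {O : Type w} {O₂ : Type w₁}
variable {d : ℤ} {A : GradedQuiver.{u, v, w} k O} {B : GradedQuiver.{u, v₁, w₁} k O₂}
  {F₀ : O → O₂} {e : ℤ} {Φ : Multi d A B F₀ 0} {MA : Multi d A A id 1} {MB : Multi d B B id 1}

theorem negOnePow_smul_eq_iff {X : Type*} [AddCommGroup X] {n : ℤ} {a b : X} :
    n.negOnePow • a = b ↔ a = n.negOnePow • b := by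
  constructor <;> rintro rfl <;> rw [negOnePow_smul_smul, negOnePow_smul_of_cast]
  all_goals
    push_cast
    generalize (n : ZMod 2) = n
    decide +revert

namespace Multi

/-- Every insertion raises the degree by `1`, so all the terms have the same sign in `form_inr`, and
it factors out of the sum. -/
theorem hat_sumSplits₃ (F : Multi d A B F₀ e) {x y : O} (s : Word (PLetter d A B F₀) x y)
    (a : ∀ ⦃m n : O⦄ (r : Word (PLetter d A B F₀) m n), A.Hom m n (pdeg r + 1 + 1))
    (b : ∀ ⦃m n : O⦄ (r : Word (PLetter d A B F₀) m n),
      Module.Dual k (B.Hom (F₀ n) (F₀ m) (-(pdeg r + 1 + 1 + d - 1))))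
    (p : ℤ) (f : Module.Dual k (B.Hom (F₀ x) (F₀ y) (-(p + d - 1)))) :
    f (s.sumSplits₃ fun _ _ q r t => (pdeg q).negOnePow •
      (F.hat (q.insert (.inl ⟨_, a r⟩) t) _ + F.hat (q.insert (.inr ⟨_, b r⟩) t) _)) =
    ((pdeg s + 1 + e) * (p - 1) + (p - 1)).negOnePow • s.sumSplits₃ fun _ _ q r t =>
      (pdeg q).negOnePow • (F.form (q.insert (.inl ⟨_, a r⟩) t) (.inr ⟨p, f⟩) +
        F.form (q.insert (.inr ⟨_, b r⟩) t) (.inr ⟨p, f⟩)) := by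
  rw [Word.map_sumSplits₃, Word.smul_sumSplits₃]
  refine Word.sumSplits₃_congr _ fun _ _ q r t h => ?_
  have h₁ : pdeg (q.insert (.inl ⟨_, a r⟩) t) = pdeg s + 1 := by
    simp only [← h, pdeg_eq_total, Word.total_insert, Word.total_append, PLetter.sdeg_inl]
    ring
  have h₂ : pdeg (q.insert (.inr ⟨_, b r⟩) t) = pdeg s + 1 := by
    simp only [← h, pdeg_eq_total, Word.total_insert, Word.total_append, PLetter.sdeg_inr]
    ring
  rw [F.form_inr, F.form_inr, h₁, h₂, ← smul_add, smul_comm, map_negOnePow_smul, _root_.map_add]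
  congr 1
  rw [← negOnePow_smul_eq_iff]

theorem dualHat_sumSplits₃ (F : Multi d A B F₀ e) {x y : O} (s : Word (PLetter d A B F₀) x y)
    (a : ∀ ⦃m n : O⦄ (r : Word (PLetter d A B F₀) m n), A.Hom m n (pdeg r + 1 + 1))
    (b : ∀ ⦃m n : O⦄ (r : Word (PLetter d A B F₀) m n),
      Module.Dual k (B.Hom (F₀ n) (F₀ m) (-(pdeg r + 1 + 1 + d - 1))))
    (n : ℤ) (c : A.Hom y x (-(n + d - 1))) :
    (s.sumSplits₃ fun _ _ q r t => (pdeg q).negOnePow •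
      (F.dualHat (q.insert (.inl ⟨_, a r⟩) t) n + F.dualHat (q.insert (.inr ⟨_, b r⟩) t) n)) c =
    (pdeg s + 1).negOnePow • s.sumSplits₃ fun _ _ q r t =>
      (pdeg q).negOnePow • (F.form (q.insert (.inl ⟨_, a r⟩) t) (.inl ⟨_, c⟩) +
        F.form (q.insert (.inr ⟨_, b r⟩) t) (.inl ⟨_, c⟩)) := by
  refine (Word.map_sumSplits₃ (LinearMap.applyₗ (R := k) (M₂ := k) c) s _).trans ?_
  rw [Word.smul_sumSplits₃]
  refine Word.sumSplits₃_congr _ fun _ _ q r t h => ?_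
  have h₁ : pdeg (q.insert (.inl ⟨_, a r⟩) t) = pdeg s + 1 := by
    simp only [← h, pdeg_eq_total, Word.total_insert, Word.total_append, PLetter.sdeg_inl]
    ring
  have h₂ : pdeg (q.insert (.inr ⟨_, b r⟩) t) = pdeg s + 1 := by
    simp only [← h, pdeg_eq_total, Word.total_insert, Word.total_append, PLetter.sdeg_inr]
    ring
  rw [F.form_inl, F.form_inl, h₁, h₂, ← smul_add, smul_comm, map_negOnePow_smul, _root_.map_add]
  congr 1
  rw [← negOnePow_smul_eq_iff]
  rfl

theorem hat_stasheff (hM : IsPreCY MA) {x y : O} (s : Word (PLetter d A A id) x y) (n : ℤ) :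
    (s.sumSplits₃ fun _ _ q r t => (pdeg q).negOnePow •
      (MA.hat (q.insert (.inl ⟨pdeg r + 1 + 1, MA.hat r _⟩) t) n +
        MA.hat (q.insert (.inr ⟨pdeg r + 1 + 1, MA.dualHat r _⟩) t) n)) = 0 := by
  obtain ⟨p, rfl⟩ : ∃ p : ℤ, n = -(p + d - 1) := ⟨1 - d - n, by ring⟩
  refine (Module.forall_dual_apply_eq_zero_iff k _).1 fun f => ?_
  refine (MA.hat_sumSplits₃ s (fun _ _ r => MA.hat r _) (fun _ _ r => MA.dualHat r _) p f).trans ?_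
  refine (congrArg _ (form_stasheff hM s _)).trans (smul_zero _)

theorem dualHat_stasheff (hM : IsPreCY MA) {x y : O} (s : Word (PLetter d A A id) x y) (n : ℤ) :
    (s.sumSplits₃ fun _ _ q r t => (pdeg q).negOnePow •
      (MA.dualHat (q.insert (.inl ⟨pdeg r + 1 + 1, MA.hat r _⟩) t) n +
        MA.dualHat (q.insert (.inr ⟨pdeg r + 1 + 1, MA.dualHat r _⟩) t) n)) = 0 := by
  ext c
  refine (MA.dualHat_sumSplits₃ s (fun _ _ r => MA.hat r _) (fun _ _ r => MA.dualHat r _) n c).trans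
    ?_
  refine (congrArg _ (form_stasheff hM s _)).trans (smul_zero _)

end Multi

namespace IsPreCYMorphism

theorem hat_eq (hΦ : IsPreCYMorphism MA MB Φ) (hA : MA.IsCyclic) (hB : MB.IsCyclic) {x y : O}
    (s : Word (PLetter d A B F₀) x y) (n : ℤ) :
    (s.sumSplits₃ fun _ _ q r t => (pdeg q).negOnePow •
      (Φ.hat (q.insert (.inl ⟨pdeg r + 1 + 1, mixedA MA Φ r _⟩) t) n +
        Φ.hat (q.insert (.inr ⟨pdeg r + 1 + 1, mixedB MB Φ r _⟩) t) n)) =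
      Word.cutSum (lettersB Φ) s fun z => MB.hat z n := by
  obtain ⟨p, rfl⟩ : ∃ p : ℤ, n = -(p + d - 1) := ⟨1 - d - n, by ring⟩
  rw [← sub_eq_zero]
  refine (Module.forall_dual_apply_eq_zero_iff k _).1 fun f => ?_
  rw [map_sub, sub_eq_zero]
  refine (Φ.hat_sumSplits₃ s (fun _ _ r => mixedA MA Φ r _) (fun _ _ r => mixedB MB Φ r _)
    p f).trans ?_
  refine (congrArg _ (hΦ.form_eq hA hB s _)).trans ?_
  rw [negOnePow_smul_eq_iff, Word.map_cutSum, Word.smul_cutSum]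
  refine Word.cutSum_congr_total (lettersB Φ) s PLetter.sdeg PLetter.sdeg sdeg_of_mem_lettersB
    fun z hz => ?_
  have hz : pdeg z = pdeg s := hz
  refine (MB.form_inr z p f).trans ?_
  rw [hz]
  refine negOnePow_smul_congr _ ?_
  push_cast
  ring

theorem dualHat_eq (hΦ : IsPreCYMorphism MA MB Φ) (hA : MA.IsCyclic) (hB : MB.IsCyclic) {x y : O}
    (s : Word (PLetter d A B F₀) x y) (n : ℤ) :
    (s.sumSplits₃ fun _ _ q r t => (pdeg q).negOnePow •
      (Φ.dualHat (q.insert (.inl ⟨pdeg r + 1 + 1, mixedA MA Φ r _⟩) t) n +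
        Φ.dualHat (q.insert (.inr ⟨pdeg r + 1 + 1, mixedB MB Φ r _⟩) t) n)) =
      Word.cutSum (lettersA Φ) s fun z => MA.dualHat z n := by
  ext c
  refine (Φ.dualHat_sumSplits₃ s (fun _ _ r => mixedA MA Φ r _) (fun _ _ r => mixedB MB Φ r _)
    n c).trans ?_
  refine (congrArg _ (hΦ.form_eq hA hB s _)).trans ?_
  refine Eq.trans ?_ (Word.map_cutSum (lettersA Φ) (LinearMap.applyₗ (R := k) (M₂ := k) c) s _).symm
  -- The minus sign of `form_eq` cancels the shift by `1` of the degree of the words with an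
  -- inserted operation.
  rw [smul_neg, ← Units.neg_smul, ← Int.negOnePow_succ, negOnePow_smul_eq_iff, Word.smul_cutSum]
  refine Word.cutSum_congr_total (lettersA Φ) s PLetter.sdeg PLetter.sdeg sdeg_of_mem_lettersA
    fun z hz => ?_
  have hz : pdeg z = pdeg s := hz
  refine (MA.form_inl z n c).trans ?_
  rw [hz]
  refine negOnePow_smul_congr _ ?_
  push_cast
  generalize (pdeg s : ZMod 2) = a
  decide +revert

end IsPreCYMorphism

theorem mixedA_eq_zero {x y : O} (s : Word (PLetter d A B F₀) x y) {n : ℤ}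
    (h : n ≠ pdeg s + 1 + 1) : mixedA MA Φ s n = 0 := by
  rw [← Word.cutSum_zero (lettersA Φ) s]
  refine Word.cutSum_congr_total (lettersA Φ) s PLetter.sdeg PLetter.sdeg sdeg_of_mem_lettersA
    fun z hz => MA.hat_eq_zero z ?_
  have hz : pdeg z = pdeg s := hz
  rwa [hz]

theorem mixedB_eq_zero {x y : O} (s : Word (PLetter d A B F₀) x y) {n : ℤ}
    (h : n ≠ pdeg s + 1 + 1) : mixedB MB Φ s n = 0 := by
  rw [← Word.cutSum_zero (lettersB Φ) s]
  refine Word.cutSum_congr_total (lettersB Φ) s PLetter.sdeg PLetter.sdeg sdeg_of_mem_lettersB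
    fun z hz => MB.dualHat_eq_zero z ?_
  have hz : pdeg z = pdeg s := hz
  rwa [hz]

theorem list_sum_prodMk {X Y ι : Type*} [AddCommMonoid X] [AddCommMonoid Y] (l : List ι)
    (a : ι → X) (b : ι → Y) :
    (l.map fun i => (a i, b i)).sum = ((l.map a).sum, (l.map b).sum) := by
  induction l with
  | nil => rfl
  | cons i l ih => simp [ih]

/-- The part in `A` of `φ_A`, on words of homogeneous letters. -/
def identityA {x y : O} (r : Word (PLetter d A B F₀) x y) (n : ℤ) : A.Hom x y n :=
  (r.single.map (PLetter.onA fun a => A.toTot a.2 n)).sum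

/-- The part in `B^*[d-1]` of `φ_B`, on words of homogeneous letters. -/
def identityB {x y : O} (r : Word (PLetter d A B F₀) x y) (n : ℤ) :
    Module.Dual k (B.Hom (F₀ y) (F₀ x) (-(n + d - 1))) :=
  (r.single.map (PLetter.onF fun f => DirectSum.of
    (fun p => Module.Dual k (B.Hom (F₀ y) (F₀ x) (-(p + d - 1)))) f.1 f.2 n)).sum

end Equations

/-! ### The `A∞`-structures and the `A∞`-morphisms -/

section AInfinityMorphisms

variable {k : Type u} [Field k] {O : Type w} {O₂ : Type w₁}
variable {d : ℤ} {A : GradedQuiver.{u, v, w} k O} {B : GradedQuiver.{u, v₁, w₁} k O₂}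
  {F₀ : O → O₂} {e : ℤ} {Φ : Multi d A B F₀ 0} {MA : Multi d A A id 1} {MB : Multi d B B id 1}

theorem IsWordLinear.prodMk {X Y : Type*} [AddCommGroup X] [Module k X] [AddCommGroup Y]
    [Module k Y] {x y : O} {K : Word (PLetter d A B F₀) x y → X}
    {K' : Word (PLetter d A B F₀) x y → Y} (h : IsWordLinear K) (h' : IsWordLinear K') :
    IsWordLinear fun r => (K r, K' r) :=
  fun _ _ q t _ _ _ _ _ hl => Prod.ext (h q t hl) (h' q t hl)

theorem isWordLinear_single {X : Type*} [AddCommGroup X] [Module k X] {x y : O}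
    {K : PLetter d A B F₀ x y → X} (hK : IsLetterLinear K) :
    IsWordLinear fun r : Word (PLetter d A B F₀) x y => (r.single.map K).sum := by
  intro z z' q t c c' l₁ l₂ l hl
  cases q with
  | nil =>
    cases t with
    | nil => simpa [Word.single] using hK hl
    | cons a t => simp [Word.single]
  | cons a q => simp [Word.single_cons_insert]

theorem isLetterLinear_onA {x y : O} (n : ℤ) : IsLetterLinear (d := d) (B := B) (F₀ := F₀)
    (PLetter.onA fun a : A.Letter x y => A.toTot a.2 n) := by
  intro c c' l₁ l₂ l hl
  cases hl with
  | inl p a b =>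
    change DirectSum.lof k ℤ (fun p => A.Hom x y p) p (c • a + c' • b) n =
      c • DirectSum.lof k ℤ (fun p => A.Hom x y p) p a n +
        c' • DirectSum.lof k ℤ (fun p => A.Hom x y p) p b n
    rw [map_add, map_smul, map_smul]
    rfl
  | inr p f g => simp [PLetter.onA]

theorem isLetterLinear_onF {x y : O} (n : ℤ) : IsLetterLinear (A := A)
    (PLetter.onF fun f : FLetter d B F₀ x y => DirectSum.of
      (fun p => Module.Dual k (B.Hom (F₀ y) (F₀ x) (-(p + d - 1)))) f.1 f.2 n) := by
  intro c c' l₁ l₂ l hl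
  cases hl with
  | inl p a b => simp [PLetter.onF]
  | inr p f g =>
    let D := fun p => Module.Dual k (B.Hom (F₀ y) (F₀ x) (-(p + d - 1)))
    change DirectSum.lof k ℤ D p (c • f + c' • g) n =
      c • DirectSum.lof k ℤ D p f n + c' • DirectSum.lof k ℤ D p g n
    rw [map_add, map_smul, map_smul]
    rfl

theorem identityA_eq_zero {x y : O} (r : Word (PLetter d A B F₀) x y) {n : ℤ}
    (h : n ≠ pdeg r + 0 + 1) : identityA r n = 0 := by
  refine List.sum_eq_zero fun c hc => ?_
  obtain ⟨l, hl, rfl⟩ := List.mem_map.1 hc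
  rw [mem_single hl] at h
  rcases l with a | f
  · refine A.toTot_apply_of_ne _ fun hn => h ?_
    rw [← hn]
    simp only [pdeg_eq_total, Word.total_cons, Word.total_nil, PLetter.sdeg_inl]
    ring
  · rfl

theorem identityB_eq_zero {x y : O} (r : Word (PLetter d A B F₀) x y) {n : ℤ}
    (h : n ≠ pdeg r + 0 + 1) : identityB r n = 0 := by
  refine List.sum_eq_zero fun c hc => ?_
  obtain ⟨l, hl, rfl⟩ := List.mem_map.1 hc
  rw [mem_single hl] at h
  rcases l with a | f
  · rfl
  · refine DirectSum.of_eq_of_ne _ _ _ fun hn => h ?_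
    rw [hn]
    simp only [pdeg_eq_total, Word.total_cons, Word.total_nil, PLetter.sdeg_inr]
    ring

theorem isHomogeneousFamily_boundary (hM : MA.IsCyclic) :
    IsHomogeneousFamily (R := mixed d A A id) (H₀ := id) 1
      fun _ _ n (r : Word (PLetter d A A id) _ _) => (MA.hat r n, MA.dualHat r n) where
  linear _ _ n := (Multi.hat_linear hM _ _ n).prodMk (Multi.dualHat_linear hM _ _ n)
  degree _ _ _ r hn := Prod.ext (MA.hat_eq_zero r hn) (MA.dualHat_eq_zero r hn)
  nil x n := Prod.ext (MA.hat_nil x n) (Multi.dualHat_of_isNull (isNull_nil x) n)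

theorem isHomogeneousFamily_phiA (hΦ : Φ.IsCyclic) :
    IsHomogeneousFamily (R := mixed d A A id) (H₀ := id) 0
      fun _ _ n (r : Word (PLetter d A B F₀) _ _) => (identityA r n, Φ.dualHat r n) where
  linear _ _ n := (isWordLinear_single (isLetterLinear_onA n)).prodMk
    (Multi.dualHat_linear hΦ _ _ n)
  degree _ _ _ r hn := Prod.ext (identityA_eq_zero r hn) (Φ.dualHat_eq_zero r hn)
  nil x n := Prod.ext rfl (Multi.dualHat_of_isNull (isNull_nil x) n)

theorem isHomogeneousFamily_phiB (hΦ : Φ.IsCyclic) :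
    IsHomogeneousFamily (R := mixed d B B id) (H₀ := F₀) 0
      fun _ _ n (r : Word (PLetter d A B F₀) _ _) => (Φ.hat r n, identityB r n) where
  linear _ _ n := (Multi.hat_linear hΦ _ _ n).prodMk
    (isWordLinear_single (isLetterLinear_onF n))
  degree _ _ _ r hn := Prod.ext (Φ.hat_eq_zero r hn) (identityB_eq_zero r hn)
  nil x n := Prod.ext (Φ.hat_nil x n) rfl

theorem boundaryStructure_apply {x y : O} (q : Word (mixed d A A id).Letter x y) :
    boundaryStructure MA q = (expandSum (fun r => MA.hat r _) q,
      expandSum (fun r => MA.dualHat r _) q) :=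
  list_sum_prodMk (expand q) (fun r => MA.hat r _) (fun r => MA.dualHat r _)

theorem mixedStructure_apply {x y : O} (q : Word (mixed d A B F₀).Letter x y) :
    mixedStructure MA MB Φ q = (expandSum (fun r => mixedA MA Φ r _) q,
      expandSum (fun r => mixedB MB Φ r _) q) :=
  list_sum_prodMk (expand q) (fun r => mixedA MA Φ r _) (fun r => mixedB MB Φ r _)

theorem mixedStructure_nil (x : O) : mixedStructure MA MB Φ (.nil x) = 0 := by
  rw [mixedStructure_apply, expandSum_nil, expandSum_nil, mixedA, mixedB, Word.cutSum_nil,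
    Word.cutSum_nil]
  exact Prod.ext (MA.hat_nil x _) (Multi.dualHat_of_isNull (isNull_nil _) _)

/-- The part in `A` of an element of `A ⊕ B^*[d-1]`. -/
def mixedFst (d : ℤ) (A : GradedQuiver.{u, v, w} k O) (B : GradedQuiver.{u, v₁, w₁} k O₂)
    (F₀ : O → O₂) (x y : O) (n : ℤ) : (mixed d A B F₀).Hom x y n →ₗ[k] A.Hom x y n :=
  LinearMap.fst k (A.Hom x y n) (Module.Dual k (B.Hom (F₀ y) (F₀ x) (-(n + d - 1))))

/-- The part in `B^*[d-1]` of an element of `A ⊕ B^*[d-1]`. -/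
def mixedSnd (d : ℤ) (A : GradedQuiver.{u, v, w} k O) (B : GradedQuiver.{u, v₁, w₁} k O₂)
    (F₀ : O → O₂) (x y : O) (n : ℤ) : (mixed d A B F₀).Hom x y n →ₗ[k]
      Module.Dual k (B.Hom (F₀ y) (F₀ x) (-(n + d - 1))) :=
  LinearMap.snd k (A.Hom x y n) (Module.Dual k (B.Hom (F₀ y) (F₀ x) (-(n + d - 1))))

theorem mixed_ext {x y : O} {n : ℤ} {a b : (mixed d A B F₀).Hom x y n}
    (h : mixedFst d A B F₀ x y n a = mixedFst d A B F₀ x y n b)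
    (h' : mixedSnd d A B F₀ x y n a = mixedSnd d A B F₀ x y n b) : a = b :=
  Prod.ext h h'

theorem expandSum_eq_zero {X : Type*} [AddCommGroup X] {x y : O}
    {G : Word (PLetter d A B F₀) x y → X} (h : ∀ r, G r = 0)
    (q : Word (mixed d A B F₀).Letter x y) : expandSum G q = 0 := by
  refine List.sum_eq_zero fun c hc => ?_
  obtain ⟨r, -, rfl⟩ := List.mem_map.1 hc
  exact h r

theorem isAInfinityStructure_boundary (hM : IsPreCY MA) :
    IsAInfinityStructure (boundaryStructure MA) := by
  have hG := isHomogeneousFamily_boundary hM.cyclic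
  have hmul : (boundaryStructure MA).IsMultilinear := hG.isMultilinear
  refine ⟨hmul, fun q => DFinsupp.ext fun n => ?_⟩
  refine (insertSum_expandFamily hG (a := fun _ _ n r => MA.hat r n)
    (b := fun _ _ n r => MA.dualHat r n) (fun _ _ q => boundaryStructure_apply q)
    hmul.map_nil q n).trans (expandSum_eq_zero (fun s => mixed_ext ?_ ?_) q)
  · refine (Word.map_sumSplits₃ (mixedFst d A A id _ _ n) s _).trans ?_
    exact (MA.hat_stasheff hM s n).trans (map_zero _).symm
  · refine (Word.map_sumSplits₃ (mixedSnd d A A id _ _ n) s _).trans ?_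
    exact (MA.dualHat_stasheff hM s n).trans (map_zero _).symm

theorem phiA_apply {x y : O} (q : Word (mixed d A B F₀).Letter x y) :
    phiA Φ q = (expandSum (fun r => identityA r _) q, expandSum (fun r => Φ.dualHat r _) q) :=
  list_sum_prodMk (expand q) (fun r => identityA r _) (fun r => Φ.dualHat r _)

theorem phiB_apply {x y : O} (q : Word (mixed d A B F₀).Letter x y) :
    phiB Φ q = (expandSum (fun r => Φ.hat r _) q, expandSum (fun r => identityB r _) q) :=
  list_sum_prodMk (expand q) (fun r => Φ.hat r _) (fun r => identityB r _)

/-- A linear function cannot distinguish the value of `φ_A` from the list of its summands. This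
connects `phiA`, defined on `A ⊕ B^*[d-1]`, with the lists `lettersA` used in the cyclic sums. -/
theorem letters_phiA {X : Type*} [AddCommGroup X] [Module k X] ⦃x y : O⦄
    (q : Word (mixed d A B F₀).Letter x y) (K : PLetter d A A id (id x) (id y) → X)
    (hK : IsLetterLinear K) :
    K (.inl ⟨_, (phiA Φ q).1⟩) + K (.inr ⟨_, (phiA Φ q).2⟩) =
      expandSum (fun r => ((lettersA Φ r).map K).sum) q := by
  rw [phiA_apply]
  refine (congrArg₂ (· + ·) (hK.inl_sum _ (expand q) _) (hK.inr_sum _ (expand q) _)).trans ?_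
  rw [← List.sum_map_add]
  refine expandSum_congr q fun r hr => ?_
  rw [← hr, sum_lettersA, add_comm]
  refine congrArg _ ((hK.inl_sum _ r.single _).trans ?_)
  refine congrArg List.sum (List.map_congr_left fun l hl => ?_)
  rw [mem_single hl]
  rcases l with ⟨p, a⟩ | f
  -- The degree of the value of `φ_A` is that of the letter itself, so the component taken in `phiA`
  -- is the whole letter.
  · have hp : p = pdeg (.cons (.inl ⟨p, a⟩) (.nil y) : Word (PLetter d A B F₀) x y) + 0 + 1 := by
      simp only [pdeg_eq_total, Word.total_cons, Word.total_nil, PLetter.sdeg_inl]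
      ring
    rw [← hp]
    simp only [PLetter.onA, GradedQuiver.toTot_apply]
  · exact hK.inl_zero _

theorem letters_phiB {X : Type*} [AddCommGroup X] [Module k X] ⦃x y : O⦄
    (q : Word (mixed d A B F₀).Letter x y) (K : PLetter d B B id (F₀ x) (F₀ y) → X)
    (hK : IsLetterLinear K) :
    K (.inl ⟨_, (phiB Φ q).1⟩) + K (.inr ⟨_, (phiB Φ q).2⟩) =
      expandSum (fun r => ((lettersB Φ r).map K).sum) q := by
  rw [phiB_apply]
  refine (congrArg₂ (· + ·) (hK.inl_sum _ (expand q) _) (hK.inr_sum _ (expand q) _)).trans ?_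
  rw [← List.sum_map_add]
  refine expandSum_congr q fun r hr => ?_
  rw [← hr, sum_lettersB]
  refine congrArg _ ((hK.inr_sum _ r.single _).trans ?_)
  refine congrArg List.sum (List.map_congr_left fun l hl => ?_)
  rw [mem_single hl]
  rcases l with a | ⟨p, f⟩
  · exact hK.inr_zero _
  · have hp : p = pdeg (.cons (.inr ⟨p, f⟩) (.nil y) : Word (PLetter d A B F₀) x y) + 0 + 1 := by
      simp only [pdeg_eq_total, Word.total_cons, Word.total_nil, PLetter.sdeg_inr]
      ring
    rw [← hp]
    simp only [PLetter.onF, DirectSum.of_eq_same]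

theorem cutSum_boundary_phiA (hA : MA.IsCyclic) {x y : O}
    (q : Word (mixed d A B F₀).Letter x y) (n : ℤ) :
    (WordFamily.cutSum (boundaryStructure MA) (phiA Φ) q) n =
      expandSum (X := (mixed d A A id).Hom x y n) (fun r => Word.cutSum (lettersA Φ) r fun z =>
        (MA.hat z n, MA.dualHat z n)) q := by
  have hG := isHomogeneousFamily_boundary hA
  rw [WordFamily.cutSum_eq, Tot_apply_cutSum]
  refine (congrArg (Word.cutSum (phiA Φ).letter q) (funext fun z => ?_)).trans
    (cutSum_expandSum letters_phiA (hG.linear n) q)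
  exact toTot_expandFamily (R := mixed d A A id) (H₀ := id) (e := 1)
    (G := fun _ _ n r => (MA.hat r n, MA.dualHat r n)) hG.degree z n

theorem cutSum_boundary_phiB (hB : MB.IsCyclic) {x y : O}
    (q : Word (mixed d A B F₀).Letter x y) (n : ℤ) :
    (WordFamily.cutSum (boundaryStructure MB) (phiB Φ) q) n =
      expandSum (X := (mixed d B B id).Hom (F₀ x) (F₀ y) n)
        (fun r => Word.cutSum (lettersB Φ) r fun z => (MB.hat z n, MB.dualHat z n)) q := by
  have hG := isHomogeneousFamily_boundary hB
  rw [WordFamily.cutSum_eq, Tot_apply_cutSum]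
  refine (congrArg (Word.cutSum (phiB Φ).letter q) (funext fun z => ?_)).trans
    (cutSum_expandSum letters_phiB (hG.linear n) q)
  exact toTot_expandFamily (R := mixed d B B id) (H₀ := id) (e := 1)
    (G := fun _ _ n r => (MB.hat r n, MB.dualHat r n)) hG.degree z n

theorem toTot_mixedStructure {x y : O} (q : Word (mixed d A B F₀).Letter x y) (n : ℤ) :
    (mixed d A B F₀).toTot (mixedStructure MA MB Φ q) n =
      expandSum (X := (mixed d A B F₀).Hom x y n) (fun r => (mixedA MA Φ r n, mixedB MB Φ r n)) q :=
  toTot_expandFamily (R := mixed d A B F₀) (H₀ := id) (e := 1)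
    (G := fun _ _ n r => (mixedA MA Φ r n, mixedB MB Φ r n))
    (fun _ _ _ r hn => Prod.ext (mixedA_eq_zero r hn) (mixedB_eq_zero r hn)) q n

/-- Both sides are `M_A` applied to the values of `φ_A` on the pieces, with its last output in `A`
left free. This and `mixedSnd_mixedStructure` transfer multilinearity and the Stasheff identities
from the two targets. -/
theorem mixedFst_mixedStructure (hA : MA.IsCyclic) {x y : O}
    (q : Word (mixed d A B F₀).Letter x y) (n : ℤ) :
    mixedFst d A B F₀ x y n ((mixed d A B F₀).toTot (mixedStructure MA MB Φ q) n) =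
      mixedFst d A A id x y n ((WordFamily.cutSum (boundaryStructure MA) (phiA Φ) q) n) := by
  refine (congrArg _ (toTot_mixedStructure q n)).trans ?_
  refine Eq.trans ?_ (congrArg _ (cutSum_boundary_phiA hA q n)).symm
  refine (map_expandSum (X := (mixed d A B F₀).Hom x y n) (mixedFst d A B F₀ x y n) _ q).trans ?_
  refine Eq.trans ?_ (map_expandSum (X := (mixed d A A id).Hom x y n)
    (mixedFst d A A id x y n) _ q).symm
  refine expandSum_congr q fun r _ => ?_
  exact (Word.map_cutSum (M := (mixed d A A id).Hom x y n) (lettersA Φ) (mixedFst d A A id x y n) r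
    fun z => (MA.hat z n, MA.dualHat z n)).symm

theorem mixedSnd_mixedStructure (hB : MB.IsCyclic) {x y : O}
    (q : Word (mixed d A B F₀).Letter x y) (n : ℤ) :
    mixedSnd d A B F₀ x y n ((mixed d A B F₀).toTot (mixedStructure MA MB Φ q) n) =
      mixedSnd d B B id (F₀ x) (F₀ y) n
        ((WordFamily.cutSum (boundaryStructure MB) (phiB Φ) q) n) := by
  refine (congrArg _ (toTot_mixedStructure q n)).trans ?_
  refine Eq.trans ?_ (congrArg _ (cutSum_boundary_phiB hB q n)).symm
  refine (map_expandSum (X := (mixed d A B F₀).Hom x y n) (mixedSnd d A B F₀ x y n) _ q).trans ?_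
  refine Eq.trans ?_ (map_expandSum (X := (mixed d B B id).Hom (F₀ x) (F₀ y) n)
    (mixedSnd d B B id (F₀ x) (F₀ y) n) _ q).symm
  refine expandSum_congr q fun r _ => ?_
  exact (Word.map_cutSum (M := (mixed d B B id).Hom (F₀ x) (F₀ y) n) (lettersB Φ)
    (mixedSnd d B B id (F₀ x) (F₀ y) n) r fun z => (MB.hat z n, MB.dualHat z n)).symm

/-! ### The two parts of each morphism equation. -/

theorem identityA_eq_zero_of_single {x y : O} {r : Word (PLetter d A B F₀) x y}
    (h : r.single = []) (n : ℤ) : identityA r n = 0 := by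
  rw [identityA, h]
  rfl

/-- The identity only sees one letter words, so the operation must absorb the whole word: `q` and
`t` are empty and `r` is `s`. -/
theorem sumSplits₃_identityA {x y : O} (s : Word (PLetter d A B F₀) x y) (n : ℤ) :
    (s.sumSplits₃ fun _ _ q r t => (pdeg q).negOnePow •
      (identityA (q.insert (.inl ⟨pdeg r + 1 + 1, mixedA MA Φ r _⟩) t) n +
        identityA (q.insert (.inr ⟨pdeg r + 1 + 1, mixedB MB Φ r _⟩) t) n)) = mixedA MA Φ s n := by
  rw [Word.sumSplits₃_eq_of_nil]
  · have h : A.toTot (mixedA MA Φ s (pdeg s + 1 + 1)) n = mixedA MA Φ s n := by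
      by_cases hn : pdeg s + 1 + 1 = n
      · subst hn
        exact A.toTot_apply _
      · rw [A.toTot_apply_of_ne _ hn, mixedA_eq_zero s (Ne.symm hn)]
    rw [← h]
    simp [identityA, Word.insert, Word.append, Word.single, PLetter.onA, pdeg_eq_total]
  · intro m m' n l a b c
    have h (l') : ((Word.cons l a).insert l' c).single = [] := Word.single_cons_insert l a l' c
    rw [identityA_eq_zero_of_single (h _), identityA_eq_zero_of_single (h _), add_zero, smul_zero]
  · intro n n' b l c
    rw [identityA_eq_zero_of_single (Word.single_insert_cons (.nil x) _ l c),
      identityA_eq_zero_of_single (Word.single_insert_cons (.nil x) _ l c), add_zero, smul_zero]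

theorem identityB_eq_zero_of_single {x y : O} {r : Word (PLetter d A B F₀) x y}
    (h : r.single = []) (n : ℤ) : identityB r n = 0 := by
  rw [identityB, h]
  rfl

theorem sumSplits₃_identityB {x y : O} (s : Word (PLetter d A B F₀) x y) (n : ℤ) :
    (s.sumSplits₃ fun _ _ q r t => (pdeg q).negOnePow •
      (identityB (q.insert (.inl ⟨pdeg r + 1 + 1, mixedA MA Φ r _⟩) t) n +
        identityB (q.insert (.inr ⟨pdeg r + 1 + 1, mixedB MB Φ r _⟩) t) n)) = mixedB MB Φ s n := by
  rw [Word.sumSplits₃_eq_of_nil]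
  · have h : DirectSum.of (fun p => Module.Dual k (B.Hom (F₀ y) (F₀ x) (-(p + d - 1)))) _
        (mixedB MB Φ s (pdeg s + 1 + 1)) n = mixedB MB Φ s n := by
      by_cases hn : pdeg s + 1 + 1 = n
      · subst hn
        exact DirectSum.of_eq_same ..
      · rw [DirectSum.of_eq_of_ne _ _ _ (Ne.symm hn), mixedB_eq_zero s (Ne.symm hn)]
    rw [← h]
    simp [identityB, Word.insert, Word.append, Word.single, PLetter.onF, pdeg_eq_total]
    rfl
  · intro m m' n l a b c
    have h (l') : ((Word.cons l a).insert l' c).single = [] := Word.single_cons_insert l a l' c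
    rw [identityB_eq_zero_of_single (h _), identityB_eq_zero_of_single (h _), add_zero, smul_zero]
  · intro n n' b l c
    rw [identityB_eq_zero_of_single (Word.single_insert_cons (.nil x) _ l c),
      identityB_eq_zero_of_single (Word.single_insert_cons (.nil x) _ l c), add_zero, smul_zero]

/-- The `A`-part is the definition of `mixedA`; the `A^*`-part, from `dualHat_eq`, is where the
equation of a morphism is used. -/
theorem insertSum_phiA (hΦ : IsPreCYMorphism MA MB Φ) (hA : MA.IsCyclic) (hB : MB.IsCyclic)
    {x y : O} (q : Word (mixed d A B F₀).Letter x y) :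
    (phiA Φ).insertSum (mixedStructure MA MB Φ) q =
      WordFamily.cutSum (boundaryStructure MA) (phiA Φ) q := by
  refine DFinsupp.ext fun n => ?_
  refine (insertSum_expandFamily (isHomogeneousFamily_phiA hΦ.cyclic)
    (a := fun _ _ n r => mixedA MA Φ r n) (b := fun _ _ n r => mixedB MB Φ r n)
    (fun _ _ q => mixedStructure_apply q) mixedStructure_nil q n).trans ?_
  refine Eq.trans ?_ (cutSum_boundary_phiA hA q n).symm
  refine expandSum_congr q fun s _ => mixed_ext ?_ ?_
  · refine (Word.map_sumSplits₃ (mixedFst d A A id _ _ n) s _).trans ?_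
    refine (sumSplits₃_identityA s n).trans ?_
    exact (Word.map_cutSum (M := (mixed d A A id).Hom x y n) (lettersA Φ) (mixedFst d A A id x y n)
      s fun z => (MA.hat z n, MA.dualHat z n)).symm
  · refine (Word.map_sumSplits₃ (mixedSnd d A A id _ _ n) s _).trans ?_
    refine (hΦ.dualHat_eq hA hB s n).trans ?_
    exact (Word.map_cutSum (M := (mixed d A A id).Hom x y n) (lettersA Φ) (mixedSnd d A A id x y n)
      s fun z => (MA.hat z n, MA.dualHat z n)).symm

/-- Here the roles are reversed: the `B`-part uses the equation of a morphism, and the `B^*`-part is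
the definition of `mixedB`. -/
theorem insertSum_phiB (hΦ : IsPreCYMorphism MA MB Φ) (hA : MA.IsCyclic) (hB : MB.IsCyclic)
    {x y : O} (q : Word (mixed d A B F₀).Letter x y) :
    (phiB Φ).insertSum (mixedStructure MA MB Φ) q =
      WordFamily.cutSum (boundaryStructure MB) (phiB Φ) q := by
  refine DFinsupp.ext fun n => ?_
  refine (insertSum_expandFamily (isHomogeneousFamily_phiB hΦ.cyclic)
    (a := fun _ _ n r => mixedA MA Φ r n) (b := fun _ _ n r => mixedB MB Φ r n)
    (fun _ _ q => mixedStructure_apply q) mixedStructure_nil q n).trans ?_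
  refine Eq.trans ?_ (cutSum_boundary_phiB hB q n).symm
  refine expandSum_congr q fun s _ => mixed_ext ?_ ?_
  · refine (Word.map_sumSplits₃ (mixedFst d B B id _ _ n) s _).trans ?_
    refine (hΦ.hat_eq hA hB s n).trans ?_
    exact (Word.map_cutSum (M := (mixed d B B id).Hom (F₀ x) (F₀ y) n) (lettersB Φ)
      (mixedFst d B B id (F₀ x) (F₀ y) n) s fun z => (MB.hat z n, MB.dualHat z n)).symm
  · refine (Word.map_sumSplits₃ (mixedSnd d B B id _ _ n) s _).trans ?_
    refine (sumSplits₃_identityB s n).trans ?_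
    exact (Word.map_cutSum (M := (mixed d B B id).Hom (F₀ x) (F₀ y) n) (lettersB Φ)
      (mixedSnd d B B id (F₀ x) (F₀ y) n) s fun z => (MB.hat z n, MB.dualHat z n)).symm

/-! ### The `A∞`-structure on `A ⊕ B^*[d-1]`. -/

/-- The operations of the target of a morphism inserted in one another, applied to the words of
values of the morphism, give zero. -/
theorem sumSplits₃_cutSum_eq_zero {Q : GradedQuiver.{u, v, w} k O} {R : GradedQuiver.{u, v₁, w₁} k O₂}
    {F : WordFamily Q R F₀ 0} (hF : F.IsMultilinear) {m : WordFamily Q Q id 1}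
    (hm : ∀ x, m (.nil x) = 0) {n : WordFamily R R id 1} (hn : IsAInfinityStructure n)
    (h : ∀ {x y : O} (q : Word Q.Letter x y), F.insertSum m q = n.cutSum F q)
    {x y : O} (q : Word Q.Letter x y) :
    (q.sumSplits₃ fun _ _ s r t => (Q.sdeg s).negOnePow • n.cutSum F (s.insert ⟨_, m r⟩ t)) = 0 := by
  refine (sumSplits₃_cutSum hF hm h (hn.multilinear.toTot _ _) q).trans ?_
  refine Eq.trans ?_ (Word.cutSum_zero F.letter q)
  refine congrArg (Word.cutSum F.letter q) (funext fun z => ?_)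
  exact (hn.multilinear.insertSum_eq hn.multilinear.map_nil z).symm.trans (hn.stasheff z)

/-- Each part of the operation is a part of a composite of multilinear families, that of the target
with `φ_A` or `φ_B`. -/
theorem isMultilinear_mixedStructure (hΦ : Φ.IsCyclic) (hA : MA.IsCyclic) (hB : MB.IsCyclic) :
    (mixedStructure MA MB Φ).IsMultilinear := by
  have hA' : (boundaryStructure MA).IsMultilinear := (isHomogeneousFamily_boundary hA).isMultilinear
  have hB' : (boundaryStructure MB).IsMultilinear := (isHomogeneousFamily_boundary hB).isMultilinear
  have hφA : (phiA Φ).IsMultilinear := (isHomogeneousFamily_phiA hΦ).isMultilinear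
  have hφB : (phiB Φ).IsMultilinear := (isHomogeneousFamily_phiB hΦ).isMultilinear
  have hA := fun x y n => mixedFst_mixedStructure (MB := MB) (Φ := Φ) hA (x := x) (y := y) (n := n)
  have hB := fun x y n => mixedSnd_mixedStructure (MA := MA) (Φ := Φ) hB (x := x) (y := y) (n := n)
  refine ⟨fun s p a b t => ?_, fun s p c a t => ?_, mixedStructure_nil⟩
  · refine DFinsupp.ext fun n => mixed_ext ?_ ?_
    · rw [DirectSum.add_apply, map_add, hA, hA, hA, ← map_add, ← DirectSum.add_apply]
      exact congrArg (fun c => mixedFst d A A id _ _ n (c n))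
        ((cutSum_multilinear hφA (hA'.toTot _ _)).map_add s a b t)
    · rw [DirectSum.add_apply, map_add, hB, hB, hB, ← map_add, ← DirectSum.add_apply]
      exact congrArg (fun c => mixedSnd d B B id _ _ n (c n))
        ((cutSum_multilinear hφB (hB'.toTot _ _)).map_add s a b t)
  · refine DFinsupp.ext fun n => mixed_ext ?_ ?_
    · rw [DirectSum.smul_apply, map_smul, hA, hA, ← map_smul, ← DirectSum.smul_apply]
      exact congrArg (fun c => mixedFst d A A id _ _ n (c n))
        ((cutSum_multilinear hφA (hA'.toTot _ _)).map_smul s c a t)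
    · rw [DirectSum.smul_apply, map_smul, hB, hB, ← map_smul, ← DirectSum.smul_apply]
      exact congrArg (fun c => mixedSnd d B B id _ _ n (c n))
        ((cutSum_multilinear hφB (hB'.toTot _ _)).map_smul s c a t)

/-- The outer operation is replaced by that of a target composed with `φ_A` for the `A`-part, and
with `φ_B` for the `B^*`-part. The morphism equations, which do not presuppose that the source is an
`A∞`-category, then reduce each part to the Stasheff identities of that target. -/
theorem isAInfinityStructure_mixed (hA : IsPreCY MA) (hB : IsPreCY MB)
    (hΦ : IsPreCYMorphism MA MB Φ) : IsAInfinityStructure (mixedStructure MA MB Φ) := by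
  have hmul := isMultilinear_mixedStructure hΦ.cyclic hA.cyclic hB.cyclic
  refine ⟨hmul, fun q => DFinsupp.ext fun n => ?_⟩
  rw [hmul.insertSum_eq mixedStructure_nil, Tot_apply_sumSplits₃]
  refine mixed_ext ?_ ?_
  · have h := sumSplits₃_cutSum_eq_zero (isHomogeneousFamily_phiA hΦ.cyclic).isMultilinear
      mixedStructure_nil (isAInfinityStructure_boundary hA)
      (insertSum_phiA hΦ hA.cyclic hB.cyclic) q
    refine (Word.map_sumSplits₃ (mixedFst d A B F₀ _ _ n) q _).trans ?_
    refine Eq.trans ?_ (congrArg (fun c => mixedFst d A A id _ _ n (c n)) h)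
    refine Eq.trans ?_ (congrArg (mixedFst d A A id _ _ n) (Tot_apply_sumSplits₃ q _ n)).symm
    refine Eq.trans ?_ (Word.map_sumSplits₃ (mixedFst d A A id _ _ n) q _).symm
    refine Word.sumSplits₃_congr _ fun _ _ s r t _ => ?_
    rw [Tot_apply_negOnePow_smul, Tot_apply_negOnePow_smul, map_negOnePow_smul,
      map_negOnePow_smul, mixedFst_mixedStructure hA.cyclic]
    rfl
  · have h := sumSplits₃_cutSum_eq_zero (isHomogeneousFamily_phiB hΦ.cyclic).isMultilinear
      mixedStructure_nil (isAInfinityStructure_boundary hB)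
      (insertSum_phiB hΦ hA.cyclic hB.cyclic) q
    refine (Word.map_sumSplits₃ (mixedSnd d A B F₀ _ _ n) q _).trans ?_
    refine Eq.trans ?_ (congrArg (fun c => mixedSnd d B B id _ _ n (c n)) h)
    refine Eq.trans ?_ (congrArg (mixedSnd d B B id _ _ n) (Tot_apply_sumSplits₃ q _ n)).symm
    refine Eq.trans ?_ (Word.map_sumSplits₃ (mixedSnd d B B id _ _ n) q _).symm
    refine Word.sumSplits₃_congr _ fun _ _ s r t _ => ?_
    rw [Tot_apply_negOnePow_smul, Tot_apply_negOnePow_smul, map_negOnePow_smul,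
      map_negOnePow_smul, mixedSnd_mixedStructure hB.cyclic]
    rfl

end AInfinityMorphisms

theorem mainTheorem4 {k : Type u} [Field k] [CharZero k] {O : Type w} {O₂ : Type w₁} (d : ℤ)
    (A : GradedQuiver.{u, v, w} k O) (B : GradedQuiver.{u, v₁, w₁} k O₂)
    (MA : Multi d A A id 1) (hMA : IsPreCY MA) (MB : Multi d B B id 1) (hMB : IsPreCY MB)
    (Φ₀ : O → O₂) (Φ : Multi d A B Φ₀ 0) (hΦ : IsPreCYMorphism MA MB Φ) :
    IsAInfinityMorphism (mixedStructure MA MB Φ) (boundaryStructure MA) id (phiA Φ) ∧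
      IsAInfinityMorphism (mixedStructure MA MB Φ) (boundaryStructure MB) Φ₀ (phiB Φ) := by
  have hmixed := isAInfinityStructure_mixed hMA hMB hΦ
  exact ⟨⟨hmixed, isAInfinityStructure_boundary hMA,
      (isHomogeneousFamily_phiA hΦ.cyclic).isMultilinear,
      insertSum_phiA hΦ hMA.cyclic hMB.cyclic⟩,
    ⟨hmixed, isAInfinityStructure_boundary hMB,
      (isHomogeneousFamily_phiB hΦ.cyclic).isMultilinear,
      insertSum_phiB hΦ hMA.cyclic hMB.cyclic⟩⟩
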